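/- Let $G$ be a connected (finite-dimensional real) Lie group with Lie algebra $\mathfrak g$ and a left Haar measure $dg$, let $h \in \mathfrak g$, and let $\tau$ be an involutive automorphism of the Lie group $G$ with $\tau(\exp th) = \exp th$ for all $t \in \mathbb R$. Let $(U,\mathcal H)$ be a strongly continuous unitary representation of $G$ on a complex Hilbert space, with inner product antilinear in the first argument, and let $J$ be a conjugation on $\mathcal H$ (an antilinear isometric involution) with $J U(g) J = U(\tau(g))$ for all $g \in G$. Let $\partial U(h)$ be the infinitesimal generator of $t \mapsto U(\exp th)$ and let $$\mathtt V := \{ v \in \mathcal D(\Delta^{1/2}) : J\Delta^{1/2}v = v\}, \qquad \Delta := e^{2\pi i\,\partial U(h)},$$ be the standard subspace of $\mathcal H$ with modular operator $\Delta$ and modular conjugation $J$. Let $\mathcal H^\infty$ be the space of smooth vectors with the topology defined by the seminorms $v \mapsto \|dU(x_1)\cdots dU(x_k)v\|$, $k \ge 0$, $x_1,\dots,x_k\in\mathfrak g$, where $dU(x)v = \frac{d}{dt}\big|_{t=0}U(\exp tx)v$, and let $\mathcal H^{-\infty}$ be the space of continuous antilinear functionals on $\mathcal H^\infty$ (distribution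 vectors) with the weak-$*$ topology; $\mathcal H$ is embedded in $\mathcal H^{-\infty}$ by $v \mapsto \langle \cdot, v\rangle$. For $\eta \in \mathcal H^{-\infty}$, $\xi\in\mathcal H^\infty$, $g\in G$ and a test function $\varphi \in C_c^\infty(G,\mathbb R)$ put $$(U^{-\infty}(g)\eta)(\xi) := \eta(U(g)^{-1}\xi), \quad U^{-\infty}(\varphi)\eta := \int_G \varphi(g)\,U^{-\infty}(g)\eta\, dg \in \mathcal H, \quad (J\eta)(\xi) := \overline{\eta(J\xi)}.$$ Let $\mathcal H^{-\infty}_{\rm KMS}$ be the set of those $\eta\in\mathcal H^{-\infty}$ for which the orbit map $t \mapsto U^{-\infty}(\exp th)\eta$ extends to a weak-$*$ continuous map $\Phi : \{z \in \mathbb C : 0 \le \operatorname{Im} z\le \pi\} \to \mathcal H^{-\infty}$ that is weak-$*$ holomorphic on the interior of the strip and satisfies $\Phi(t+\pi i) = J\Phi(t)$ for all $t \in \mathbb R$. Let $\mathcal O \subseteq G$ be open and let $\mathtt E \subseteq \mathcal H^{-\infty}$ be a real linear subspace. Let $\mathsf H^G_{\mathtt E}(\mathcal O)$ be the closure in $\mathcal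 H$ of the real linear span of $\{U^{-\infty}(\varphi)\eta : \varphi\in C_c^\infty(\mathcal O,\mathbb R),\ \eta\in\mathtt E\}$. Then the following are equivalent: (a) $\mathsf H^G_{\mathtt E}(\mathcal O) \subseteq \mathtt V$; (b) $U^{-\infty}(\varphi)\mathtt E \subseteq \mathtt V$ for all $\varphi \in C_c^\infty(\mathcal O,\mathbb R)$; (c) $U^{-\infty}(\varphi)\mathtt E \subseteq \mathcal H^{-\infty}_{\rm KMS}$ for all $\varphi \in C_c^\infty(\mathcal O,\mathbb R)$; (d) $U^{-\infty}(g)\mathtt E \subseteq \mathcal H^{-\infty}_{\rm KMS}$ for every $g \in \mathcal O$. -/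

import Mathlib

open scoped Manifold ContDiff ComplexConjugate

noncomputable section

section Representation

variable (F : Type*) [NormedAddCommGroup F] [NormedSpace ℝ F]
  {G : Type*} [TopologicalSpace G] [ChartedSpace F G] [Group G]
  {H : Type*} [NormedAddCommGroup H] [InnerProductSpace ℂ H]

/-- `γ` is the one-parameter subgroup `t ↦ exp (t h)` of the Lie group `G` that is generated by the
element `h` of its Lie algebra: the smooth homomorphism `ℝ → G` with derivative `h` at `0`. -/
structure IsExpCurve (h : GroupLieAlgebra 𝓘(ℝ, F) G) (γ : ℝ → G) : Prop where
  map_add : ∀ s t : ℝ, γ (s + t) = γ s * γ t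
  contMDiff : ContMDiff 𝓘(ℝ, ℝ) 𝓘(ℝ, F) ∞ γ
  deriv_zero : (mfderiv 𝓘(ℝ, ℝ) 𝓘(ℝ, F) γ 0 (1 : ℝ) : F) = h

variable (G H) in
/-- An antiunitary representation of `G ⋊ {1, τ}`, where `τ` is an involutive automorphism of the
Lie group `G`: a strongly continuous unitary representation `U` of `G`, together with a conjugation
`J` (an antilinear isometric involution, the image of `τ`) such that `J U(g) J = U(τ(g))`. -/
structure AntiunitaryRep where
  /-- the unitary representation of `G` -/
  U : G →* (H ≃ₗᵢ[ℂ] H)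
  continuous_orbit : ∀ v : H, Continuous fun g : G => U g v
  /-- the involutive automorphism of `G` -/
  τ : G ≃* G
  contMDiff_τ : ContMDiff 𝓘(ℝ, F) 𝓘(ℝ, F) ∞ τ
  τ_τ : ∀ g : G, τ (τ g) = g
  /-- the conjugation representing `τ` -/
  J : H ≃ₗᵢ⋆[ℂ] H
  J_J : ∀ v : H, J (J v) = v
  J_U_J : ∀ (g : G) (v : H), J (U g (J v)) = U (τ g) v

/-- The space `H^∞` of smooth vectors: those whose orbit map `g ↦ U(g) v` is smooth. -/
def smoothVectors (U : G →* (H ≃ₗᵢ[ℂ] H)) : Submodule ℂ H where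
  carrier := {v | ContMDiff 𝓘(ℝ, F) 𝓘(ℝ, H) ∞ fun g : G => U g v}
  zero_mem' := by
    simpa using (contMDiff_const : ContMDiff 𝓘(ℝ, F) 𝓘(ℝ, H) ∞ fun _ : G => (0 : H))
  add_mem' := by
    intro v w hv hw
    simp only [Set.mem_ofPred_eq, map_add]
    exact ContMDiff.add hv hw
  smul_mem' := by
    intro c v hv
    have hc : ContDiff ℝ ∞ fun w : H => c • w := contDiff_const_smul c
    simpa [Function.comp_def] using hc.contMDiff.comp hv

/-- The space `H^∞` as a type of its own; it carries its own topology, which is finer than the one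
induced by the norm of `H`. -/
def SmoothVec (U : G →* (H ≃ₗᵢ[ℂ] H)) : Type _ := smoothVectors F U

instance (U : G →* (H ≃ₗᵢ[ℂ] H)) : AddCommGroup (SmoothVec F U) :=
  inferInstanceAs (AddCommGroup (smoothVectors F U))

instance (U : G →* (H ≃ₗᵢ[ℂ] H)) : Module ℂ (SmoothVec F U) :=
  inferInstanceAs (Module ℂ (smoothVectors F U))

variable {F} in
/-- The inclusion `H^∞ → H`. -/
def SmoothVec.toH {U : G →* (H ≃ₗᵢ[ℂ] H)} (ξ : SmoothVec F U) : H :=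
  Subtype.val (p := fun v => v ∈ smoothVectors F U) ξ

variable {F} in
/-- The derived representation: `dU(x) v` is the derivative of the orbit map of `v` at the identity
in the direction of the Lie algebra element `x`, that is, `d/dt U(exp t x) v` at `t = 0`. -/
def derivedRep (U : G →* (H ≃ₗᵢ[ℂ] H)) (x : GroupLieAlgebra 𝓘(ℝ, F) G) (v : H) : H :=
  mfderiv 𝓘(ℝ, F) 𝓘(ℝ, H) (fun g : G => U g v) 1 x

/-- The topology of `H^∞` is defined by the seminorms `v ↦ ‖dU(x₁) ⋯ dU(xₖ) v‖` with `k ≥ 0` and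
`x₁, …, xₖ` in the Lie algebra: the coarsest topology that makes all the linear maps
`v ↦ dU(x₁) ⋯ dU(xₖ) v` from `H^∞` to `H` continuous. -/
instance (U : G →* (H ≃ₗᵢ[ℂ] H)) : TopologicalSpace (SmoothVec F U) :=
  ⨅ l : List (GroupLieAlgebra 𝓘(ℝ, F) G),
    TopologicalSpace.induced (fun ξ : SmoothVec F U => l.foldr (derivedRep U) ξ.toH) inferInstance

/-- The space `H^{-∞}` of distribution vectors: the continuous antilinear functionals on `H^∞`. -/
def distributionVectors (U : G →* (H ≃ₗᵢ[ℂ] H)) : Submodule ℂ (SmoothVec F U → ℂ) where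
  carrier := {η | (∀ ξ ζ, η (ξ + ζ) = η ξ + η ζ) ∧ (∀ (c : ℂ) ξ, η (c • ξ) = conj c * η ξ) ∧
    Continuous η}
  zero_mem' := ⟨by simp, by simp, continuous_const⟩
  add_mem' := by
    rintro η θ ⟨h₁, h₂, h₃⟩ ⟨k₁, k₂, k₃⟩
    refine ⟨fun ξ ζ => ?_, fun c ξ => ?_, h₃.add k₃⟩
    · simp only [Pi.add_apply, h₁, k₁]; ring
    · simp only [Pi.add_apply, h₂, k₂]; ring
  smul_mem' := by
    rintro a η ⟨h₁, h₂, h₃⟩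
    refine ⟨fun ξ ζ => ?_, fun c ξ => ?_, h₃.const_smul a⟩
    · simp only [Pi.smul_apply, h₁, smul_eq_mul]; ring
    · simp only [Pi.smul_apply, h₂, smul_eq_mul]; ring

/-- The embedding of `H` into the functionals on `H^∞`, `v ↦ ⟨·, v⟩` (the inner product is antilinear
in its first argument). -/
def toFunctional (U : G →* (H ≃ₗᵢ[ℂ] H)) (v : H) : SmoothVec F U → ℂ :=
  fun ξ => inner ℂ ξ.toH v

section Action

variable [LieGroup 𝓘(ℝ, F) ∞ G]

variable {F} in
/-- The action `U^∞(g)` of `G` on the space of smooth vectors. -/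
def smoothAct (U : G →* (H ≃ₗᵢ[ℂ] H)) (g : G) (ξ : SmoothVec F U) : SmoothVec F U :=
  ⟨U g ξ.toH, by
    have hξ : ContMDiff 𝓘(ℝ, F) 𝓘(ℝ, H) ∞ fun x : G => U x ξ.toH := ξ.2
    have hg : ContMDiff 𝓘(ℝ, F) 𝓘(ℝ, F) ∞ fun x : G => x * g := contMDiff_mul_right
    change ContMDiff 𝓘(ℝ, F) 𝓘(ℝ, H) ∞ fun x : G => U x (U g ξ.toH)
    simpa [Function.comp_def] using hξ.comp hg⟩

variable {F} in
/-- The action `U^{-∞}(g)` of `G` on distribution vectors: `(U^{-∞}(g) η)(ξ) = η(U(g⁻¹) ξ)`. -/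
def distAct (U : G →* (H ≃ₗᵢ[ℂ] H)) (g : G) (η : SmoothVec F U → ℂ) : SmoothVec F U → ℂ :=
  fun ξ => η (smoothAct U g⁻¹ ξ)

variable {F} in
/-- The integrated action `U^{-∞}(φ) η = ∫ φ(g) U^{-∞}(g) η dg` on distribution vectors, as a weak
integral, for a real function `φ` on `G` and a measure `μ` on `G`. -/
def distInt [MeasurableSpace G] (U : G →* (H ≃ₗᵢ[ℂ] H)) (μ : MeasureTheory.Measure G) (φ : G → ℝ)
    (η : SmoothVec F U → ℂ) : SmoothVec F U → ℂ :=
  fun ξ => ∫ g, (φ g : ℂ) * distAct U g η ξ ∂μ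

end Action

variable {F} in
/-- The action of `J` on smooth vectors. -/
def AntiunitaryRep.smoothJ (ρ : AntiunitaryRep F G H) (ξ : SmoothVec F ρ.U) : SmoothVec F ρ.U :=
  ⟨ρ.J ξ.toH, by
    have hξ : ContMDiff 𝓘(ℝ, F) 𝓘(ℝ, H) ∞ fun x : G => ρ.U x ξ.toH := ξ.2
    have hJ : ContDiff ℝ ∞ fun v : H => ρ.J v := by
      let L : H →L[ℝ] H :=
        { toFun := ρ.J
          map_add' := ρ.J.map_add
          map_smul' := fun r v => by
            have h := ρ.J.map_smulₛₗ (r : ℂ) v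
            rw [Complex.conj_ofReal] at h
            exact h
          cont := ρ.J.continuous }
      exact L.contDiff
    have h : (fun x : G => ρ.U x (ρ.J ξ.toH)) = fun x : G => ρ.J (ρ.U (ρ.τ x) ξ.toH) := by
      funext x
      rw [← ρ.J_U_J, ρ.J_J]
    change ContMDiff 𝓘(ℝ, F) 𝓘(ℝ, H) ∞ fun x : G => ρ.U x (ρ.J ξ.toH)
    rw [h]
    exact hJ.contMDiff.comp (hξ.comp ρ.contMDiff_τ)⟩

variable {F} in
/-- The action of `J` on distribution vectors: `(J η)(ξ)` is the complex conjugate of `η(J ξ)`. -/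
def AntiunitaryRep.distJ (ρ : AntiunitaryRep F G H) (η : SmoothVec F ρ.U → ℂ) :
    SmoothVec F ρ.U → ℂ :=
  fun ξ => conj (η (ρ.smoothJ ξ))

/-- The test functions `C_c^∞(O, ℝ)`: smooth real functions on `G` with compact support in `O`. -/
def testFunctions (O : Set G) : Set (G → ℝ) :=
  {φ | ContMDiff 𝓘(ℝ, F) 𝓘(ℝ, ℝ) ∞ φ ∧ HasCompactSupport φ ∧ tsupport φ ⊆ O}

variable {F} in
/-- The closed real subspace `H_E^G(O)` of `H`: the closure in `H` of the real linear span of the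
vectors `U^{-∞}(φ) η`, with `φ` a real test function on `O` and `η ∈ E`; the distribution vector
`U^{-∞}(φ) η` is identified with the vector `v ∈ H` with `U^{-∞}(φ) η = ⟨·, v⟩`. -/
def netSpace [LieGroup 𝓘(ℝ, F) ∞ G] [MeasurableSpace G] (U : G →* (H ≃ₗᵢ[ℂ] H))
    (μ : MeasureTheory.Measure G) (E : Submodule ℝ (SmoothVec F U → ℂ)) (O : Set G) :
    Submodule ℝ H :=
  (Submodule.span ℝ
    {v : H | ∃ φ ∈ testFunctions F O, ∃ η ∈ E, toFunctional F U v = distInt U μ φ η}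
    ).topologicalClosure

end Representation

section Modular

variable {H : Type*} [NormedAddCommGroup H] [InnerProductSpace ℂ H]

/-- The infinitesimal generator, in the sense of Stone's theorem, of a one-parameter group
`t ↦ V t` of operators: `v ↦ d/dt V(t) v` at `t = 0`, on all `v` for which this derivative exists. -/
def infinitesimalGenerator (V : ℝ → (H ≃ₗᵢ[ℂ] H)) : H →ₗ.[ℂ] H where
  domain :=
    { carrier := {v | DifferentiableAt ℝ (fun t => V t v) 0}
      zero_mem' := by simp
      add_mem' := by
        intro v w hv hw
        simp only [Set.mem_ofPred_eq, map_add]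
        exact DifferentiableAt.add (𝕜 := ℝ) hv hw
      smul_mem' := by
        intro c v hv
        simp only [Set.mem_ofPred_eq, map_smul]
        exact DifferentiableAt.const_smul (𝕜 := ℝ) hv c }
  toFun :=
    { toFun := fun v => deriv (fun t => V t (v : H)) 0
      map_add' := by
        rintro ⟨v, hv⟩ ⟨w, hw⟩
        simp only [Submodule.coe_add, map_add]
        exact deriv_add (𝕜 := ℝ) hv hw
      map_smul' := by
        rintro c ⟨v, hv⟩
        simp only [Submodule.coe_smul, map_smul, RingHom.id_apply]
        exact deriv_const_smul (𝕜 := ℝ) c hv }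

/-- The graph of `v ↦ ∑ₙ (zⁿ/n!) Tⁿ v`, on the vectors `v` in the domains of all powers of `T` for
which the series `∑ₙ (|z|ⁿ/n!) ‖Tⁿ v‖` converges; here `x n = Tⁿ v`. -/
def expSeriesGraph (T : H →ₗ.[ℂ] H) (z : ℂ) : Set (H × H) :=
  {p | ∃ x : ℕ → H, x 0 = p.1 ∧ (∀ n, (x n, x (n + 1)) ∈ T.graph) ∧
    (Summable fun n : ℕ => ‖z‖ ^ n / (n.factorial : ℝ) * ‖x n‖) ∧
    p.2 = ∑' n : ℕ, (z ^ n / (n.factorial : ℂ)) • x n}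

/-- The graph of the (unbounded) operator `e^{zT}`, for a skew-adjoint operator `T`: the closure of
the graph of the exponential series. All vectors of bounded spectral support with respect to `T` are
in the domain of the series, and they form a core of the operator `e^{zT}` of the spectral calculus;
therefore the closure is the graph of that operator. -/
def expGraph (T : H →ₗ.[ℂ] H) (z : ℂ) : Set (H × H) :=
  closure (expSeriesGraph T z)

end Modular

section KMS

variable {F : Type*} [NormedAddCommGroup F] [NormedSpace ℝ F]
  {G : Type*} [TopologicalSpace G] [ChartedSpace F G] [Group G]
  {H : Type*} [NormedAddCommGroup H] [InnerProductSpace ℂ H]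

/-- The standard subspace `V = Fix (J Δ^{1/2})` with modular conjugation `J` and modular operator
`Δ = e^{2πi ∂U(h)}`, where `∂U(h)` is the infinitesimal generator of `t ↦ U(γ t)`, `γ t = exp (t h)`.
As `J` is an involution, `J Δ^{1/2} v = v` says that `(v, J v)` lies on the graph of
`Δ^{1/2} = e^{πi ∂U(h)}`. -/
def AntiunitaryRep.standardSubspace (ρ : AntiunitaryRep F G H) (γ : ℝ → G) : Set H :=
  {v | (v, ρ.J v) ∈ expGraph (infinitesimalGenerator fun t => ρ.U (γ t)) (Real.pi * Complex.I)}

/-- The space `H^{-∞}_KMS`: the distribution vectors `η` whose orbit map `t ↦ U^{-∞}(exp t h) η`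
extends to a map `Φ` from the closed strip `0 ≤ Im z ≤ π` to `H^{-∞}` that is weak-* continuous,
weak-* holomorphic on the open strip, and satisfies `Φ(t + πi) = J Φ(t)` for all real `t`. -/
def AntiunitaryRep.distKMS [LieGroup 𝓘(ℝ, F) ∞ G] (ρ : AntiunitaryRep F G H) (γ : ℝ → G) :
    Set (SmoothVec F ρ.U → ℂ) :=
  {η | η ∈ distributionVectors F ρ.U ∧ ∃ Φ : ℂ → SmoothVec F ρ.U → ℂ,
    (∀ z : ℂ, 0 ≤ z.im → z.im ≤ Real.pi → Φ z ∈ distributionVectors F ρ.U) ∧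
    (∀ t : ℝ, Φ t = distAct ρ.U (γ t) η) ∧
    (∀ ξ, ContinuousOn (fun z => Φ z ξ) {z : ℂ | 0 ≤ z.im ∧ z.im ≤ Real.pi}) ∧
    (∀ ξ, DifferentiableOn ℂ (fun z => Φ z ξ) {z : ℂ | 0 < z.im ∧ z.im < Real.pi}) ∧
    ∀ t : ℝ, Φ (t + Real.pi * Complex.I) = ρ.distJ (Φ t)}

end KMS

end

/-! Membership in `H^{-∞}_KMS` asserts that an analytic continuation exists, and such an assertion
cannot be integrated over `G` directly. The proof replaces it by a family of equations. Convolving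
an orbit along `γ` with a Gaussian of width `δ` gives an entire function of `z`; for a smooth vector
`ξ` its values `ξ_δ(z)` are again smooth. The condition `GaussKMS` says `η(ξ_δ(πi)) = conj (η(J
ξ_δ(0)))` for all `δ` and `ξ`. It only compares values of `η` at two fixed smooth vectors.

For vectors: `e^{πi∂U(h)}` is the closure of its exponential series, Gaussian mollifications of
vectors lie in the domain of the series, and mollification is a bounded operator. Hence `v ∈ V`
exactly when `v_δ(πi) = (Jv)_δ(0)` for all `δ` (`mem_expGraph_iff`). Pairing with the dense space of
smooth vectors turns this into `GaussKMS` for `⟨·, v⟩` (`mem_standardSubspace_iff_gaussKMS`).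

For distribution vectors: if `Φ` is a KMS extension, then `Φ(z)` tested on a Gaussian vector and the
entire mollification agree on the real line, hence on the strip; this gives `GaussKMS`. Conversely,
`GaussKMS` identifies the values of the mollified orbit functions at height `π`. As `δ → 0` they
converge on both boundary lines of the strip, relative to the weight `exp(x²)`, so Phragmén–Lindelöf
gives convergence on the closed strip; the limit is `Φ` (`exists_strip_extension`,
`mem_distKMS_of_gaussKMS`). This uses that orbits of distribution vectors grow at most exponentially
along `γ`: such a vector is a finite sum of derivatives of Hilbert space vectors
(`exists_eq_sum_inner`), and derivatives of `U(γ t) ξ` expand with coefficients from `Ad(γ t)⁻¹`.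

With `GaussKMS` on both sides, (b) ⇔ (c) is a comparison of equations once `U^{-∞}(φ)η` is known to
be a vector; (d) ⇒ (c) is integration against the real function `φ`; (c) ⇒ (d) is the fundamental
lemma of the calculus of variations; (a) ⇔ (b) holds since `V` is a closed real subspace. -/

open scoped Manifold ContDiff ComplexConjugate

set_option linter.unusedSectionVars false

noncomputable section

/-! ### Gaussian mollification of functions of exponential growth -/

section Gaussian

open MeasureTheory Filter Topology Set

/-- Continuous functions on the real line that decay faster than every exponential. -/
def RapidDecay (m : ℝ → ℂ) : Prop :=
  Continuous m ∧ ∀ c : ℝ, Integrable fun t : ℝ => Real.exp (c * |t|) * ‖m t‖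

theorem RapidDecay.integrable_smul {E : Type*} [NormedAddCommGroup E] [NormedSpace ℂ E]
    {m : ℝ → ℂ} (hm : RapidDecay m) {k : ℝ → E} (hk : Continuous k) {C c : ℝ}
    (hC : ∀ t, ‖k t‖ ≤ C * Real.exp (c * |t|)) : Integrable fun t => m t • k t := by
  refine ((hm.2 c).const_mul C).mono' (hm.1.smul hk).aestronglyMeasurable (ae_of_all _ fun t => ?_)
  rw [norm_smul]
  calc ‖m t‖ * ‖k t‖ ≤ ‖m t‖ * (C * Real.exp (c * |t|)) := by gcongr; exact hC t
    _ = _ := by ring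

/-- This stability is the reason for a class wider than the Gaussians: differentiating an orbit
integral multiplies its weight by matrix coefficients of `Ad(γ t)⁻¹`, which can grow exponentially.
-/
theorem RapidDecay.mul {m p : ℝ → ℂ} (hm : RapidDecay m) (hp : Continuous p) {C c : ℝ}
    (hC : ∀ t, ‖p t‖ ≤ C * Real.exp (c * |t|)) : RapidDecay fun t => m t * p t := by
  refine ⟨hm.1.mul hp, fun d => ?_⟩
  refine ((hm.2 (d + c)).const_mul C).mono'
    (by have := hm.1; fun_prop) (ae_of_all _ fun t => ?_)
  rw [norm_mul, norm_norm, norm_mul, Real.norm_of_nonneg (Real.exp_pos _).le, add_mul,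
    Real.exp_add]
  calc Real.exp (d * |t|) * (‖m t‖ * ‖p t‖)
      ≤ Real.exp (d * |t|) * (‖m t‖ * (C * Real.exp (c * |t|))) := by gcongr; exact hC t
    _ = _ := by ring

/-- The Gaussian kernel of width `δ`, as an entire function. -/
def gaussKernel (δ : ℝ) (z : ℂ) : ℂ := ((δ * √Real.pi)⁻¹ : ℝ) * Complex.exp (-(z / δ) ^ 2)

theorem continuous_gaussKernel (δ : ℝ) : Continuous (gaussKernel δ) := by
  unfold gaussKernel; fun_prop

theorem gaussKernel_neg (δ : ℝ) (z : ℂ) : gaussKernel δ (-z) = gaussKernel δ z := by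
  simp [gaussKernel, neg_div]

theorem conj_gaussKernel (δ : ℝ) (z : ℂ) : conj (gaussKernel δ z) = gaussKernel δ (conj z) := by
  simp [gaussKernel, ← Complex.exp_conj]

theorem norm_gaussKernel {δ : ℝ} (hδ : 0 < δ) (x y : ℝ) :
    ‖gaussKernel δ (x - y * Complex.I)‖ = Real.exp (y ^ 2 / δ ^ 2) * ‖gaussKernel δ x‖ := by
  have h : ∀ y : ℝ, ‖gaussKernel δ (x - y * Complex.I)‖ =
      (δ * √Real.pi)⁻¹ * Real.exp (y ^ 2 / δ ^ 2 - x ^ 2 / δ ^ 2) := by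
    intro y
    have hr : (-(((x : ℂ) - y * Complex.I) / δ) ^ 2).re = y ^ 2 / δ ^ 2 - x ^ 2 / δ ^ 2 := by
      have : -(((x : ℂ) - y * Complex.I) / δ) ^ 2 =
          ((y ^ 2 / δ ^ 2 - x ^ 2 / δ ^ 2 : ℝ) : ℂ) + ((2 * x * y / δ ^ 2 : ℝ) : ℂ) * Complex.I := by
        push_cast
        rw [div_pow, sub_sq, mul_pow, Complex.I_sq]
        ring
      rw [this]; simp only [Complex.add_re, Complex.ofReal_re, Complex.re_ofReal_mul, Complex.I_re,
        mul_zero, add_zero]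
    rw [gaussKernel, norm_mul, Complex.norm_exp, hr, Complex.norm_real,
      Real.norm_of_nonneg (by positivity)]
  have h0 := h 0
  simp only [Complex.ofReal_zero, zero_mul, sub_zero] at h0
  rw [h y, h0, sub_eq_add_neg, Real.exp_add]
  norm_num
  ring

theorem integrable_exp_mul_abs_gaussian {a : ℝ} (ha : 0 < a) (c : ℝ) :
    Integrable fun t : ℝ => Real.exp (c * |t|) * Real.exp (-a * t ^ 2) := by
  have key : ∀ d : ℝ, Integrable fun t : ℝ => Real.exp (d * t) * Real.exp (-a * t ^ 2) := by
    intro d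
    have := (integrable_cexp_quadratic (b := (a : ℂ)) (by simpa using ha) d 0).norm
    refine this.congr (ae_of_all _ fun t => ?_)
    simp only [Complex.norm_exp]
    rw [← Real.exp_add]
    congr 1
    simp [← Complex.ofReal_pow]
    ring
  refine ((key c).add (key (-c))).mono' (by fun_prop) (ae_of_all _ fun t => ?_)
  rw [Real.norm_of_nonneg (by positivity)]
  simp only [Pi.add_apply, ← add_mul]
  gcongr
  rcases abs_cases t with ⟨h, -⟩ | ⟨h, -⟩ <;> rw [h]
  · linarith [Real.exp_pos (-c * t)]
  · rw [mul_neg, ← neg_mul]; linarith [Real.exp_pos (c * t)]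

/-- The cross term in `(t - z)²` costs only an exponential in `|t|`, so Gaussian decay survives
uniformly for bounded `z`. This is the domination for differentiating in `z`. -/
theorem norm_gaussKernel_sub_le {δ : ℝ} (hδ : 0 < δ) {R : ℝ} {z : ℂ} (hz : ‖z‖ ≤ R) (t : ℝ) :
    ‖gaussKernel δ (t - z)‖ ≤ (δ * √Real.pi)⁻¹ * Real.exp (R ^ 2 / δ ^ 2) *
      (Real.exp (2 * R / δ ^ 2 * |t|) * Real.exp (-(δ ^ 2)⁻¹ * t ^ 2)) := by
  rw [gaussKernel, norm_mul, Complex.norm_exp, Complex.norm_real,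
      Real.norm_of_nonneg (by positivity), mul_assoc, ← Real.exp_add, ← Real.exp_add]
  gcongr
  have h1 : -(((t : ℂ) - z) / δ) ^ 2 =
      ((-(δ ^ 2)⁻¹ * t ^ 2 : ℝ) : ℂ) + (2 * t * z - z ^ 2) * ((1 / δ ^ 2 : ℝ) : ℂ) := by
    push_cast
    ring
  rw [h1, Complex.add_re, Complex.ofReal_re, Complex.re_mul_ofReal]
  have hR : 0 ≤ R := (norm_nonneg z).trans hz
  have h2 : (2 * t * z - z ^ 2).re ≤ 2 * |t| * R + R ^ 2 := by
    refine (Complex.re_le_norm _).trans ((norm_sub_le _ _).trans ?_)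
    rw [norm_mul, norm_mul, norm_pow, Complex.norm_real, Real.norm_eq_abs]
    norm_num
    gcongr
  have h3 : (2 * t * z - z ^ 2).re * (1 / δ ^ 2) ≤ (2 * |t| * R + R ^ 2) * (1 / δ ^ 2) := by
    gcongr
  have h4 : (2 * |t| * R + R ^ 2) * (1 / δ ^ 2) = R ^ 2 / δ ^ 2 + 2 * R / δ ^ 2 * |t| := by ring
  linarith

theorem rapidDecay_gaussKernel {δ : ℝ} (hδ : 0 < δ) (z : ℂ) :
    RapidDecay fun t => gaussKernel δ (t - z) := by
  have hc : Continuous fun t : ℝ => gaussKernel δ (t - z) := by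
    have := continuous_gaussKernel δ; fun_prop
  refine ⟨hc, fun c => ?_⟩
  refine ((integrable_exp_mul_abs_gaussian (a := (δ ^ 2)⁻¹) (by positivity)
    (c + 2 * ‖z‖ / δ ^ 2)).const_mul ((δ * √Real.pi)⁻¹ * Real.exp (‖z‖ ^ 2 / δ ^ 2))).mono'
    (by fun_prop) (ae_of_all _ fun t => ?_)
  rw [norm_mul, norm_norm, Real.norm_of_nonneg (Real.exp_pos _).le, add_mul, Real.exp_add]
  refine (mul_le_mul_of_nonneg_left (norm_gaussKernel_sub_le hδ le_rfl t)
    (Real.exp_pos _).le).trans_eq ?_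
  ring

theorem rapidDecay_gaussKernel_ofReal {δ : ℝ} (hδ : 0 < δ) :
    RapidDecay fun t => gaussKernel δ t := by
  simpa using rapidDecay_gaussKernel hδ 0

section Mollify

variable {E : Type*} [NormedAddCommGroup E] [NormedSpace ℂ E]

/-- The convolution of a function on the real line with the Gaussian kernel of width `δ`, as a
function of a complex variable. -/
def mollify (δ : ℝ) (k : ℝ → E) (z : ℂ) : E := ∫ t : ℝ, gaussKernel δ (t - z) • k t

theorem integrable_mollify {δ : ℝ} (hδ : 0 < δ) {k : ℝ → E} (hk : Continuous k) {C c : ℝ}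
    (hC : ∀ t, ‖k t‖ ≤ C * Real.exp (c * |t|)) (z : ℂ) :
    Integrable fun t : ℝ => gaussKernel δ (t - z) • k t :=
  (rapidDecay_gaussKernel hδ z).integrable_smul hk hC

theorem mollify_translate (δ : ℝ) (k : ℝ → E) (z : ℂ) (s : ℝ) :
    mollify δ (fun t => k (t + s)) z = mollify δ k (z + s) := by
  rw [mollify, mollify,
    ← integral_add_right_eq_self (fun t : ℝ => gaussKernel δ (t - (z + s)) • k t) s]
  congr 1 with t
  congr 2
  push_cast
  ring

theorem mollify_comp_neg (δ : ℝ) (k : ℝ → E) (z : ℂ) :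
    mollify δ (fun t => k (-t)) z = mollify δ k (-z) := by
  rw [mollify, mollify, ← integral_neg_eq_self]
  congr 1 with t
  rw [neg_neg, ← gaussKernel_neg]
  congr 2
  push_cast
  ring

theorem mollify_conj (δ : ℝ) (k : ℝ → ℂ) (z : ℂ) :
    mollify δ (fun t => conj (k t)) z = conj (mollify δ k (conj z)) := by
  rw [mollify, mollify, ← integral_conj]
  congr 1 with t
  simp [conj_gaussKernel]

/-- All dependence on `z` sits in the entire kernel, so `k` need only be continuous and of
exponential growth. -/
theorem differentiable_mollify [CompleteSpace E] {δ : ℝ} (hδ : 0 < δ) {k : ℝ → E}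
    (hk : Continuous k) {C c : ℝ} (hC : ∀ t, ‖k t‖ ≤ C * Real.exp (c * |t|)) :
    Differentiable ℂ (mollify δ k) := by
  intro z₀
  have hg := continuous_gaussKernel δ
  set R : ℝ := ‖z₀‖ + 1
  set F' : ℂ → ℝ → E := fun z t => (gaussKernel δ (t - z) * (2 * (t - z) / δ ^ 2)) • k t
  set A : ℝ := (δ * √Real.pi)⁻¹ * Real.exp (R ^ 2 / δ ^ 2)
  have hbound : ∀ᵐ t : ℝ, ∀ z ∈ Metric.ball z₀ 1, ‖F' z t‖ ≤
      A * (2 / δ ^ 2) * Real.exp R * C *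
        (Real.exp ((2 * R / δ ^ 2 + 1 + c) * |t|) * Real.exp (-(δ ^ 2)⁻¹ * t ^ 2)) := by
    refine ae_of_all _ fun t z hz => ?_
    have hzR : ‖z‖ ≤ R := by
      have h1 : ‖z - z₀‖ < 1 := by simpa [dist_eq_norm] using hz
      have h2 : ‖z‖ ≤ ‖z₀‖ + ‖z - z₀‖ := by simpa using norm_add_le z₀ (z - z₀)
      linarith
    -- The linear factor produced by the derivative is absorbed into an exponential, which keeps the
    -- bound in the same integrable family.
    have h1 : ‖(2 * ((t : ℂ) - z) / δ ^ 2)‖ ≤ 2 / δ ^ 2 * (Real.exp R * Real.exp |t|) := by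
      rw [norm_div, norm_mul, norm_pow, Complex.norm_real, Real.norm_of_nonneg hδ.le,
        ← Real.exp_add]
      have h3 : ‖(t : ℂ) - z‖ ≤ Real.exp (R + |t|) := by
        refine (norm_sub_le _ _).trans ?_
        rw [Complex.norm_real, Real.norm_eq_abs]
        linarith [Real.add_one_le_exp (R + |t|)]
      norm_num
      rw [mul_div_right_comm]
      gcongr
    rw [norm_smul, norm_mul]
    calc _ ≤ (A * (Real.exp (2 * R / δ ^ 2 * |t|) * Real.exp (-(δ ^ 2)⁻¹ * t ^ 2))) *
          (2 / δ ^ 2 * (Real.exp R * Real.exp |t|)) * (C * Real.exp (c * |t|)) := by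
          gcongr
          · exact norm_gaussKernel_sub_le hδ hzR t
          · exact hC t
      _ = _ := by
          rw [add_mul _ c, add_mul _ (1 : ℝ), Real.exp_add _ (c * |t|), Real.exp_add _ (1 * |t|),
            one_mul]
          ring
  have hd : ∀ᵐ t : ℝ, ∀ z ∈ Metric.ball z₀ 1,
      HasDerivAt (fun z => gaussKernel δ (t - z) • k t) (F' z t) z := by
    refine ae_of_all _ fun t z _ => HasDerivAt.smul_const ?_ _
    have h1 : HasDerivAt (fun z : ℂ => -(((t : ℂ) - z) / δ) ^ 2) (2 * (t - z) / δ ^ 2) z := by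
      have h0 := ((((hasDerivAt_id z).const_sub (t : ℂ)).div_const (δ : ℂ)).pow 2).neg
      refine h0.congr_deriv ?_
      simp
      ring
    have := (h1.cexp).const_mul (((δ * √Real.pi)⁻¹ : ℝ) : ℂ)
    refine this.congr_deriv ?_
    rw [gaussKernel, mul_assoc]
  have := hasDerivAt_integral_of_dominated_loc_of_deriv_le (μ := volume)
    (F := fun z (t : ℝ) => gaussKernel δ (t - z) • k t) (Metric.ball_mem_nhds z₀ one_pos)
    (Eventually.of_forall fun z => (integrable_mollify hδ hk hC z).aestronglyMeasurable)
    (integrable_mollify hδ hk hC z₀) (F' := F')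
    (by apply Continuous.aestronglyMeasurable; fun_prop) hbound
    ((integrable_exp_mul_abs_gaussian (by positivity) _).const_mul _) hd
  exact this.2.differentiableAt

/-- The exponential moments of the Gaussian kernel. -/
def gaussMoment (δ c : ℝ) : ℝ := ∫ t : ℝ, Real.exp (c * |t|) * ‖gaussKernel δ t‖

theorem gaussMoment_nonneg (δ c : ℝ) : 0 ≤ gaussMoment δ c := 
  integral_nonneg fun _ => by positivity

/-- The real part of the argument is moved into `k` by translation; the imaginary part costs
`exp(y²/δ²)`. The bound degenerates as `δ → 0` and serves on the strip only as the a priori growth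
needed for Phragmén–Lindelöf. -/
theorem norm_mollify_le {δ : ℝ} (hδ : 0 < δ) {k : ℝ → E} {C c : ℝ} (hc : 0 ≤ c) (hC0 : 0 ≤ C)
    (hC : ∀ t, ‖k t‖ ≤ C * Real.exp (c * |t|)) (x y : ℝ) :
    ‖mollify δ k (x + y * Complex.I)‖ ≤
      C * Real.exp (c * |x|) * Real.exp (y ^ 2 / δ ^ 2) * gaussMoment δ c := by
  rw [add_comm, ← mollify_translate, gaussMoment, ← integral_const_mul]
  refine norm_integral_le_of_norm_le (((rapidDecay_gaussKernel_ofReal hδ).2 c).const_mul _)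
    (ae_of_all _ fun t => ?_)
  rw [norm_smul, norm_gaussKernel hδ]
  have h1 : ‖k (t + x)‖ ≤ C * (Real.exp (c * |t|) * Real.exp (c * |x|)) := by
    refine (hC _).trans ?_
    rw [← Real.exp_add, ← mul_add]
    gcongr
    exact abs_add_le t x
  calc _ ≤ Real.exp (y ^ 2 / δ ^ 2) * ‖gaussKernel δ t‖ *
      (C * (Real.exp (c * |t|) * Real.exp (c * |x|))) := by gcongr
    _ = _ := by ring

/-- Rescaling moves `δ` from the kernel into `k`. The right-hand side makes sense at `δ = 0`, where
it is `k x`, so convergence as `δ → 0` becomes joint continuity in `(δ, x)`. -/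
theorem mollify_ofReal_eq {δ : ℝ} (hδ : 0 < δ) (k : ℝ → E) (x : ℝ) :
    mollify δ k x = ∫ s : ℝ, gaussKernel 1 s • k (x + δ * s) := by
  have h1 := mollify_translate δ k 0 x
  rw [zero_add] at h1
  rw [← h1, mollify]
  have h2 := Measure.integral_comp_mul_left
    (fun t : ℝ => gaussKernel δ ((t : ℂ) - 0) • k (t + x)) δ
  have h3 : (∫ s : ℝ, gaussKernel 1 s • k (x + δ * s)) =
      ∫ s : ℝ, δ • (gaussKernel δ (((δ * s : ℝ) : ℂ) - 0) • k (δ * s + x)) := by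
    congr 1 with s
    have hδ' : (δ : ℂ) ≠ 0 := by exact_mod_cast hδ.ne'
    rw [add_comm (δ * s), ← smul_assoc]
    congr 1
    simp only [gaussKernel]
    push_cast
    rw [Complex.real_smul, sub_zero, mul_div_cancel_left₀ _ hδ', mul_inv]
    field_simp
  rw [h3, integral_smul, h2, abs_of_pos (by positivity), smul_smul, mul_inv_cancel₀ hδ.ne',
    one_smul]

theorem integral_gaussKernel_one : ∫ s : ℝ, gaussKernel 1 s = 1 := by
  have h : ∀ s : ℝ, gaussKernel 1 s = (((√Real.pi)⁻¹ * Real.exp (-1 * s ^ 2) : ℝ) : ℂ) := by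
    intro s
    simp [gaussKernel]
  simp_rw [h]
  rw [integral_complex_ofReal, integral_const_mul, integral_gaussian]
  rw [div_one, inv_mul_cancel₀ (by positivity), Complex.ofReal_one]

theorem norm_integral_gaussKernel_one_le {k : ℝ → E} {C c δ : ℝ} (hc : 0 ≤ c) (hC0 : 0 ≤ C)
    (hC : ∀ t, ‖k t‖ ≤ C * Real.exp (c * |t|)) (hδ : |δ| ≤ 1) (x : ℝ) :
    ‖∫ s : ℝ, gaussKernel 1 s • k (x + δ * s)‖ ≤ C * Real.exp (c * |x|) * gaussMoment 1 c := by
  rw [gaussMoment, ← integral_const_mul]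
  refine norm_integral_le_of_norm_le (((rapidDecay_gaussKernel_ofReal one_pos).2 c).const_mul _)
    (ae_of_all _ fun s => ?_)
  have h1 : ‖k (x + δ * s)‖ ≤ C * (Real.exp (c * |x|) * Real.exp (c * |s|)) := by
    refine (hC _).trans ?_
    rw [← Real.exp_add, ← mul_add]
    gcongr
    refine (abs_add_le _ _).trans ?_
    rw [abs_mul]
    gcongr
    exact mul_le_of_le_one_left (abs_nonneg s) hδ
  rw [norm_smul]
  calc _ ≤ ‖gaussKernel 1 s‖ * (C * (Real.exp (c * |x|) * Real.exp (c * |s|))) := by gcongr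
    _ = _ := by ring

theorem continuous_integral_gaussKernel_one {k : ℝ → E} (hk : Continuous k) {C c : ℝ}
    (hc : 0 ≤ c) (hC0 : 0 ≤ C) (hC : ∀ t, ‖k t‖ ≤ C * Real.exp (c * |t|)) :
    Continuous fun p : ℝ × ℝ => ∫ s : ℝ, gaussKernel 1 s • k (p.2 + p.1 * s) := by
  have hg := continuous_gaussKernel 1
  refine continuous_iff_continuousAt.2 fun p₀ => ?_
  set R : ℝ := ‖p₀‖ + 1
  refine continuousAt_of_dominated
    (bound := fun s => C * Real.exp (c * R) * (Real.exp ((c * R) * |s|) * ‖gaussKernel 1 s‖))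
    (Eventually.of_forall fun p => by apply Continuous.aestronglyMeasurable; fun_prop) ?_
    (((rapidDecay_gaussKernel_ofReal one_pos).2 _).const_mul _)
    (ae_of_all _ fun s => by fun_prop)
  have hn : ∀ᶠ p : ℝ × ℝ in 𝓝 p₀, ‖p‖ < R :=
    continuous_norm.continuousAt.eventually_lt continuousAt_const (by simp [R])
  filter_upwards [hn] with p hp
  refine ae_of_all _ fun s => ?_
  have h2 : |p.2| ≤ R := (norm_snd_le p).trans hp.le
  have h3 : |p.1| ≤ R := (norm_fst_le p).trans hp.le
  have h1 : ‖k (p.2 + p.1 * s)‖ ≤ C * (Real.exp (c * R) * Real.exp (c * R * |s|)) := by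
    refine (hC _).trans ?_
    rw [← Real.exp_add, mul_assoc c, ← mul_add]
    gcongr
    refine (abs_add_le _ _).trans ?_
    rw [abs_mul]
    gcongr
  rw [norm_smul]
  calc _ ≤ ‖gaussKernel 1 s‖ * (C * (Real.exp (c * R) * Real.exp (c * R * |s|))) := by gcongr
    _ = _ := by ring

theorem integral_gaussKernel_one_smul [CompleteSpace E] (v : E) :
    ∫ s : ℝ, gaussKernel 1 s • v = v := by
  rw [integral_smul_const, integral_gaussKernel_one, one_smul]

theorem tendsto_mollify_ofReal [CompleteSpace E] {k : ℝ → E} (hk : Continuous k) {C c : ℝ}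
    (hc : 0 ≤ c) (hC0 : 0 ≤ C) (hC : ∀ t, ‖k t‖ ≤ C * Real.exp (c * |t|)) (x : ℝ) :
    Tendsto (fun δ => mollify δ k x) (𝓝[>] 0) (𝓝 (k x)) := by
  have h := ((continuous_integral_gaussKernel_one hk hc hC0 hC).comp
    (Continuous.prodMk continuous_id (continuous_const (y := x)))).tendsto 0
  simp only [Function.comp_def, id, zero_mul, add_zero, integral_gaussKernel_one_smul] at h
  refine (h.mono_left nhdsWithin_le_nhds).congr' ?_
  filter_upwards [self_mem_nhdsWithin] with δ hδ
  rw [mollify_ofReal_eq hδ]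

end Mollify

end Gaussian

/-! ### Holomorphic functions on the strip and their boundary values -/

section Strip

open MeasureTheory Filter Topology Set

/-- A continuous function on the closed strip that is holomorphic on the open strip and vanishes on
the real line vanishes on the strip. -/
theorem eq_zero_of_eq_zero_on_real {h : ℂ → ℂ}
    (hc : ContinuousOn h (Complex.im ⁻¹' Icc 0 Real.pi))
    (hd : DifferentiableOn ℂ h (Complex.im ⁻¹' Ioo 0 Real.pi)) (h0 : ∀ t : ℝ, h t = 0) :
    ∀ z ∈ Complex.im ⁻¹' Icc 0 Real.pi, h z = 0 := by
  have hpi : (1 : ℝ) < Real.pi := by linarith [Real.pi_gt_three]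
  set U : Set ℂ := Ioo (-1 : ℝ) 1 ×ℂ Ioo (0 : ℝ) 1 with hU
  have hcl : closure U = Icc (-1 : ℝ) 1 ×ℂ Icc (0 : ℝ) 1 := by
    rw [hU, Complex.closure_reProdIm, closure_Ioo (by norm_num), closure_Ioo (by norm_num)]
  have hclS : closure U ⊆ Complex.im ⁻¹' Icc 0 Real.pi := by
    rw [hcl]
    intro z hz
    exact ⟨hz.2.1, hz.2.2.trans hpi.le⟩
  have hUS : U ⊆ Complex.im ⁻¹' Ioo 0 Real.pi := fun z hz => ⟨hz.2.1, hz.2.2.trans hpi⟩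
  have hbdd : Bornology.IsBounded U := (Metric.isBounded_Ioo _ _).reProdIm (Metric.isBounded_Ioo _ _)
  obtain ⟨M, hM⟩ := hbdd.isCompact_closure.exists_bound_of_continuousOn (hc.mono hclS)
  have hM0 : 0 ≤ M := (norm_nonneg _).trans (hM 0 (by rw [hcl]; simp [Complex.mem_reProdIm]))
  -- `Re q` is negative on the three sides of the rectangle off the real line and positive at
  -- interior points near `0`. By the maximum principle `h · exp(N q)` is bounded by `M` for every
  -- `N`, since `h` vanishes on the fourth side; letting `N` grow forces `h = 0` wherever `Re q >
  -- 0`.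
  set q : ℂ → ℂ := fun z => 1 / 2 - z ^ 2 + 2 * Complex.I * z with hq
  have hqre : ∀ z, (q z).re = 1 / 2 - z.re ^ 2 + z.im ^ 2 - 2 * z.im := by
    intro z
    simp [hq, pow_two]
    ring
  have hqd : Differentiable ℂ q := by fun_prop
  have key : ∀ z ∈ U, 0 < (q z).re → h z = 0 := by
    intro z hz hqz
    have hN : ∀ N : ℕ, ‖h z * Complex.exp (N * q z)‖ ≤ M := by
      intro N
      refine Complex.norm_le_of_forall_mem_frontier_norm_le (f := fun z => h z * Complex.exp (N * q z))
        hbdd ⟨?_, ?_⟩ ?_ (subset_closure hz)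
      · exact (hd.mono hUS).mul (by fun_prop)
      · exact (hc.mono hclS).mul (by fun_prop)
      · intro w hw
        have hwcl : w ∈ closure U := frontier_subset_closure hw
        have hw' := hwcl
        rw [hcl] at hw'
        by_cases him : w.im = 0
        · have : w = (w.re : ℂ) := Complex.ext rfl (by simpa using him)
          rw [this, h0]
          simpa using hM0
        · have hqw : (q w).re ≤ 0 := by
            by_contra hcon
            push Not at hcon
            rw [hqre] at hcon
            obtain ⟨⟨h1, h2⟩, h3, h4⟩ := hw'
            have h3' : 0 < w.im := lt_of_le_of_ne h3 (Ne.symm him)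
            apply hw.2
            rw [((isOpen_Ioo).reProdIm isOpen_Ioo).interior_eq]
            refine ⟨⟨lt_of_le_of_ne h1 ?_, lt_of_le_of_ne h2 ?_⟩, h3', lt_of_le_of_ne h4 ?_⟩
            · intro hx
              rw [← hx] at hcon
              nlinarith
            · intro hx
              rw [hx] at hcon
              nlinarith
            · intro hx
              rw [hx] at hcon
              nlinarith [sq_nonneg w.re]
          rw [norm_mul, Complex.norm_exp]
          have : ((N : ℂ) * q w).re = N * (q w).re := by simp
          rw [this]
          calc _ ≤ M * 1 := by
                refine mul_le_mul (hM w hwcl) ?_ (Real.exp_pos _).le hM0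
                exact Real.exp_le_one_iff.2 (mul_nonpos_of_nonneg_of_nonpos N.cast_nonneg hqw)
            _ = M := mul_one M
    by_contra hne
    have hpos : 0 < ‖h z‖ := norm_pos_iff.2 hne
    obtain ⟨N, hN'⟩ := exists_nat_gt (M / ‖h z‖ / (q z).re)
    have h1 := hN N
    rw [norm_mul, Complex.norm_exp] at h1
    have : ((N : ℂ) * q z).re = N * (q z).re := by simp
    rw [this] at h1
    rw [div_lt_iff₀ hqz, div_lt_iff₀ hpos] at hN'
    nlinarith [Real.add_one_le_exp (N * (q z).re)]
  have hopen : IsOpen (Complex.im ⁻¹' Ioo 0 Real.pi) := isOpen_Ioo.preimage Complex.continuous_im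
  have hconn : IsPreconnected (Complex.im ⁻¹' Ioo 0 Real.pi) :=
    ((convex_Ioo (0 : ℝ) Real.pi).linear_preimage Complex.imLm).isPreconnected
  -- The point `i/16` lies in the rectangle and has `Re q > 0`; the identity theorem spreads the
  -- zero from there.
  have hev : h =ᶠ[𝓝 (Complex.I / 16)] 0 := by
    have hmem : {z : ℂ | z ∈ U ∧ 0 < (q z).re} ∈ 𝓝 (Complex.I / 16) := by
      refine IsOpen.mem_nhds ?_ ⟨?_, ?_⟩
      · exact ((isOpen_Ioo).reProdIm isOpen_Ioo).inter
          (isOpen_lt continuous_const (Complex.continuous_re.comp hqd.continuous))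
      · rw [hU, Complex.mem_reProdIm]; norm_num
      · rw [hqre]; norm_num
    filter_upwards [hmem] with z hz using key z hz.1 hz.2
  have hzero := (hd.analyticOnNhd hopen).eqOn_zero_of_preconnected_of_eventuallyEq_zero hconn
    (by (constructor <;> norm_num); linarith) hev
  have := hzero.of_subset_closure hc continuousOn_const
    (preimage_mono Ioo_subset_Icc_self) (by
      rw [Complex.closure_preimage_im, closure_Ioo (by positivity)])
  exact fun z hz => this hz

/-- Phragmén–Lindelöf on the strip for entire functions of exponential growth, with the boundary
values measured by a Gaussian weight. -/
theorem norm_le_of_strip_boundary {f : ℂ → ℂ} (hf : Differentiable ℂ f) {A c D : ℝ}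
    (hgrowth : ∀ x y : ℝ, 0 ≤ y → y ≤ Real.pi →
      ‖f (x + y * Complex.I)‖ ≤ A * Real.exp (c * |x|))
    (hbot : ∀ x : ℝ, ‖f x‖ ≤ D * Real.exp (x ^ 2))
    (htop : ∀ x : ℝ, ‖f (x + Real.pi * Complex.I)‖ ≤ D * Real.exp (x ^ 2))
    {z : ℂ} (hz : z ∈ Complex.im ⁻¹' Icc 0 Real.pi) :
    ‖Complex.exp (-z ^ 2) * f z‖ ≤ D * Real.exp (Real.pi ^ 2) := by
  have hexp : ∀ z : ℂ, ‖Complex.exp (-z ^ 2)‖ = Real.exp (z.im ^ 2 - z.re ^ 2) := by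
    intro z
    rw [Complex.norm_exp]
    congr 1
    simp [pow_two]
  have hA : 0 ≤ A := by
    have h1 := hgrowth 0 0 le_rfl Real.pi_pos.le
    simp only [abs_zero, mul_zero, Real.exp_zero, mul_one] at h1
    exact (norm_nonneg _).trans h1
  have hD : 0 ≤ D := by
    have h1 := hbot 0
    norm_num at h1
    exact (norm_nonneg _).trans h1
  refine PhragmenLindelof.horizontal_strip (f := fun z => Complex.exp (-z ^ 2) * f z)
    (a := 0) (b := Real.pi) ?_ ?_ ?_ ?_ hz.1 hz.2
  · exact Differentiable.diffContOnCl (by fun_prop)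
  · refine ⟨0, by have := Real.pi_pos; positivity, 0, ?_⟩
    simp only [zero_mul, Real.exp_zero]
    refine Asymptotics.IsBigO.of_bound (A * Real.exp (Real.pi ^ 2) * Real.exp (c ^ 2)) ?_
    refine eventually_inf_principal.2 (Eventually.of_forall fun z hz => ?_)
    rw [norm_mul, hexp, norm_one, mul_one]
    have h1 := hgrowth z.re z.im hz.1.le hz.2.le
    rw [Complex.re_add_im] at h1
    calc _ ≤ Real.exp (z.im ^ 2 - z.re ^ 2) * (A * Real.exp (c * |z.re|)) := by gcongr
      _ = A * Real.exp (z.im ^ 2 - z.re ^ 2 + c * |z.re|) := by rw [Real.exp_add]; ring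
      _ ≤ A * Real.exp (Real.pi ^ 2 + c ^ 2) := by
        refine mul_le_mul_of_nonneg_left (Real.exp_le_exp.2 ?_) hA
        have h2 : z.im ^ 2 ≤ Real.pi ^ 2 := pow_le_pow_left₀ hz.1.le hz.2.le 2
        nlinarith [sq_nonneg (c - |z.re|), sq_abs z.re, sq_nonneg (|z.re|), sq_nonneg c]
      _ = _ := by rw [Real.exp_add]; ring
  · intro z hz
    have h1 : z = (z.re : ℂ) := Complex.ext rfl (by simpa using hz)
    rw [norm_mul, hexp, hz, h1, Complex.ofReal_re]
    calc _ ≤ Real.exp (0 ^ 2 - z.re ^ 2) * (D * Real.exp (z.re ^ 2)) := by gcongr; exact hbot _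
      _ = D * Real.exp 0 := by
        rw [show (0 : ℝ) = (0 ^ 2 - z.re ^ 2) + z.re ^ 2 by ring, Real.exp_add]; ring_nf
      _ ≤ _ := by gcongr; positivity
  · intro z hz
    have h1 : z = (z.re : ℂ) + Real.pi * Complex.I := by
      rw [← hz, Complex.re_add_im]
    rw [norm_mul, hexp, hz]
    calc _ ≤ Real.exp (Real.pi ^ 2 - z.re ^ 2) * (D * Real.exp (z.re ^ 2)) := by
          gcongr; rw [h1]; simpa using htop z.re
      _ = _ := by
        rw [show Real.pi ^ 2 = (Real.pi ^ 2 - z.re ^ 2) + z.re ^ 2 by ring, Real.exp_add]; ring_nf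

theorem exp_mul_abs_le (c x : ℝ) : Real.exp (c * |x|) ≤ Real.exp (c ^ 2) * Real.exp (x ^ 2) := by
  rw [← Real.exp_add]
  gcongr
  nlinarith [sq_nonneg (c - |x|), sq_abs x, sq_nonneg (|x|), sq_nonneg c]

/-- Joint continuity gives uniform convergence on `[-R, R]`; outside, both terms grow at most
exponentially and are negligible against `exp(x²)`. -/
theorem eventually_norm_mollify_sub_le {k : ℝ → ℂ} (hk : Continuous k) {C c : ℝ}
    (hc : 0 ≤ c) (hC0 : 0 ≤ C) (hC : ∀ t, ‖k t‖ ≤ C * Real.exp (c * |t|)) {ε : ℝ} (hε : 0 < ε) :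
    ∀ᶠ δ in 𝓝[>] (0 : ℝ), ∀ x : ℝ, ‖mollify δ k x - k x‖ ≤ ε * Real.exp (x ^ 2) := by
  set B : ℝ → ℝ → ℂ := fun δ x => ∫ s : ℝ, gaussKernel 1 s • k (x + δ * s) with hB
  have hBcont : Continuous (Function.uncurry B) :=
    continuous_integral_gaussKernel_one hk hc hC0 hC
  have hB0 : ∀ x, B 0 x = k x := fun x => by
    simp only [hB, zero_mul, add_zero, integral_gaussKernel_one_smul]
  have hBle : ∀ δ x, |δ| ≤ 1 → ‖B δ x‖ ≤ C * Real.exp (c * |x|) * gaussMoment 1 c :=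
    fun δ x hδ => norm_integral_gaussKernel_one_le hc hC0 hC hδ x
  set A := gaussMoment 1 c
  have hA : 0 ≤ A := gaussMoment_nonneg 1 c
  -- For `|x| > R ≥ c + 1` one has `x² ≥ c|x| + R`, so the tail gains the factor `exp(-R)`.
  obtain ⟨R, hR1, hR2⟩ : ∃ R : ℝ, c + 1 ≤ R ∧ 2 * C * A * Real.exp (-R) ≤ ε := by
    have h1 := Real.tendsto_exp_neg_atTop_nhds_zero.const_mul (2 * C * A)
    rw [mul_zero] at h1
    obtain ⟨R, hR, hR'⟩ := ((h1.eventually (gt_mem_nhds hε)).and (eventually_ge_atTop (c + 1))).exists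
    exact ⟨R, hR', hR.le⟩
  obtain ⟨v, hv, hv'⟩ := (isCompact_Icc (a := -R) (b := R)).mem_uniformity_of_prod
    (f := B) (s := univ) (q := 0) hBcont.continuousOn (mem_univ _) (Metric.dist_mem_uniformity hε)
  rw [nhdsWithin_univ] at hv
  have hv1 : ∀ᶠ δ : ℝ in 𝓝[>] 0, δ ∈ v := nhdsWithin_le_nhds hv
  have hv2 : ∀ᶠ δ : ℝ in 𝓝[>] 0, δ < 1 := nhdsWithin_le_nhds (gt_mem_nhds one_pos)
  filter_upwards [hv1, hv2, self_mem_nhdsWithin] with δ h1 h2 h3 x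
  have h3' : 0 < δ := h3
  rw [mollify_ofReal_eq h3', ← hB0 x]
  change ‖B δ x - B 0 x‖ ≤ _
  rcases le_or_gt |x| R with hx | hx
  · have h4 : dist (B δ x) (B 0 x) < ε := hv' δ h1 x (abs_le.1 hx)
    rw [dist_eq_norm] at h4
    refine h4.le.trans (le_mul_of_one_le_right hε.le (Real.one_le_exp (sq_nonneg x)))
  · calc ‖B δ x - B 0 x‖ ≤ C * Real.exp (c * |x|) * A + C * Real.exp (c * |x|) * A :=
          (norm_sub_le _ _).trans (add_le_add (hBle δ x (by rw [abs_of_pos h3']; exact h2.le))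
            (hBle 0 x (by simp)))
      _ = 2 * C * A * Real.exp (c * |x|) := by ring
      _ ≤ 2 * C * A * (Real.exp (-R) * Real.exp (x ^ 2)) := by
        rw [← Real.exp_add]
        gcongr
        nlinarith [sq_abs x, abs_nonneg x]
      _ = 2 * C * A * Real.exp (-R) * Real.exp (x ^ 2) := by ring
      _ ≤ _ := by gcongr

section

variable {k l : ℝ → ℂ} (hk : Continuous k) (hl : Continuous l) {C c : ℝ}
  (hc : 0 ≤ c) (hC0 : 0 ≤ C) (hkC : ∀ t, ‖k t‖ ≤ C * Real.exp (c * |t|))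
  (hlC : ∀ t, ‖l t‖ ≤ C * Real.exp (c * |t|))
  (h : ∀ δ : ℝ, 0 < δ → ∀ s : ℝ, mollify δ k (s + Real.pi * Complex.I) = mollify δ l s)

include hc hC0 hkC in
theorem norm_mollify_strip_growth {δ : ℝ} (hδ : 0 < δ) (x y : ℝ) (hy0 : 0 ≤ y)
    (hy : y ≤ Real.pi) : ‖mollify δ k (x + y * Complex.I)‖ ≤
      C * Real.exp (Real.pi ^ 2 / δ ^ 2) * gaussMoment δ c * Real.exp (c * |x|) := by
  refine (norm_mollify_le hδ hc hC0 hkC x y).trans ?_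
  have h1 := gaussMoment_nonneg δ c
  calc _ ≤ C * Real.exp (c * |x|) * Real.exp (Real.pi ^ 2 / δ ^ 2) * gaussMoment δ c := by gcongr
    _ = _ := by ring

include hc hC0 hkC in
theorem norm_mollify_ofReal_le {δ : ℝ} (hδ : 0 < δ) (hδ1 : δ ≤ 1) (x : ℝ) :
    ‖mollify δ k x‖ ≤ C * (gaussMoment 1 c * Real.exp (c ^ 2)) * Real.exp (x ^ 2) := by
  rw [mollify_ofReal_eq hδ]
  refine (norm_integral_gaussKernel_one_le hc hC0 hkC (by rwa [abs_of_pos hδ]) x).trans ?_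
  have h1 := gaussMoment_nonneg 1 c
  calc _ ≤ C * (Real.exp (c ^ 2) * Real.exp (x ^ 2)) * gaussMoment 1 c := by
        gcongr; exact exp_mul_abs_le c x
    _ = _ := by ring

include hk hc hC0 hkC hlC h in
-- The boundary values are bounded uniformly in `δ ≤ 1`, so the bound inside is independent of `δ`
-- although the a priori growth is not. Its linearity in `C` later yields continuity of `Φ(z)` in
-- `ξ`.
theorem norm_exp_mul_mollify_strip_le {δ : ℝ} (hδ : 0 < δ) (hδ1 : δ ≤ 1) {z : ℂ}
    (hz : z ∈ Complex.im ⁻¹' Icc 0 Real.pi) :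
    ‖Complex.exp (-z ^ 2) * mollify δ k z‖ ≤
      C * (gaussMoment 1 c * Real.exp (c ^ 2)) * Real.exp (Real.pi ^ 2) := by
  refine norm_le_of_strip_boundary (differentiable_mollify hδ hk hkC)
    (norm_mollify_strip_growth hc hC0 hkC hδ) (norm_mollify_ofReal_le hc hC0 hkC hδ hδ1)
    (fun x => ?_) hz
  rw [h δ hδ]
  exact norm_mollify_ofReal_le hc hC0 hlC hδ hδ1 x

include hk hl hc hC0 hkC hlC h in
/-- If the Gaussian convolutions of `k` continue analytically to those of `l` at height `π`, then
`k` and `l` are the boundary values of a function that is continuous on the closed strip and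
holomorphic inside. -/
theorem exists_strip_extension : ∃ Ψ : ℂ → ℂ,
    (∀ z ∈ Complex.im ⁻¹' Icc 0 Real.pi,
      Tendsto (fun n : ℕ => mollify (1 / ((n : ℝ) + 1)) k z) atTop (𝓝 (Ψ z))) ∧
    ContinuousOn Ψ (Complex.im ⁻¹' Icc 0 Real.pi) ∧
    DifferentiableOn ℂ Ψ (Complex.im ⁻¹' Ioo 0 Real.pi) ∧
    (∀ t : ℝ, Ψ t = k t) ∧ ∀ t : ℝ, Ψ (t + Real.pi * Complex.I) = l t := by
  set d : ℕ → ℝ := fun n => 1 / ((n : ℝ) + 1) with hd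
  have hd0 : ∀ n, 0 < d n := fun n => by simp only [hd]; positivity
  have hdlim : Tendsto d atTop (𝓝[>] 0) :=
    tendsto_nhdsWithin_iff.2 ⟨tendsto_one_div_add_atTop_nhds_zero_nat, Eventually.of_forall hd0⟩
  set g : ℕ → ℂ → ℂ := fun n z => Complex.exp (-z ^ 2) * mollify (d n) k z with hg
  have hgdiff : ∀ n, Differentiable ℂ (g n) := fun n => by
    have := differentiable_mollify (hd0 n) hk hkC
    fun_prop
  -- The mollifications converge to `k` on the lower line and, through `h`, to `l` on the upper one,
  -- both relative to `exp(x²)`. `norm_le_of_strip_boundary`, applied to differences, carries the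
  -- Cauchy property into the strip.
  have hcauchy : UniformCauchySeqOn g atTop (Complex.im ⁻¹' Icc 0 Real.pi) := by
    rw [Metric.uniformCauchySeqOn_iff]
    intro ε hε
    -- Two mollifications differ by at most `2ε' exp(x²)` on the boundary, hence after the factor
    -- `exp(π²)` by `ε/2` inside.
    set ε' : ℝ := ε / (4 * Real.exp (Real.pi ^ 2)) with hε'
    have hε'0 : 0 < ε' := by positivity
    obtain ⟨N, hN⟩ := eventually_atTop.1 ((hdlim.eventually
      (eventually_norm_mollify_sub_le hk hc hC0 hkC hε'0)).and
      (hdlim.eventually (eventually_norm_mollify_sub_le hl hc hC0 hlC hε'0)))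
    refine ⟨N, fun m hm n hn z hz => ?_⟩
    have hsub : ∀ {q : ℝ → ℂ} (x : ℝ), ‖mollify (d m) q x - q x‖ ≤ ε' * Real.exp (x ^ 2) →
        ‖mollify (d n) q x - q x‖ ≤ ε' * Real.exp (x ^ 2) →
        ‖mollify (d m) q x - mollify (d n) q x‖ ≤ (2 * ε') * Real.exp (x ^ 2) := by
      intro q x h1 h2
      calc _ = ‖(mollify (d m) q x - q x) - (mollify (d n) q x - q x)‖ := by congr 1; ring
        _ ≤ _ := norm_sub_le _ _
        _ ≤ _ := add_le_add h1 h2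
        _ = _ := by ring
    have := norm_le_of_strip_boundary (f := fun z => mollify (d m) k z - mollify (d n) k z)
      ((differentiable_mollify (hd0 m) hk hkC).sub (differentiable_mollify (hd0 n) hk hkC))
      (A := C * Real.exp (Real.pi ^ 2 / d m ^ 2) * gaussMoment (d m) c +
        C * Real.exp (Real.pi ^ 2 / d n ^ 2) * gaussMoment (d n) c) (c := c) (D := 2 * ε')
      (fun x y hy0 hy => by
        rw [add_mul]
        exact (norm_sub_le _ _).trans (add_le_add
          (norm_mollify_strip_growth hc hC0 hkC (hd0 m) x y hy0 hy)
          (norm_mollify_strip_growth hc hC0 hkC (hd0 n) x y hy0 hy)))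
      (fun x => hsub x ((hN m hm).1 x) ((hN n hn).1 x))
      (fun x => by
        simp only [h _ (hd0 _)]
        exact hsub x ((hN m hm).2 x) ((hN n hn).2 x)) hz
    rw [dist_eq_norm]
    calc ‖g m z - g n z‖ = ‖Complex.exp (-z ^ 2) * (mollify (d m) k z - mollify (d n) k z)‖ := by
          simp only [hg]; rw [mul_sub]
      _ ≤ _ := this
      _ = ε / 2 := by rw [hε']; field_simp; norm_num
      _ < ε := by linarith
  choose! G hG using fun z (hz : z ∈ Complex.im ⁻¹' Icc 0 Real.pi) =>
    cauchySeq_tendsto_of_complete (hcauchy.cauchySeq hz)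
  have hunif := hcauchy.tendstoUniformlyOn_of_tendsto hG
  have hexp : ∀ z : ℂ, Complex.exp (z ^ 2) * Complex.exp (-z ^ 2) = 1 := fun z => by
    rw [← Complex.exp_add]; simp
  have hlim : ∀ z ∈ Complex.im ⁻¹' Icc 0 Real.pi,
      Tendsto (fun n : ℕ => mollify (d n) k z) atTop (𝓝 (Complex.exp (z ^ 2) * G z)) := by
    intro z hz
    refine ((hG z hz).const_mul (Complex.exp (z ^ 2))).congr fun n => ?_
    rw [hg, ← mul_assoc, hexp, one_mul]
  refine ⟨fun z => Complex.exp (z ^ 2) * G z, hlim, ?_, ?_, fun t => ?_, fun t => ?_⟩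
  · have := hunif.continuousOn (Frequently.of_forall fun n => (hgdiff n).continuous.continuousOn)
    exact ContinuousOn.mul (by fun_prop) this
  · have := (hunif.mono (preimage_mono Ioo_subset_Icc_self)).tendstoLocallyUniformlyOn.differentiableOn
      (Eventually.of_forall fun n => (hgdiff n).differentiableOn)
      (isOpen_Ioo.preimage Complex.continuous_im)
    exact DifferentiableOn.mul (by fun_prop) this
  · refine tendsto_nhds_unique (hlim t ?_) ?_
    · simp [Real.pi_pos.le]
    · exact (tendsto_mollify_ofReal hk hc hC0 hkC t).comp hdlim
  · refine tendsto_nhds_unique (hlim _ ?_) ?_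
    · simp [Real.pi_pos.le]
    · simp only [h _ (hd0 _)]
      exact (tendsto_mollify_ofReal hl hc hC0 hlC t).comp hdlim

end

end Strip

/-! ### The exponential of the generator through mollified orbits -/

section OneParameterGroup

open MeasureTheory Filter Topology Set

variable {H : Type*} [NormedAddCommGroup H] [InnerProductSpace ℂ H]
  {V : ℝ → (H ≃ₗᵢ[ℂ] H)}

theorem norm_orbit_le (V : ℝ → (H ≃ₗᵢ[ℂ] H)) (v : H) (t : ℝ) :
    ‖V t v‖ ≤ ‖v‖ * Real.exp (0 * |t|) := by
  simp

/-- The mollification of the orbit maps of a one-parameter group, as a bounded operator. -/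
def mollifyL (V : ℝ → (H ≃ₗᵢ[ℂ] H)) (hcont : ∀ v : H, Continuous fun t => V t v) {δ : ℝ}
    (hδ : 0 < δ) (z : ℂ) : H →L[ℂ] H :=
  LinearMap.mkContinuous
    { toFun := fun v => mollify δ (fun t => V t v) z
      map_add' := fun v w => by
        simp only [mollify, map_add, smul_add]
        exact integral_add (integrable_mollify hδ (hcont v) (norm_orbit_le V v) z)
          (integrable_mollify hδ (hcont w) (norm_orbit_le V w) z)
      map_smul' := fun a v => by
        simp only [mollify, map_smul, RingHom.id_apply]
        rw [← integral_smul]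
        congr 1 with t
        rw [smul_comm] }
    (Real.exp (z.im ^ 2 / δ ^ 2) * gaussMoment δ 0) fun v => by
      have := norm_mollify_le hδ le_rfl (norm_nonneg v) (norm_orbit_le V v) z.re z.im
      rw [Complex.re_add_im] at this
      simp only [zero_mul, Real.exp_zero, mul_one] at this
      simp only [LinearMap.coe_mk, AddHom.coe_mk]
      linarith

theorem mollifyL_apply (hcont : ∀ v : H, Continuous fun t => V t v) {δ : ℝ}
    (hδ : 0 < δ) (z : ℂ) (v : H) : mollifyL V hcont hδ z v = mollify δ (fun t => V t v) z := rfl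

theorem one_parameter_zero (hadd : ∀ s t v, V (s + t) v = V s (V t v)) (v : H) : V 0 v = v := by
  have := hadd 0 0 v
  rw [add_zero] at this
  exact ((V 0).injective this).symm

theorem mollify_orbit_apply (hadd : ∀ s t v, V (s + t) v = V s (V t v)) (δ : ℝ) (z : ℂ) (s : ℝ)
    (v : H) : mollify δ (fun t => V t (V s v)) z = mollify δ (fun t => V t v) (z + s) := by
  rw [← mollify_translate]
  simp only [hadd]

theorem apply_mollify_orbit [CompleteSpace H] (hadd : ∀ s t v, V (s + t) v = V s (V t v))
    (hcont : ∀ v : H, Continuous fun t => V t v) {δ : ℝ} (hδ : 0 < δ) (z : ℂ) (s : ℝ) (v : H) :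
    V s (mollify δ (fun t => V t v) z) = mollify δ (fun t => V t v) (z + s) := by
  rw [← mollify_orbit_apply hadd, mollify, mollify]
  have := (V s).toContinuousLinearEquiv.toContinuousLinearMap.integral_comp_comm
    (integrable_mollify hδ (hcont v) (norm_orbit_le V v) z)
  refine Eq.trans this.symm ?_
  congr 1 with t
  change V s (gaussKernel δ (t - z) • V t v) = _
  rw [map_smul, ← hadd, ← hadd, add_comm]

theorem mem_graph_infinitesimalGenerator {v w : H} :
    (v, w) ∈ (infinitesimalGenerator V).graph ↔ HasDerivAt (fun t => V t v) w 0 := by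
  rw [LinearPMap.mem_graph_iff]
  constructor
  · rintro ⟨y, hy, hw⟩
    have hd : DifferentiableAt ℝ (fun t => V t (y : H)) 0 := y.2
    have := hd.hasDerivAt
    simp only at hy hw
    rw [← hy, ← hw]
    exact this
  · intro h
    exact ⟨⟨v, h.differentiableAt⟩, rfl, h.deriv⟩

variable [CompleteSpace H] (hadd : ∀ s t v, V (s + t) v = V s (V t v))
  (hcont : ∀ v : H, Continuous fun t => V t v)

include hcont in
theorem differentiable_mollify_orbit {δ : ℝ} (hδ : 0 < δ) (v : H) :
    Differentiable ℂ (mollify δ fun t => V t v) :=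
  differentiable_mollify hδ (hcont v) (norm_orbit_le V v)

include hadd hcont in
-- A real shift of the argument is the same as replacing `v` by `V s v`. Differentiating at `s = 0`
-- in both descriptions gives the complex derivative on one side and the mollification of `T v` on
-- the other.
theorem deriv_mollify_orbit {δ : ℝ} (hδ : 0 < δ) {v w : H}
    (h : HasDerivAt (fun t => V t v) w 0) :
    deriv (mollify δ fun t => V t v) = mollify δ fun t => V t w := by
  ext1 z
  have h1 : HasDerivAt (fun s : ℝ => mollify δ (fun t => V t v) (z + s))
      (deriv (mollify δ fun t => V t v) z) 0 := by
    have h0 : HasDerivAt (mollify δ fun t => V t v) (deriv (mollify δ fun t => V t v) z)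
        (z + ((0 : ℝ) : ℂ)) := by
      simpa using (differentiable_mollify_orbit hcont hδ v z).hasDerivAt
    have h2 : HasDerivAt (fun s : ℝ => z + (s : ℂ)) 1 0 := Complex.ofRealCLM.hasDerivAt.const_add z
    simpa [Function.comp_def] using h0.scomp (0 : ℝ) h2
  have h2 : HasDerivAt (fun s : ℝ => mollify δ (fun t => V t v) (z + s))
      (mollify δ (fun t => V t w) z) 0 := by
    have := ((mollifyL V hcont hδ z).restrictScalars ℝ).hasFDerivAt.comp_hasDerivAt (0 : ℝ) h
    refine this.congr_of_eventuallyEq (Eventually.of_forall fun s => ?_)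
    exact (mollify_orbit_apply hadd δ z s v).symm
  exact h1.unique h2

include hadd hcont in
-- The derivatives at `0` of the mollified orbit are the mollifications of `Tⁿ v`, so its Taylor
-- series at `z` is the image of the exponential series under a bounded operator.
theorem mollify_eq_of_mem_expSeriesGraph {δ : ℝ} (hδ : 0 < δ) {z : ℂ} {p : H × H}
    (hp : p ∈ expSeriesGraph (infinitesimalGenerator V) z) :
    mollify δ (fun t => V t p.1) z = mollify δ (fun t => V t p.2) 0 := by
  obtain ⟨x, hx0, hx, hsum, hp2⟩ := hp
  have hiter : ∀ n, iteratedDeriv n (mollify δ fun t => V t (x 0)) = mollify δ fun t => V t (x n) := by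
    intro n
    induction n with
    | zero => simp
    | succ n ih =>
      rw [iteratedDeriv_succ, ih]
      exact deriv_mollify_orbit hadd hcont hδ (mem_graph_infinitesimalGenerator.1 (hx n))
  have htaylor := Complex.hasSum_taylorSeries_of_entire
    (differentiable_mollify_orbit hcont hδ (x 0)) 0 z
  have hs : Summable fun n : ℕ => (z ^ n / (n.factorial : ℂ)) • x n := by
    refine Summable.of_norm (hsum.congr fun n => ?_)
    rw [norm_smul, norm_div, norm_pow, Complex.norm_natCast]
  have h2 := hs.hasSum.mapL (mollifyL V hcont hδ 0)
  rw [← hp2] at h2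
  rw [← hx0]
  refine htaylor.unique (h2.congr_fun fun n => ?_)
  rw [hiter, map_smul, mollifyL_apply, sub_zero, smul_smul]
  congr 1
  ring

include hadd hcont in
-- The group acts on the entire function `P` by real translations, so `Tⁿ P(0)` is its `n`-th
-- derivative at `0`, and the exponential series is the Taylor series of `P`.
theorem mollify_mem_expSeriesGraph {δ : ℝ} (hδ : 0 < δ) (z : ℂ) (v : H) :
    (mollify δ (fun t => V t v) 0, mollify δ (fun t => V t v) z) ∈
      expSeriesGraph (infinitesimalGenerator V) z := by
  set P := mollify δ fun t => V t v with hP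
  have hPd : Differentiable ℂ P := differentiable_mollify_orbit hcont hδ v
  have hPn : ∀ n, Differentiable ℂ (iteratedDeriv n P) := fun n =>
    (hPd.contDiff (n := ∞)).differentiable_iteratedDeriv n (by exact_mod_cast ENat.natCast_lt_top n)
  have hV : ∀ n (s : ℝ) (w : ℂ), V s (iteratedDeriv n P w) = iteratedDeriv n P (w + s) := by
    intro n s
    induction n with
    | zero => exact fun w => apply_mollify_orbit hadd hcont hδ w s v
    | succ n ih =>
      intro w
      rw [iteratedDeriv_succ, ← deriv_comp_add_const, ← funext ih]
      exact ((V s).toContinuousLinearEquiv.toContinuousLinearMap.hasFDerivAt.comp_hasDerivAt w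
        (hPn n w).hasDerivAt).deriv.symm
  refine ⟨fun n => iteratedDeriv n P 0, by simp, fun n => ?_, ?_, ?_⟩
  · rw [mem_graph_infinitesimalGenerator]
    simp only [hV, zero_add]
    have := ((hPn n) ((0 : ℝ) : ℂ)).hasDerivAt.scomp (0 : ℝ) Complex.ofRealCLM.hasDerivAt
    rw [← iteratedDeriv_succ] at this
    simpa [Function.comp_def] using this
  · set R : ℝ := ‖z‖ + 1 with hR
    have hR0 : 0 < R := by positivity
    obtain ⟨M, hM⟩ := (isCompact_sphere (0 : ℂ) R).exists_bound_of_continuousOn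
      hPd.continuous.continuousOn
    have hq : ‖z‖ / R < 1 := (div_lt_one hR0).2 (by linarith)
    refine Summable.of_nonneg_of_le (fun n => by positivity) (fun n => ?_)
      ((summable_geometric_of_lt_one (by positivity) hq).mul_right M)
    have h1 := Complex.norm_iteratedDeriv_le_of_forall_mem_sphere_norm_le n hR0
      hPd.diffContOnCl hM
    calc _ ≤ ‖z‖ ^ n / (n.factorial : ℝ) * (n.factorial * M / R ^ n) := by gcongr
      _ = _ := by
        have : (n.factorial : ℝ) ≠ 0 := by positivity
        rw [div_pow]
        field_simp
  · have h1 := (Complex.hasSum_taylorSeries_of_entire hPd 0 z).tsum_eq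
    rw [← h1]
    refine tsum_congr fun n => ?_
    rw [sub_zero, smul_smul]
    congr 1
    ring

include hadd hcont in
theorem tendsto_mollify_orbit (v : H) :
    Tendsto (fun δ => mollify δ (fun t => V t v) 0) (𝓝[>] 0) (𝓝 v) := by
  have := tendsto_mollify_ofReal (hcont v) le_rfl (norm_nonneg v) (norm_orbit_le V v) 0
  simpa [one_parameter_zero hadd] using this

include hadd hcont in
/-- The graph of `e^{zT}`, for the generator `T` of a unitary one-parameter group, in terms of
Gaussian mollifications. -/
theorem mem_expGraph_iff {z : ℂ} {v w : H} :
    (v, w) ∈ expGraph (infinitesimalGenerator V) z ↔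
      ∀ δ : ℝ, 0 < δ → mollify δ (fun t => V t v) z = mollify δ (fun t => V t w) 0 := by
  constructor
  · intro h δ hδ
    have hcl : IsClosed {p : H × H | mollifyL V hcont hδ z p.1 = mollifyL V hcont hδ 0 p.2} :=
      isClosed_eq (by fun_prop) (by fun_prop)
    exact closure_minimal (fun p hp => mollify_eq_of_mem_expSeriesGraph hadd hcont hδ hp) hcl h
  · intro h
    -- The mollified pairs lie on the graph of the series, by the hypothesis, and converge to `(v,
    -- w)`.
    refine mem_closure_of_tendsto
      ((tendsto_mollify_orbit hadd hcont v).prodMk_nhds (tendsto_mollify_orbit hadd hcont w)) ?_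
    filter_upwards [self_mem_nhdsWithin] with δ hδ
    rw [← h δ hδ]
    exact mollify_mem_expSeriesGraph hadd hcont hδ z v

end OneParameterGroup

/-! ### Differential calculus at the identity of a Lie group -/

section LieCalculus

open MeasureTheory Filter Topology Set

variable {F : Type*} [NormedAddCommGroup F] [NormedSpace ℝ F]
  {G : Type*} [TopologicalSpace G] [ChartedSpace F G] [Group G]
  {E : Type*} [NormedAddCommGroup E] [NormedSpace ℝ E]

variable (F) in
/-- The derivative at the identity of a vector-valued function on a Lie group. -/
def derivOne (f : G → E) : F →L[ℝ] E := mfderiv 𝓘(ℝ, F) 𝓘(ℝ, E) f 1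

variable (F) in
/-- The function `f` on `G` has the derivative `D` at the identity. -/
def HasDerivOne (f : G → E) (D : F →L[ℝ] E) : Prop := HasMFDerivAt 𝓘(ℝ, F) 𝓘(ℝ, E) f 1 D

theorem HasDerivOne.derivOne_eq {f : G → E} {D : F →L[ℝ] E} (h : HasDerivOne F f D) :
    derivOne F f = D := HasMFDerivAt.mfderiv h

theorem ContMDiff.hasDerivOne {f : G → E} (h : ContMDiff 𝓘(ℝ, F) 𝓘(ℝ, E) ∞ f) :
    HasDerivOne F f (derivOne F f) :=
  (h.mdifferentiable (by simp) 1).hasMFDerivAt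

theorem hasDerivOne_iff {f : G → E} {D : F →L[ℝ] E} : HasDerivOne F f D ↔
    ContinuousAt f 1 ∧ HasFDerivAt (fun y => f ((extChartAt 𝓘(ℝ, F) (1 : G)).symm y)) D
      (extChartAt 𝓘(ℝ, F) (1 : G) 1) := by
  change (_ ∧ HasFDerivWithinAt (fun y => f ((extChartAt 𝓘(ℝ, F) (1 : G)).symm y)) D
    (range 𝓘(ℝ, F)) (extChartAt 𝓘(ℝ, F) (1 : G) 1)) ↔ _
  rw [ModelWithCorners.range_eq_univ, hasFDerivWithinAt_univ]

theorem HasDerivOne.clm_comp {E' : Type*} [NormedAddCommGroup E'] [NormedSpace ℝ E'] {f : G → E}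
    {D : F →L[ℝ] E} (h : HasDerivOne F f D) (L : E →L[ℝ] E') :
    HasDerivOne F (fun g => L (f g)) (L ∘L D) := by
  rw [hasDerivOne_iff] at h ⊢
  exact ⟨L.continuous.continuousAt.comp h.1, L.hasFDerivAt.comp _ h.2⟩

theorem HasDerivOne.add {f f' : G → E} {D D' : F →L[ℝ] E} (h : HasDerivOne F f D)
    (h' : HasDerivOne F f' D') : HasDerivOne F (fun g => f g + f' g) (D + D') := by
  rw [hasDerivOne_iff] at h h' ⊢
  exact ⟨h.1.add h'.1, h.2.add h'.2⟩

variable [LieGroup 𝓘(ℝ, F) ∞ G]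

variable (F G) in
/-- The derivative, in the chart at the identity, of the left translation that moves the point with
coordinates `y` to the identity. -/
def chartTransl (y : F) : F →L[ℝ] F :=
  fderiv ℝ (fun z => extChartAt 𝓘(ℝ, F) (1 : G)
    (((extChartAt 𝓘(ℝ, F) (1 : G)).symm y)⁻¹ * (extChartAt 𝓘(ℝ, F) (1 : G)).symm z)) y

theorem contDiffAt_chart_transl {y : F} (hy : y ∈ (extChartAt 𝓘(ℝ, F) (1 : G)).target) :
    ContDiffAt ℝ ∞ (Function.uncurry fun y z : F => extChartAt 𝓘(ℝ, F) (1 : G)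
      (((extChartAt 𝓘(ℝ, F) (1 : G)).symm y)⁻¹ * (extChartAt 𝓘(ℝ, F) (1 : G)).symm z)) (y, y) := by
  have : IsManifold 𝓘(ℝ, F) ∞ G := LieGroup.toContMDiffMul.toIsManifold
  rw [← contMDiffAt_iff_contDiffAt]
  have hs : ContMDiffAt 𝓘(ℝ, F) 𝓘(ℝ, F) ∞ (extChartAt 𝓘(ℝ, F) (1 : G)).symm y :=
    (contMDiffOn_extChartAt_symm 1).contMDiffAt ((isOpen_extChartAt_target 1).mem_nhds hy)
  have h1 : ContMDiffAt 𝓘(ℝ, F × F) 𝓘(ℝ, F) ∞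
      (fun p : F × F => (extChartAt 𝓘(ℝ, F) (1 : G)).symm p.1) (y, y) :=
    ContMDiffAt.comp (y, y) hs contDiffAt_fst.contMDiffAt
  have h2 : ContMDiffAt 𝓘(ℝ, F × F) 𝓘(ℝ, F) ∞
      (fun p : F × F => (extChartAt 𝓘(ℝ, F) (1 : G)).symm p.2) (y, y) :=
    ContMDiffAt.comp (y, y) hs contDiffAt_snd.contMDiffAt
  refine ContMDiffAt.comp (y, y) ?_ (h1.inv.mul h2)
  simp only [inv_mul_cancel]
  exact contMDiffAt_extChartAt

theorem contDiffOn_chartTransl :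
    ContDiffOn ℝ ∞ (chartTransl F G) (extChartAt 𝓘(ℝ, F) (1 : G)).target := fun y hy =>
  (ContDiffAt.fderiv (g := fun y => y) (contDiffAt_chart_transl (G := G) hy) contDiffAt_id
    (by simp)).contDiffWithinAt

/-- The derivatives at other points near the identity, in terms of those at the identity. -/
theorem HasDerivOne.hasFDerivAt_chart {f : G → E} {D : F →L[ℝ] E} {y : F}
    (hy : y ∈ (extChartAt 𝓘(ℝ, F) (1 : G)).target)
    (h : HasDerivOne F (fun b => f ((extChartAt 𝓘(ℝ, F) (1 : G)).symm y * b)) D) :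
    HasFDerivAt (fun z => f ((extChartAt 𝓘(ℝ, F) (1 : G)).symm z)) (D ∘L chartTransl F G y) y := by
  set e := extChartAt 𝓘(ℝ, F) (1 : G) with he
  have h1 := (hasDerivOne_iff.1 h).2
  have h2 : HasFDerivAt (fun z => e ((e.symm y)⁻¹ * e.symm z)) (chartTransl F G y) y := by
    have h3 : ContDiffAt ℝ ∞ (fun z => e ((e.symm y)⁻¹ * e.symm z)) y :=
      (contDiffAt_chart_transl (G := G) hy).comp y (contDiffAt_const.prodMk contDiffAt_id)
    exact (h3.differentiableAt (by simp)).hasFDerivAt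
  rw [← he] at h1
  have h4 : e 1 = e ((e.symm y)⁻¹ * e.symm y) := by rw [inv_mul_cancel]
  rw [h4] at h1
  refine (h1.comp y h2).congr_of_eventuallyEq ?_
  have : IsTopologicalGroup G := topologicalGroup_of_lieGroup 𝓘(ℝ, F) ∞
  have hc : ContinuousAt (fun z => (e.symm y)⁻¹ * e.symm z) y :=
    continuousAt_const.mul (continuousAt_extChartAt_symm'' hy)
  have hs : e.source ∈ 𝓝 ((e.symm y)⁻¹ * e.symm y) := by
    rw [inv_mul_cancel]; exact extChartAt_source_mem_nhds 1
  filter_upwards [hc hs] with z hz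
  simp only [Function.comp_apply]
  rw [e.left_inv hz, mul_inv_cancel_left]

section Parametric

variable {E' : Type*} [NormedAddCommGroup E'] [NormedSpace ℝ E'] {M : Type*} [TopologicalSpace M]
  {J : ModelWithCorners ℝ E' M} {N : Type*} [TopologicalSpace N] [ChartedSpace M N]
  [IsManifold J ∞ N]

/-- The base point stays at `1` and the target is a vector space, so the tangent coordinate changes
are identities, and smoothness of the derivative in tangent coordinates is smoothness of `derivOne`
itself. -/
theorem contMDiff_derivOne {f : N → G → E}
    (hf : ContMDiff (J.prod 𝓘(ℝ, F)) 𝓘(ℝ, E) ∞ (Function.uncurry f)) :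
    ContMDiff J 𝓘(ℝ, F →L[ℝ] E) ∞ fun p => derivOne F (f p) := by
  have : IsManifold 𝓘(ℝ, F) ∞ G := LieGroup.toContMDiffMul.toIsManifold
  have : IsManifold 𝓘(ℝ, F) 1 G := IsManifold.of_le (n := ∞) (by simp)
  have : IsManifold J 1 N := IsManifold.of_le (n := ∞) (by simp)
  intro p₀
  have h := ContMDiffAt.mfderiv (m := ∞) f (fun _ => (1 : G)) hf.contMDiffAt
    (contMDiffAt_const (x := p₀)) (by simp)
  refine h.congr_of_eventuallyEq (Eventually.of_forall fun p => ?_)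
  refine Eq.trans ?_ (inTangentCoordinates_eq (I := 𝓘(ℝ, F)) (I' := 𝓘(ℝ, E)) (fun _ : N => (1 : G))
    (fun x => f x 1) (fun x => derivOne F (f x)) (mem_chart_source _ _)
    (by simp only [chartAt_self_eq]; trivial)).symm
  ext v
  exact (((tangentBundleCore 𝓘(ℝ, E) E).coordChange_self _ _ (mem_chart_source _ _) _).trans
    (congrArg (derivOne F (f p)) ((tangentBundleCore 𝓘(ℝ, F) G).coordChange_self _ _
      (mem_chart_source _ _) v))).symm

/-- The adjoint action: the derivative at the identity of a conjugation. -/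
def lieAd (g : G) : F →L[ℝ] F := mfderiv 𝓘(ℝ, F) 𝓘(ℝ, F) (fun a : G => g * a * g⁻¹) 1

end Parametric

theorem contMDiff_conj (g : G) : ContMDiff 𝓘(ℝ, F) 𝓘(ℝ, F) ∞ fun a : G => g * a * g⁻¹ :=
  (contMDiff_const.mul contMDiff_id).mul contMDiff_const

theorem contMDiff_lieAd : ContMDiff 𝓘(ℝ, F) 𝓘(ℝ, F →L[ℝ] F) ∞ (lieAd : G → F →L[ℝ] F) := by
  have : IsManifold 𝓘(ℝ, F) ∞ G := LieGroup.toContMDiffMul.toIsManifold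
  have : IsManifold 𝓘(ℝ, F) 1 G := IsManifold.of_le (n := ∞) (by simp)
  intro p₀
  have hf : ContMDiff (𝓘(ℝ, F).prod 𝓘(ℝ, F)) 𝓘(ℝ, F) ∞
      (Function.uncurry fun g a : G => g * a * g⁻¹) :=
    (contMDiff_fst.mul contMDiff_snd).mul contMDiff_fst.inv
  have h := ContMDiffAt.mfderiv (m := ∞) (fun g a : G => g * a * g⁻¹) (fun _ => (1 : G))
    hf.contMDiffAt (contMDiffAt_const (x := p₀)) (by simp)
  refine h.congr_of_eventuallyEq (Eventually.of_forall fun p => ?_)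
  have h1 : ∀ g : G, g * 1 * g⁻¹ = 1 := by simp
  refine Eq.trans ?_ (inTangentCoordinates_eq (I := 𝓘(ℝ, F)) (I' := 𝓘(ℝ, F)) (fun _ : G => (1 : G))
    (fun g : G => g * 1 * g⁻¹) lieAd (mem_chart_source _ _)
    (by simp only [h1]; exact mem_chart_source _ _)).symm
  ext v
  simp only [h1]
  exact (((tangentBundleCore 𝓘(ℝ, F) G).coordChange_self _ _ (mem_chart_source _ _) _).trans
    (congrArg (lieAd p) ((tangentBundleCore 𝓘(ℝ, F) G).coordChange_self _ _
      (mem_chart_source _ _) v))).symm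

theorem lieAd_mul (g k : G) : lieAd (F := F) (g * k) = lieAd g ∘L lieAd k := by
  have h1 : (fun a : G => g * k * a * (g * k)⁻¹) =
      (fun a => g * a * g⁻¹) ∘ fun a => k * a * k⁻¹ := by
    ext a; simp [mul_assoc]
  have h2 := ((contMDiff_conj (F := F) k).mdifferentiable (by simp) 1).hasMFDerivAt
  have h3 : HasMFDerivAt 𝓘(ℝ, F) 𝓘(ℝ, F) (fun a : G => g * a * g⁻¹) (k * 1 * k⁻¹)
      (lieAd (F := F) g) := by
    rw [show k * 1 * k⁻¹ = 1 by simp]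
    exact ((contMDiff_conj (F := F) g).mdifferentiable (by simp) 1).hasMFDerivAt
  have h4 := HasMFDerivAt.comp (1 : G) h3 h2
  rw [← h1] at h4
  exact h4.mfderiv

/-- A differentiable function composed with a conjugation. -/
theorem HasDerivOne.comp_conj {f : G → E} {D : F →L[ℝ] E} (h : HasDerivOne F f D) (g : G) :
    HasDerivOne F (fun a => f (g * a * g⁻¹)) (D ∘L lieAd g) := by
  have h2 := ((contMDiff_conj (F := F) g).mdifferentiable (by simp) 1).hasMFDerivAt
  have h' : HasMFDerivAt 𝓘(ℝ, F) 𝓘(ℝ, E) f (g * 1 * g⁻¹) D := by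
    have : g * 1 * g⁻¹ = 1 := by simp
    rw [this]; exact h
  exact HasMFDerivAt.comp (1 : G) h' h2

/-- Only the factorization through `D` matters, as it confines the values of the new derivative to
those of `D`; hence `D'` is not computed. -/
theorem HasDerivOne.comp_inv {f : G → E} {D : F →L[ℝ] E} (h : HasDerivOne F f D) :
    ∃ D', HasDerivOne F (fun a => f a⁻¹) (D ∘L D') := by
  have h2 := ((contMDiff_inv 𝓘(ℝ, F) ∞ (G := G)).mdifferentiable (by simp) 1).hasMFDerivAt
  have h' : HasMFDerivAt 𝓘(ℝ, F) 𝓘(ℝ, E) f (1 : G)⁻¹ D := by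
    rw [inv_one]; exact h
  exact ⟨_, HasMFDerivAt.comp (1 : G) h' h2⟩

end LieCalculus

/-! ### A criterion for smooth vectors; differentiation of convolutions -/

section Smoothing

open MeasureTheory Filter Topology Set

variable {F : Type*} [NormedAddCommGroup F] [NormedSpace ℝ F]
  {G : Type*} [TopologicalSpace G] [ChartedSpace F G] [Group G] [LieGroup 𝓘(ℝ, F) ∞ G]
  {E : Type*} [NormedAddCommGroup E] [NormedSpace ℝ E]
  {H : Type*} [NormedAddCommGroup H] [InnerProductSpace ℂ H]

/-- A unitary operator as a real linear map. -/
def realCLM (T : H ≃ₗᵢ[ℂ] H) : H →L[ℝ] H :=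
  T.toContinuousLinearEquiv.toContinuousLinearMap.restrictScalars ℝ

@[simp]
theorem realCLM_apply (T : H ≃ₗᵢ[ℂ] H) (v : H) : realCLM T v = T v := rfl

theorem norm_realCLM_le (T : H ≃ₗᵢ[ℂ] H) : ‖realCLM T‖ ≤ 1 :=
  ContinuousLinearMap.opNorm_le_bound _ zero_le_one fun v => by simp

theorem chartTransl_one : chartTransl F G (extChartAt 𝓘(ℝ, F) (1 : G) 1) =
    ContinuousLinearMap.id ℝ F := by
  rw [chartTransl, extChartAt_to_inv]
  refine HasFDerivAt.fderiv ((hasFDerivAt_id _).congr_of_eventuallyEq ?_)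
  filter_upwards [extChartAt_target_mem_nhds (I := 𝓘(ℝ, F)) (1 : G)] with z hz
  rw [inv_one, one_mul, (extChartAt 𝓘(ℝ, F) (1 : G)).right_inv hz, id]

theorem HasDerivOne.hasFDerivAt_orbit {U : G →* (H ≃ₗᵢ[ℂ] H)} {v : H} {D : F →L[ℝ] H}
    (h : HasDerivOne F (fun g => U g v) D) {y : F}
    (hy : y ∈ (extChartAt 𝓘(ℝ, F) (1 : G)).target) :
    HasFDerivAt (fun z => U ((extChartAt 𝓘(ℝ, F) (1 : G)).symm z) v)
      (realCLM (U ((extChartAt 𝓘(ℝ, F) (1 : G)).symm y)) ∘L D ∘L chartTransl F G y) y := by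
  rw [← ContinuousLinearMap.comp_assoc]
  refine HasDerivOne.hasFDerivAt_chart (f := fun g => U g v) hy ?_
  have := h.clm_comp (realCLM (U ((extChartAt 𝓘(ℝ, F) (1 : G)).symm y)))
  simpa [map_mul] using this

/-- By homogeneity, `U(g) v = U(g₀) U(g₀⁻¹ g) v`, smoothness at the identity suffices. -/
theorem contMDiff_orbit_of_contDiffOn {U : G →* (H ≃ₗᵢ[ℂ] H)} {v : H}
    (hc : ContinuousAt (fun g => U g v) 1)
    (h : ContDiffOn ℝ ∞ (fun z => U ((extChartAt 𝓘(ℝ, F) (1 : G)).symm z) v)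
      (extChartAt 𝓘(ℝ, F) (1 : G)).target) : v ∈ smoothVectors F U := by
  have h1 : ContMDiffAt 𝓘(ℝ, F) 𝓘(ℝ, H) ∞ (fun g : G => U g v) 1 := by
    rw [contMDiffAt_iff]
    refine ⟨hc, ?_⟩
    exact (h.contDiffAt (extChartAt_target_mem_nhds (I := 𝓘(ℝ, F)) (1 : G))).contDiffWithinAt
  intro g₀
  have h2 : ContMDiff 𝓘(ℝ, F) 𝓘(ℝ, F) ∞ fun g : G => g₀⁻¹ * g := contMDiff_mul_left
  have h3 : ContMDiffAt 𝓘(ℝ, F) 𝓘(ℝ, H) ∞ (fun g : G => U (g₀⁻¹ * g) v) g₀ :=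
    ContMDiffAt.comp (g := fun g : G => U g v) g₀ (by rwa [inv_mul_cancel]) h2.contMDiffAt
  have h4 := (realCLM (U g₀)).contDiff.contMDiff.contMDiffAt.comp g₀ h3
  have h5 : (fun g => U g v) = (realCLM (U g₀)) ∘ fun g : G => U (g₀⁻¹ * g) v := by
    ext g
    simp [map_mul]
  rw [h5]
  exact h4

/-- A set of vectors that are differentiable, with derivatives in the linear span of the set,
consists of smooth vectors. -/
theorem subset_smoothVectors [FiniteDimensional ℝ F] {U : G →* (H ≃ₗᵢ[ℂ] H)} {S : Set H}
    (h : ∀ v ∈ S, ∃ D : F →L[ℝ] H, HasDerivOne F (fun g => U g v) D ∧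
      ∀ x, D x ∈ Submodule.span ℝ S) {v : H} (hv : v ∈ S) : v ∈ smoothVectors F U := by
  set e := extChartAt 𝓘(ℝ, F) (1 : G) with he
  have ho : IsOpen e.target := isOpen_extChartAt_target 1
  -- The induction runs over all of `S` at once. In the chart, the derivative of an orbit map is a
  -- combination of orbit maps of the vectors `D (b j)`, which lie in the span of `S`, with smooth
  -- coefficients.
  have key : ∀ k : ℕ, ∀ v ∈ S, ContDiffOn ℝ k (fun z => U (e.symm z) v) e.target := by
    intro k
    induction k with
    | zero =>
      intro v hv
      obtain ⟨D, hD, -⟩ := h v hv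
      exact contDiffOn_zero.2 fun y hy => (hD.hasFDerivAt_orbit hy).continuousAt.continuousWithinAt
    | succ k ih =>
      have ih' : ∀ v ∈ Submodule.span ℝ S, ContDiffOn ℝ k (fun z => U (e.symm z) v) e.target := by
        intro v hv
        induction hv using Submodule.span_induction with
        | mem v hv => exact ih v hv
        | zero => simpa using contDiffOn_const
        | add v w _ _ h1 h2 => simpa using h1.add h2
        | smul a v _ h1 =>
          refine (h1.const_smul a).congr fun z _ => ?_
          exact (realCLM (U (e.symm z))).map_smul a v
      intro v hv
      obtain ⟨D, hD, hDS⟩ := h v hv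
      push_cast
      rw [contDiffOn_succ_iff_fderiv_of_isOpen ho]
      refine ⟨fun y hy => (hD.hasFDerivAt_orbit hy).differentiableAt.differentiableWithinAt,
        by simp, ?_⟩
      set b := Module.finBasis ℝ F
      have h1 : ∀ y ∈ e.target, fderiv ℝ (fun z => U (e.symm z) v) y =
          ∑ j, ((LinearMap.toContinuousLinearMap (b.coord j)) ∘L chartTransl F G y).smulRight
            (U (e.symm y) (D (b j))) := by
        intro y hy
        rw [(hD.hasFDerivAt_orbit hy).fderiv]
        ext u
        simp only [ContinuousLinearMap.comp_apply, sum_apply,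
          ContinuousLinearMap.smulRight_apply, LinearMap.coe_toContinuousLinearMap',
          Module.Basis.coord_apply]
        conv_lhs => rw [← b.sum_repr (chartTransl F G y u)]
        rw [map_sum, map_sum]
        refine Finset.sum_congr rfl fun j _ => ?_
        rw [map_smul, map_smul]
        rfl
      refine ContDiffOn.congr ?_ h1
      refine ContDiffOn.sum fun j _ => ?_
      refine ContDiffOn.smulRight ?_ (ih' _ (hDS _))
      exact contDiffOn_const.clm_comp (contDiffOn_chartTransl.of_le (by exact_mod_cast le_top))
  obtain ⟨D, hD, -⟩ := h v hv
  exact contMDiff_orbit_of_contDiffOn (hasDerivOne_iff.1 hD).1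
    (contDiffOn_infty.2 fun k => key k v hv)

/-- The derivative of the function `φ` along the right-invariant vector field generated by `x`. -/
def rightDeriv (x : F) (φ : G → ℝ) : G → ℝ := fun g => derivOne F (fun a => φ (a * g)) x

theorem derivOne_mul_eq_zero {φ : G → ℝ} {a g : G} (h : a * g ∉ tsupport φ) :
    derivOne F (fun b => φ (a * b * g)) = 0 := by
  have : IsTopologicalGroup G := topologicalGroup_of_lieGroup 𝓘(ℝ, F) ∞
  have h1 : (fun b => φ (a * b * g)) =ᶠ[𝓝 1] fun _ => 0 := by
    have hc : ContinuousAt (fun b : G => a * b * g) 1 := by fun_prop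
    have h2 : (tsupport φ)ᶜ ∈ 𝓝 (a * 1 * g) := by
      rw [mul_one]; exact (isClosed_tsupport φ).isOpen_compl.mem_nhds h
    filter_upwards [hc h2] with b hb using image_eq_zero_of_notMem_tsupport hb
  exact h1.mfderiv_eq.trans mfderiv_const

theorem contMDiff_derivOne_mul {φ : G → ℝ} (hφ : ContMDiff 𝓘(ℝ, F) 𝓘(ℝ, ℝ) ∞ φ) (a : G) :
    ContMDiff 𝓘(ℝ, F) 𝓘(ℝ, F →L[ℝ] ℝ) ∞ fun g => derivOne F (fun b => φ (a * b * g)) :=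
  contMDiff_derivOne (f := fun g b : G => φ (a * b * g))
    (hφ.comp ((contMDiff_const.mul contMDiff_snd).mul contMDiff_fst))

theorem rightDeriv_mem {x : F} {φ : G → ℝ} (hφ : φ ∈ testFunctions F (univ : Set G)) :
    rightDeriv x φ ∈ testFunctions F (univ : Set G) := by
  have h1 := contMDiff_derivOne_mul hφ.1 1
  simp only [one_mul] at h1
  refine ⟨?_, hφ.2.1.mono' ?_, subset_univ _⟩
  · have := ((ContinuousLinearMap.apply ℝ ℝ x).contDiff (n := ∞)).contMDiff.comp h1
    exact this
  · intro g hg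
    by_contra hcon
    refine hg ?_
    have := derivOne_mul_eq_zero (F := F) (φ := φ) (a := 1) (g := g) (by rwa [one_mul])
    simp only [one_mul] at this
    simp [rightDeriv, this]

variable [FiniteDimensional ℝ F] [T2Space G] [MeasurableSpace G] [BorelSpace G]
  (μ : Measure G) [IsFiniteMeasureOnCompacts μ]

theorem continuous_derivOne_smulRight {φ : G → ℝ} (hφ : ContMDiff 𝓘(ℝ, F) 𝓘(ℝ, ℝ) ∞ φ)
    {w : G → E} (hw : Continuous w) :
    Continuous fun g => (derivOne F (fun a => φ (a * g))).smulRight (w g) := by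
  have h1 := (contMDiff_derivOne_mul hφ 1).continuous
  simp only [one_mul] at h1
  exact (ContinuousLinearMap.smulRightL ℝ F E).continuous₂.comp (h1.prodMk hw)

theorem integrable_derivOne_smulRight {φ : G → ℝ} (hφ : φ ∈ testFunctions F (univ : Set G))
    {w : G → E} (hw : Continuous w) :
    Integrable (fun g => (derivOne F (fun a => φ (a * g))).smulRight (w g)) μ := by
  refine (continuous_derivOne_smulRight hφ.1 hw).integrable_of_hasCompactSupport
    (hφ.2.1.mono' fun g hg => ?_)
  by_contra hcon
  refine hg ?_
  have := derivOne_mul_eq_zero (F := F) (φ := φ) (a := 1) (g := g) (by rwa [one_mul])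
  simp only [one_mul] at this
  simp [this]

theorem integrable_testFunction_smul {φ : G → ℝ} (hφ : φ ∈ testFunctions F (univ : Set G))
    {w : G → E} (hw : Continuous w) : Integrable (fun g => φ g • w g) μ :=
  (hφ.1.continuous.smul hw).integrable_of_hasCompactSupport hφ.2.1.smul_right

/-- Differentiation under the integral sign for left translations of test functions. -/
theorem hasDerivOne_integral {φ : G → ℝ} (hφ : φ ∈ testFunctions F (univ : Set G))
    {w : G → E} (hw : Continuous w) :
    HasDerivOne F (fun a => ∫ g, φ (a * g) • w g ∂μ)
      (∫ g, (derivOne F (fun a => φ (a * g))).smulRight (w g) ∂μ) := by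
  have : IsTopologicalGroup G := topologicalGroup_of_lieGroup 𝓘(ℝ, F) ∞
  have : IsManifold 𝓘(ℝ, F) ∞ G := LieGroup.toContMDiffMul.toIsManifold
  set e := extChartAt 𝓘(ℝ, F) (1 : G) with he
  obtain ⟨r, hr, hball⟩ := Metric.nhds_basis_closedBall.mem_iff.1
    (extChartAt_target_mem_nhds (I := 𝓘(ℝ, F)) (1 : G))
  rw [← he] at hball
  have : ProperSpace F := FiniteDimensional.proper ℝ F
  have hKc : IsCompact (Metric.closedBall (e 1) r) := isCompact_closedBall _ _
  set S : Set G := e.symm '' Metric.closedBall (e 1) r with hS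
  have hSc : IsCompact S := hKc.image_of_continuousOn ((continuousOn_extChartAt_symm 1).mono hball)
  -- This compact set contains every `g` for which some `a ∈ S` moves `g` into the support of `φ`;
  -- the integrands therefore have a common dominating function supported in it.
  set C : Set G := (fun p : G × G => p.1⁻¹ * p.2) '' (S ×ˢ tsupport φ) with hC
  have hCc : IsCompact C := (hSc.prod hφ.2.1).image (by fun_prop)
  have hmemC : ∀ a ∈ S, ∀ g, g ∉ C → a * g ∉ tsupport φ := fun a ha g hg hag =>
    hg ⟨(a, a * g), ⟨ha, hag⟩, by simp⟩
  set T : G × G → F →L[ℝ] ℝ := fun p => derivOne F (fun b => φ (p.1 * b * p.2)) with hT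
  have hTc : Continuous T := by
    refine (contMDiff_derivOne (J := 𝓘(ℝ, F).prod 𝓘(ℝ, F)) (N := G × G)
      (f := fun p b => φ (p.1 * b * p.2)) ?_).continuous
    exact hφ.1.comp (((contMDiff_fst.comp contMDiff_fst).mul contMDiff_snd).mul
      (contMDiff_snd.comp contMDiff_fst))
  obtain ⟨M, hM⟩ := (hSc.prod hCc).exists_bound_of_continuousOn hTc.continuousOn
  obtain ⟨B, hB⟩ := hKc.exists_bound_of_continuousOn
    ((contDiffOn_chartTransl (G := G)).continuousOn.mono hball)
  have hB0 : 0 ≤ B := (norm_nonneg _).trans (hB (e 1) (Metric.mem_closedBall_self hr.le))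
  set F' : F → G → F →L[ℝ] E := fun y g =>
    ((T (e.symm y, g)) ∘L chartTransl F G y).smulRight (w g) with hF'
  have hF'1 : ∀ g, F' (e 1) g = (derivOne F (fun a => φ (a * g))).smulRight (w g) := by
    intro g
    simp only [hF', hT]
    rw [he, chartTransl_one, extChartAt_to_inv]
    simp
  have key : HasFDerivAt (fun y => ∫ g, φ (e.symm y * g) • w g ∂μ) (∫ g, F' (e 1) g ∂μ) (e 1) := by
    refine hasFDerivAt_integral_of_dominated_of_fderiv_le
      (bound := C.indicator fun g => M * B * ‖w g‖) (Metric.closedBall_mem_nhds (e 1) hr)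
      (Eventually.of_forall fun y => ?_) ?_ ?_ (ae_of_all _ fun g y hy => ?_) ?_
      (ae_of_all _ fun g y hy => ?_)
    · refine (Continuous.integrable_of_hasCompactSupport
        (f := fun g => φ (e.symm y * g) • w g) ?_ ?_).aestronglyMeasurable
      · exact (hφ.1.continuous.comp (continuous_const_mul _)).smul hw
      · exact (hφ.2.1.comp_homeomorph (Homeomorph.mulLeft (e.symm y))).smul_right
    · refine Continuous.integrable_of_hasCompactSupport
        (f := fun g => φ (e.symm (e 1) * g) • w g) ?_ ?_
      · exact (hφ.1.continuous.comp (continuous_const_mul _)).smul hw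
      · exact (hφ.2.1.comp_homeomorph (Homeomorph.mulLeft (e.symm (e 1)))).smul_right
    · rw [funext hF'1]
      exact (integrable_derivOne_smulRight μ hφ hw).aestronglyMeasurable
    · have hyS : e.symm y ∈ S := mem_image_of_mem _ hy
      by_cases hg : g ∈ C
      · rw [indicator_of_mem hg, hF', ContinuousLinearMap.norm_smulRight_apply]
        have h1 := hM (e.symm y, g) ⟨hyS, hg⟩
        gcongr
        exact (ContinuousLinearMap.opNorm_comp_le _ _).trans
          (mul_le_mul h1 (hB y hy) (norm_nonneg _) ((norm_nonneg _).trans h1))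
      · have : T (e.symm y, g) = 0 := derivOne_mul_eq_zero (hmemC _ hyS g hg)
        rw [indicator_of_notMem hg, hF']
        simp [this]
    · rw [integrable_indicator_iff hCc.measurableSet]
      exact ContinuousOn.integrableOn_compact hCc (by fun_prop)
    · have h1 : HasDerivOne F (fun b => φ (e.symm y * b * g)) (T (e.symm y, g)) :=
        (hφ.1.comp ((contMDiff_const.mul contMDiff_id).mul contMDiff_const)).hasDerivOne
      exact (HasDerivOne.hasFDerivAt_chart (f := fun a => φ (a * g)) (hball hy) h1).smul_const (w g)
  simp only [hF'1] at key
  rw [hasDerivOne_iff]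
  refine ⟨?_, key⟩
  have h2 : ContinuousAt (fun a => ∫ g, φ (e.symm (e a) * g) • w g ∂μ) 1 :=
    ContinuousAt.comp (g := fun y => ∫ g, φ (e.symm y * g) • w g ∂μ) key.continuousAt
      (continuousAt_extChartAt 1)
  refine h2.congr ?_
  filter_upwards [extChartAt_source_mem_nhds (I := 𝓘(ℝ, F)) (1 : G)] with a ha
  rw [e.left_inv ha]

theorem integral_derivOne_smulRight_apply [CompleteSpace E] {φ : G → ℝ}
    (hφ : φ ∈ testFunctions F (univ : Set G)) {w : G → E} (hw : Continuous w) (x : F) :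
    (∫ g, (derivOne F (fun a => φ (a * g))).smulRight (w g) ∂μ) x =
      ∫ g, rightDeriv x φ g • w g ∂μ := by
  rw [ContinuousLinearMap.integral_apply (integrable_derivOne_smulRight μ hφ hw)]
  rfl

end Smoothing

/-! ### The derived representation on smooth vectors -/

section SmoothVectors

open MeasureTheory Filter Topology Set

variable {F : Type*} [NormedAddCommGroup F] [NormedSpace ℝ F]
  {G : Type*} [TopologicalSpace G] [ChartedSpace F G] [Group G]
  {H : Type*} [NormedAddCommGroup H] [InnerProductSpace ℂ H]
  {U : G →* (H ≃ₗᵢ[ℂ] H)}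

theorem derivedRep_eq (x : GroupLieAlgebra 𝓘(ℝ, F) G) (v : H) :
    derivedRep U x v = derivOne F (fun g => U g v) x := rfl

theorem hasDerivOne_of_mem_smoothVectors {v : H} (hv : v ∈ smoothVectors F U) :
    HasDerivOne F (fun g => U g v) (derivOne F fun g => U g v) :=
  ContMDiff.hasDerivOne hv

theorem derivedRep_add (x : GroupLieAlgebra 𝓘(ℝ, F) G) {v w : H} (hv : v ∈ smoothVectors F U)
    (hw : w ∈ smoothVectors F U) :
    derivedRep U x (v + w) = derivedRep U x v + derivedRep U x w := by
  have h := (hasDerivOne_of_mem_smoothVectors hv).add (hasDerivOne_of_mem_smoothVectors hw)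
  simp only [← map_add] at h
  rw [derivedRep_eq, h.derivOne_eq]
  rfl

theorem derivedRep_smul (x : GroupLieAlgebra 𝓘(ℝ, F) G) (c : ℂ) {v : H}
    (hv : v ∈ smoothVectors F U) : derivedRep U x (c • v) = c • derivedRep U x v := by
  have h := (hasDerivOne_of_mem_smoothVectors hv).clm_comp
    ((c • ContinuousLinearMap.id ℂ H).restrictScalars ℝ)
  simp only [ContinuousLinearMap.coe_restrictScalars', smul_apply,
    ContinuousLinearMap.id_apply, ← map_smul] at h
  rw [derivedRep_eq, h.derivOne_eq]
  rfl

variable [LieGroup 𝓘(ℝ, F) ∞ G]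

/-- `U(g) dU(x) v` is the derivative at `b = 1` of `U(g b) v`, which depends smoothly on the
parameter `g`. -/
theorem derivedRep_mem (x : F) {v : H} (hv : v ∈ smoothVectors F U) :
    derivedRep U x v ∈ smoothVectors F U := by
  have : IsManifold 𝓘(ℝ, F) ∞ G := LieGroup.toContMDiffMul.toIsManifold
  have hv' : ContMDiff 𝓘(ℝ, F) 𝓘(ℝ, H) ∞ fun g : G => U g v := hv
  have h1 : ContMDiff 𝓘(ℝ, F) 𝓘(ℝ, F →L[ℝ] H) ∞ fun g : G => derivOne F fun b => U (g * b) v :=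
    contMDiff_derivOne (f := fun g b : G => U (g * b) v)
      (hv'.comp (contMDiff_fst.mul contMDiff_snd))
  have h2 := ((ContinuousLinearMap.apply ℝ H x).contDiff (n := ∞)).contMDiff.comp h1
  change ContMDiff 𝓘(ℝ, F) 𝓘(ℝ, H) ∞ fun g : G => U g (derivedRep U x v)
  convert! h2 using 1
  ext g
  have h3 := (hasDerivOne_of_mem_smoothVectors hv).clm_comp (realCLM (U g))
  have h4 : HasDerivOne F (fun b => U (g * b) v)
      (realCLM (U g) ∘L derivOne F fun g => U g v) := by simpa [map_mul] using h3
  simp only [Function.comp_apply, h4.derivOne_eq, ContinuousLinearMap.apply_apply]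
  rfl

/-- The orbit map of a translated vector. -/
theorem HasDerivOne.orbit_apply {v : H} {D : F →L[ℝ] H} (h : HasDerivOne F (fun g => U g v) D)
    (g : G) : HasDerivOne F (fun a => U a (U g v)) (realCLM (U g) ∘L D ∘L lieAd g⁻¹) := by
  have h1 := (h.comp_conj g⁻¹).clm_comp (realCLM (U g))
  convert! h1 using 2 with a
  rw [realCLM_apply]
  have h2 : U (a * g) v = U (g * (g⁻¹ * a * g⁻¹⁻¹)) v := by
    congr 2
    group
  rw [map_mul, map_mul] at h2
  exact h2

namespace SmoothVec

theorem toH_mem (ξ : SmoothVec F U) : ξ.toH ∈ smoothVectors F U := ξ.2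

theorem toH_injective : Function.Injective (toH : SmoothVec F U → H) := Subtype.val_injective

variable (F U) in
/-- The inclusion of the smooth vectors, as a linear map. -/
def toHₗ : SmoothVec F U →ₗ[ℂ] H := (smoothVectors F U).subtype

@[simp]
theorem toHₗ_apply (ξ : SmoothVec F U) : toHₗ F U ξ = ξ.toH := rfl

variable (U) in
/-- The derived representation on the smooth vectors. -/
def deriv (x : F) : SmoothVec F U →ₗ[ℂ] SmoothVec F U where
  toFun ξ := ⟨derivedRep U x ξ.toH, derivedRep_mem x ξ.2⟩
  map_add' ξ ζ := toH_injective (derivedRep_add x ξ.2 ζ.2)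
  map_smul' c ξ := toH_injective (derivedRep_smul x c ξ.2)

theorem toH_deriv (x : F) (ξ : SmoothVec F U) : (deriv U x ξ).toH = derivedRep U x ξ.toH := rfl

theorem toH_deriv_eq (x : F) (ξ : SmoothVec F U) :
    (deriv U x ξ).toH = derivOne F (fun g => U g ξ.toH) x := rfl

variable (U) in
/-- The product of operators of the derived representation along a list. -/
def word (l : List F) : SmoothVec F U →ₗ[ℂ] SmoothVec F U :=
  l.foldr (fun x L => deriv U x ∘ₗ L) LinearMap.id

@[simp]
theorem word_nil : word U ([] : List F) = LinearMap.id := rfl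

theorem word_cons (x : F) (l : List F) : word U (x :: l) = deriv U x ∘ₗ word U l := rfl

theorem word_append (l l' : List F) : word U (l ++ l') = word U l ∘ₗ word U l' := by
  induction l with
  | nil => rfl
  | cons x l ih => rw [List.cons_append, word_cons, ih, word_cons, LinearMap.comp_assoc]

theorem toH_word (l : List F) (ξ : SmoothVec F U) :
    (word U l ξ).toH = l.foldr (derivedRep U) ξ.toH := by
  induction l with
  | nil => rfl
  | cons x l ih =>
    rw [word_cons, LinearMap.comp_apply, toH_deriv, ih]
    rfl

theorem continuous_word (l : List F) : Continuous fun ξ : SmoothVec F U => (word U l ξ).toH := by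
  simp only [toH_word]
  exact continuous_iInf_dom (i := (l : List (GroupLieAlgebra 𝓘(ℝ, F) G))) continuous_induced_dom

theorem continuous_of_word {X : Type*} [TopologicalSpace X] {f : X → SmoothVec F U}
    (h : ∀ l : List F, Continuous fun x => (word U l (f x)).toH) : Continuous f := by
  refine continuous_iInf_rng.2 fun l => continuous_induced_rng.2 ?_
  exact (continuous_congr fun x => toH_word (F := F) l (f x)).1 (h l)

theorem toH_smoothAct (g : G) (ξ : SmoothVec F U) : (smoothAct U g ξ).toH = U g ξ.toH := rfl

variable (U) in
/-- The action of `G` on the smooth vectors, as a linear map. -/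
def actₗ (g : G) : SmoothVec F U →ₗ[ℂ] SmoothVec F U where
  toFun := smoothAct U g
  map_add' ξ ζ := toH_injective ((U g).map_add ξ.toH ζ.toH)
  map_smul' c ξ := toH_injective ((U g).map_smul c ξ.toH)

theorem actₗ_apply (g : G) (ξ : SmoothVec F U) : actₗ U g ξ = smoothAct U g ξ := rfl

theorem smoothAct_mul (g k : G) (ξ : SmoothVec F U) :
    smoothAct U (g * k) ξ = smoothAct U g (smoothAct U k ξ) :=
  toH_injective (by simp only [toH_smoothAct, map_mul]; rfl)

/-- This is `dU(x) U(g) = U(g) dU(Ad(g⁻¹) x)`, expanded in a fixed basis so that the dependence on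
`g` of the derivative sits in scalar coefficients. -/
theorem deriv_smoothAct [FiniteDimensional ℝ F] (x : F) (g : G) (ξ : SmoothVec F U) :
    deriv U x (smoothAct U g ξ) = ∑ j, (((Module.finBasis ℝ F).repr (lieAd g⁻¹ x) j : ℝ) : ℂ) •
      smoothAct U g (deriv U (Module.finBasis ℝ F j) ξ) := by
  apply toH_injective
  have h1 := ((hasDerivOne_of_mem_smoothVectors ξ.2).orbit_apply g).derivOne_eq
  rw [toH_deriv_eq]
  refine (congrArg (fun D : F →L[ℝ] H => D x) h1).trans ?_
  simp only [ContinuousLinearMap.comp_apply]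
  conv_lhs => rw [← (Module.finBasis ℝ F).sum_repr (lieAd g⁻¹ x)]
  rw [map_sum, map_sum, ← toHₗ_apply, map_sum]
  refine Finset.sum_congr rfl fun j _ => ?_
  rw [map_smul, map_smul, map_smul]
  simp only [toHₗ_apply, toH_smoothAct, toH_deriv_eq, Complex.coe_smul, realCLM_apply]
  rfl

end SmoothVec

end SmoothVectors

/-! ### Exponential growth of one-parameter groups of operators -/

section Growth

open MeasureTheory Filter Topology Set

variable {F : Type*} [NormedAddCommGroup F] [NormedSpace ℝ F]

/-- Submultiplicativity: `t` is split into `n` steps of length at most `1`, with `n ≤ |t| + 1`. The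
power `n + 1` occurs because `Q 0` is not assumed to be the identity and is only bounded by `M'`. -/
theorem exists_norm_le_exp_of_hom {Q : ℝ → F →L[ℝ] F} (hc : Continuous Q)
    (hQ : ∀ s t, Q (s + t) = Q s ∘L Q t) :
    ∃ A c : ℝ, 0 ≤ A ∧ 0 ≤ c ∧ ∀ t, ‖Q t‖ ≤ A * Real.exp (c * |t|) := by
  obtain ⟨M, hM⟩ := (isCompact_Icc (a := (-1 : ℝ)) (b := 1)).exists_bound_of_continuousOn
    hc.continuousOn
  set M' := max M 1
  have hM' : ∀ s : ℝ, |s| ≤ 1 → ‖Q s‖ ≤ M' := fun s hs => (hM s (abs_le.1 hs)).trans (le_max_left _ _)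
  have hM1 : 1 ≤ M' := le_max_right _ _
  have hM0 : 0 < M' := one_pos.trans_le hM1
  have hpow : ∀ (n : ℕ) (s : ℝ), |s| ≤ 1 → ‖Q (n * s)‖ ≤ M' ^ (n + 1) := by
    intro n s hs
    induction n with
    | zero => simpa using hM' 0 (by simp)
    | succ n ih =>
      rw [Nat.cast_succ, add_mul, one_mul, hQ, pow_succ]
      exact (ContinuousLinearMap.opNorm_comp_le _ _).trans
        (mul_le_mul ih (hM' s hs) (norm_nonneg _) (by positivity))
  refine ⟨M' ^ 2, Real.log M', by positivity, Real.log_nonneg hM1, fun t => ?_⟩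
  set n := ⌊|t|⌋₊ + 1 with hn
  have hn0 : (0 : ℝ) < n := by positivity
  have h1 : |t| < n := by
    rw [hn]; push_cast; exact Nat.lt_floor_add_one |t|
  have h2 : (n : ℝ) ≤ |t| + 1 := by
    rw [hn]; push_cast; linarith [Nat.floor_le (abs_nonneg t)]
  have h3 := hpow n (t / n) (by
    rw [abs_div, Nat.abs_cast]; exact (div_le_one hn0).2 h1.le)
  rw [mul_div_cancel₀ _ hn0.ne'] at h3
  refine h3.trans ?_
  rw [← Real.rpow_natCast, ← Real.rpow_natCast, Real.rpow_def_of_pos hM0, Real.rpow_def_of_pos hM0,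
    ← Real.exp_add]
  have h4 := Real.log_nonneg hM1
  gcongr
  push_cast
  nlinarith

end Growth

/-! ### Derivatives of translated vectors -/

section Expansion

open MeasureTheory Filter Topology Set

variable {F : Type*} [NormedAddCommGroup F] [NormedSpace ℝ F]
  {G : Type*} [TopologicalSpace G] [ChartedSpace F G] [Group G] [LieGroup 𝓘(ℝ, F) ∞ G]
  {H : Type*} [NormedAddCommGroup H] [InnerProductSpace ℂ H]

theorem exists_norm_lieAd_le {γ : ℝ → G} (hγ : Continuous γ)
    (hadd : ∀ s t, γ (s + t) = γ s * γ t) :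
    ∃ A c : ℝ, 0 ≤ A ∧ 0 ≤ c ∧ ∀ t, ‖lieAd (F := F) (γ t)⁻¹‖ ≤ A * Real.exp (c * |t|) := by
  obtain ⟨A, c, hA, hc, h⟩ := exists_norm_le_exp_of_hom (Q := fun t => lieAd (F := F) (γ t))
    (contMDiff_lieAd.continuous.comp hγ) fun s t => by rw [hadd, lieAd_mul]
  refine ⟨A, c, hA, hc, fun t => ?_⟩
  have h0 : γ 0 = 1 := by simpa using hadd 0 0
  have : (γ t)⁻¹ = γ (-t) := by
    rw [inv_eq_iff_mul_eq_one, ← hadd, add_neg_cancel, h0]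
  rw [this]
  simpa using h (-t)

/-- The operators of the derived representation on a translated vector. -/
theorem exists_word_smoothAct [FiniteDimensional ℝ F] (U : G →* (H ≃ₗᵢ[ℂ] H)) {γ : ℝ → G}
    (hγ : Continuous γ) (hadd : ∀ s t, γ (s + t) = γ s * γ t) (l : List F) :
    ∃ (ι : Type) (_ : Fintype ι) (p : ι → G → ℝ) (w : ι → List F),
      (∀ i, ContMDiff 𝓘(ℝ, F) 𝓘(ℝ, ℝ) ∞ (p i)) ∧
      (∃ A c : ℝ, 0 ≤ A ∧ 0 ≤ c ∧ ∀ i t, |p i (γ t)| ≤ A * Real.exp (c * |t|)) ∧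
      ∀ g (ξ : SmoothVec F U), SmoothVec.word U l (smoothAct U g ξ) =
        ∑ i, ((p i g : ℝ) : ℂ) • smoothAct U g (SmoothVec.word U (w i) ξ) := by
  -- The last letter acts first on the translated vector and is moved past `U(g)` by
  -- `deriv_smoothAct`; the remaining word falls under the induction hypothesis. Coefficients
  -- multiply, so the exponential rates add.
  induction l using List.reverseRecOn with
  | nil =>
    refine ⟨Unit, inferInstance, fun _ _ => 1, fun _ => [], fun _ => contMDiff_const,
      ⟨1, 0, by simp, le_rfl, fun _ t => by simp⟩, fun g ξ => by simp⟩
  | append_singleton l x ih =>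
    obtain ⟨ι, _, p, w, hp, ⟨A, c, hA, hc, hAc⟩, h⟩ := ih
    obtain ⟨A', c', hA', hc', hAc'⟩ := exists_norm_lieAd_le (F := F) hγ hadd
    set b := Module.finBasis ℝ F with hb
    set L : Fin (Module.finrank ℝ F) → F →L[ℝ] ℝ := fun j => LinearMap.toContinuousLinearMap (b.coord j)
      with hL
    have hLb : ∀ j, ‖L j‖ ≤ ∑ j, ‖L j‖ := fun j =>
      Finset.single_le_sum (f := fun j => ‖L j‖) (fun _ _ => norm_nonneg _) (Finset.mem_univ j)
    have hLs : 0 ≤ ∑ j, ‖L j‖ := Finset.sum_nonneg fun _ _ => norm_nonneg _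
    refine ⟨ι × Fin (Module.finrank ℝ F), inferInstance,
      fun i g => p i.1 g * L i.2 (lieAd g⁻¹ x), fun i => w i.1 ++ [b i.2], fun i => ?_,
      ⟨A * ((∑ j, ‖L j‖) * A' * ‖x‖), c + c', by positivity, by positivity, fun i t => ?_⟩,
      fun g ξ => ?_⟩
    · have h1 : ContMDiff 𝓘(ℝ, F) 𝓘(ℝ, F →L[ℝ] F) ∞ fun g : G => lieAd (F := F) g⁻¹ :=
        contMDiff_lieAd.comp (contMDiff_inv 𝓘(ℝ, F) ∞)
      have h2 := (((L i.2) ∘L (ContinuousLinearMap.apply ℝ F x)).contDiff (n := ∞)).contMDiff.comp h1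
      exact (hp i.1).mul h2
    · rw [abs_mul, add_mul, Real.exp_add]
      have h1 : |L i.2 (lieAd (γ t)⁻¹ x)| ≤
          (∑ j, ‖L j‖) * ((A' * Real.exp (c' * |t|)) * ‖x‖) := by
        refine ((L i.2).le_opNorm _).trans ?_
        gcongr
        · exact hLb i.2
        · exact (ContinuousLinearMap.le_opNorm _ _).trans (by gcongr; exact hAc' t)
      calc _ ≤ (A * Real.exp (c * |t|)) * ((∑ j, ‖L j‖) * ((A' * Real.exp (c' * |t|)) * ‖x‖)) := by
            gcongr
            exact hAc i.1 t
        _ = _ := by ring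
    · have h0 : ∀ ζ, SmoothVec.word U [x] ζ = SmoothVec.deriv U x ζ := fun ζ => rfl
      rw [SmoothVec.word_append, LinearMap.comp_apply, h0, SmoothVec.deriv_smoothAct, map_sum]
      simp only [map_smul, h, Finset.smul_sum, smul_smul]
      rw [Fintype.sum_prod_type, Finset.sum_comm]
      refine Finset.sum_congr rfl fun i _ => Finset.sum_congr rfl fun j _ => ?_
      rw [SmoothVec.word_append, LinearMap.comp_apply]
      push_cast
      rw [mul_comm]
      rfl

end Expansion

/-! ### Gårding vectors and density of the smooth vectors -/

section Garding

open MeasureTheory Filter Topology Set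

variable {F : Type*} [NormedAddCommGroup F] [NormedSpace ℝ F] [FiniteDimensional ℝ F]
  {G : Type*} [TopologicalSpace G] [ChartedSpace F G] [Group G] [LieGroup 𝓘(ℝ, F) ∞ G]
  [T2Space G] [MeasurableSpace G] [BorelSpace G] (μ : Measure G) [μ.IsHaarMeasure]
  {H : Type*} [NormedAddCommGroup H] [InnerProductSpace ℂ H] [CompleteSpace H]
  {U : G →* (H ≃ₗᵢ[ℂ] H)} (hU : ∀ v, Continuous fun g => U g v)

variable (U) in
/-- The integrated representation `U(φ) v`. -/
def garding (φ : G → ℝ) (v : H) : H := ∫ g, φ g • U g v ∂μ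

include hU in
-- Left invariance of the measure moves `a` from the vector to the test function, where it can be
-- differentiated.
theorem inv_apply_garding {φ : G → ℝ} (hφ : φ ∈ testFunctions F (univ : Set G)) (v : H) (a : G) :
    U a⁻¹ (garding μ U φ v) = ∫ g, φ (a * g) • U g v ∂μ := by
  have : IsTopologicalGroup G := topologicalGroup_of_lieGroup 𝓘(ℝ, F) ∞
  have h1 := (realCLM (U a⁻¹)).integral_comp_comm (integrable_testFunction_smul μ hφ (hU v))
  have h2 := integral_mul_left_eq_self (μ := μ) (fun g => realCLM (U a⁻¹) (φ g • U g v)) a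
  refine h1.symm.trans (h2.symm.trans ?_)
  congr 1 with g
  rw [map_smul, realCLM_apply, map_mul, map_inv]
  congr 1
  exact (U a).symm_apply_apply _

include hU in
theorem hasDerivOne_inv_apply_garding {φ : G → ℝ} (hφ : φ ∈ testFunctions F (univ : Set G))
    (v : H) : ∃ D : F →L[ℝ] H, HasDerivOne F (fun a => U a⁻¹ (garding μ U φ v)) D ∧
      ∀ x, D x = garding μ U (rightDeriv x φ) v := by
  refine ⟨_, ?_, integral_derivOne_smulRight_apply μ hφ (hU v)⟩
  simp only [inv_apply_garding μ hU hφ]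
  exact hasDerivOne_integral μ hφ (hU v)

include hU in
-- Derivatives of Gårding vectors are Gårding vectors of differentiated test functions, so the set
-- of all of them satisfies the criterion `subset_smoothVectors`.
theorem garding_mem_smoothVectors {φ : G → ℝ} (hφ : φ ∈ testFunctions F (univ : Set G)) (v : H) :
    garding μ U φ v ∈ smoothVectors F U := by
  refine subset_smoothVectors (S := {u | ∃ φ ∈ testFunctions F (univ : Set G), ∃ v,
    u = garding μ U φ v}) ?_ ⟨φ, hφ, v, rfl⟩
  rintro u ⟨φ, hφ, v, rfl⟩
  obtain ⟨D, hD, hDx⟩ := hasDerivOne_inv_apply_garding μ hU hφ v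
  obtain ⟨D', hD'⟩ := hD.comp_inv
  simp only [inv_inv] at hD'
  refine ⟨_, hD', fun x => Submodule.subset_span ?_⟩
  rw [ContinuousLinearMap.comp_apply, hDx]
  exact ⟨_, rightDeriv_mem hφ, v, rfl⟩

include hU in
/-- Moving a derivative to the test function of a Gårding vector. -/
theorem inner_derivedRep_garding (x : F) {ζ : H} (hζ : ζ ∈ smoothVectors F U) {φ : G → ℝ}
    (hφ : φ ∈ testFunctions F (univ : Set G)) (v : H) :
    inner ℂ (derivedRep U x ζ) (garding μ U φ v) =
      inner ℂ ζ (garding μ U (rightDeriv x φ) v) := by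
  obtain ⟨D, hD, hDx⟩ := hasDerivOne_inv_apply_garding μ hU hφ v
  have h1 := (hD.clm_comp ((innerSL ℂ ζ).restrictScalars ℝ)).derivOne_eq
  have h2 := ((hasDerivOne_of_mem_smoothVectors hζ).clm_comp
    (Complex.conjCLE.toContinuousLinearMap ∘L
      (innerSL ℂ (garding μ U φ v)).restrictScalars ℝ)).derivOne_eq
  -- By unitarity the same function of `g` is obtained from the inverse orbit of the Gårding vector
  -- and from the orbit of `ζ`; its derivative is computed in both ways.
  have h3 : (fun g => (innerSL ℂ ζ).restrictScalars ℝ (U g⁻¹ (garding μ U φ v))) =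
      fun g => (Complex.conjCLE.toContinuousLinearMap ∘L
        (innerSL ℂ (garding μ U φ v)).restrictScalars ℝ) (U g ζ) := by
    ext g
    change inner ℂ ζ (U g⁻¹ (garding μ U φ v)) = conj (inner ℂ (garding μ U φ v) (U g ζ))
    rw [inner_conj_symm, map_inv]
    exact (LinearIsometryEquiv.inner_map_eq_flip _ _ _).symm
  rw [h3, h2] at h1
  have h4 := congrArg (fun L : F →L[ℝ] ℂ => L x) h1
  have h5 : conj (inner ℂ (garding μ U φ v) (derivedRep U x ζ)) = inner ℂ ζ (D x) := h4
  rw [inner_conj_symm, hDx] at h5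
  exact h5

include hU in
-- Repeated integration by parts. This is how smearing turns the derivatives in a distribution
-- vector into an honest vector.
theorem exists_inner_word_garding (l : List F) {φ : G → ℝ}
    (hφ : φ ∈ testFunctions F (univ : Set G)) (v : H) :
    ∃ u : H, ∀ ξ : SmoothVec F U,
      inner ℂ (SmoothVec.word U l ξ).toH (garding μ U φ v) = inner ℂ ξ.toH u := by
  induction l generalizing φ with
  | nil => exact ⟨_, fun ξ => rfl⟩
  | cons x l ih =>
    obtain ⟨u, hu⟩ := ih (rightDeriv_mem (x := x) hφ)
    refine ⟨u, fun ξ => ?_⟩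
    rw [← hu, ← inner_derivedRep_garding μ hU x (SmoothVec.toH_mem _) hφ]
    rfl

include μ hU in
-- Normalized bump functions near `1` form an approximate identity.
theorem dense_smoothVectors : Dense (smoothVectors F U : Set H) := by
  have : IsTopologicalGroup G := topologicalGroup_of_lieGroup 𝓘(ℝ, F) ∞
  intro v
  rw [Metric.mem_closure_iff]
  intro ε hε
  have hnhds : {g : G | ‖U g v - v‖ < ε / 2} ∈ 𝓝 (1 : G) := by
    have hc : Continuous fun g => ‖U g v - v‖ := ((hU v).sub continuous_const).norm
    refine (isOpen_lt hc continuous_const).mem_nhds ?_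
    simpa using hε
  obtain ⟨f, -, hf⟩ := (SmoothBumpFunction.nhds_basis_tsupport (I := 𝓘(ℝ, F)) (1 : G)).mem_iff.1 hnhds
  have hft : (f : G → ℝ) ∈ testFunctions F (univ : Set G) :=
    ⟨f.contMDiff, f.hasCompactSupport, subset_univ _⟩
  have hpos : 0 < ∫ g, f g ∂μ := by
    refine f.continuous.integral_pos_of_hasCompactSupport_nonneg_nonzero f.hasCompactSupport
      (fun _ => f.nonneg) (x := 1) ?_
    simp
  refine ⟨(∫ g, f g ∂μ)⁻¹ • garding μ U f v, ?_, ?_⟩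
  · have := (smoothVectors F U).smul_mem ((((∫ g, f g ∂μ)⁻¹ : ℝ)) : ℂ)
      (garding_mem_smoothVectors μ hU hft v)
    rwa [Complex.coe_smul] at this
  · have hfi : Integrable f μ := f.continuous.integrable_of_hasCompactSupport f.hasCompactSupport
    have h1 : garding μ U f v - (∫ g, f g ∂μ) • v = ∫ g, f g • (U g v - v) ∂μ := by
      simp only [smul_sub]
      rw [integral_sub (integrable_testFunction_smul μ hft (hU v)) (hfi.smul_const v),
        integral_smul_const]
      rfl
    have h2 : ‖∫ g, f g • (U g v - v) ∂μ‖ ≤ ∫ g, f g * (ε / 2) ∂μ := by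
      refine norm_integral_le_of_norm_le (hfi.mul_const _) (ae_of_all _ fun g => ?_)
      rw [norm_smul, Real.norm_of_nonneg f.nonneg]
      by_cases hg : g ∈ tsupport f
      · exact mul_le_mul_of_nonneg_left (hf hg).le f.nonneg
      · simp [image_eq_zero_of_notMem_tsupport hg]
    rw [integral_mul_const] at h2
    have h3 : v - (∫ g, f g ∂μ)⁻¹ • garding μ U f v =
        -((∫ g, f g ∂μ)⁻¹ • (garding μ U f v - (∫ g, f g ∂μ) • v)) := by
      rw [smul_sub, smul_smul, inv_mul_cancel₀ hpos.ne', one_smul, neg_sub]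
    rw [dist_eq_norm, h3, norm_neg, norm_smul, h1, norm_inv, Real.norm_of_nonneg hpos.le]
    calc _ ≤ (∫ g, f g ∂μ)⁻¹ * ((∫ g, f g ∂μ) * (ε / 2)) := by gcongr
      _ = ε / 2 := by rw [← mul_assoc, inv_mul_cancel₀ hpos.ne', one_mul]
      _ < ε := by linarith

include μ hU in
theorem toFunctional_injective : Function.Injective (toFunctional F U) := by
  intro v w h
  refine (dense_smoothVectors (F := F) μ hU).eq_of_inner_right (𝕜 := ℂ) fun ξ hξ => ?_
  exact congrFun h ⟨ξ, hξ⟩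

end Garding

/-! ### The structure of distribution vectors -/

section Distribution

open MeasureTheory Filter Topology Set

variable {F : Type*} [NormedAddCommGroup F] [NormedSpace ℝ F]
  {G : Type*} [TopologicalSpace G] [ChartedSpace F G] [Group G] [LieGroup 𝓘(ℝ, F) ∞ G]
  {H : Type*} [NormedAddCommGroup H] [InnerProductSpace ℂ H]
  {U : G →* (H ≃ₗᵢ[ℂ] H)}

/-- A distribution vector is bounded by finitely many of the defining seminorms. -/
theorem exists_bound_distributionVector {η : SmoothVec F U → ℂ}
    (hη : η ∈ distributionVectors F U) :
    ∃ (L : Finset (List F)) (r : ℝ), 0 < r ∧ ∀ ξ,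
      ‖η ξ‖ * r ≤ ‖LinearMap.pi (fun l : L => SmoothVec.toHₗ F U ∘ₗ SmoothVec.word U l.1) ξ‖ := by
  obtain ⟨hadd, hsmul, hc⟩ := hη
  have hη0 : η 0 = 0 := by simpa using hsmul 0 0
  have hs : {ξ | ‖η ξ‖ < 1} ∈ 𝓝 (0 : SmoothVec F U) :=
    (isOpen_lt hc.norm continuous_const).mem_nhds (by simp [hη0])
  have hn : 𝓝 (0 : SmoothVec F U) = ⨅ l : List F,
      comap (fun ξ => (SmoothVec.word U l ξ).toH) (𝓝 0) := by
    refine (nhds_iInf (ι := List F)).trans (iInf_congr fun l => ?_)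
    rw [nhds_induced]
    congr 1
    · ext ξ
      exact (SmoothVec.toH_word l ξ).symm
    · rw [← SmoothVec.toH_word (F := F), map_zero]
      rfl
  rw [hn, mem_iInf_finite] at hs
  obtain ⟨L, hL⟩ := hs
  set q : SmoothVec F U →ₗ[ℂ] (L → H) :=
    LinearMap.pi (fun l : L => SmoothVec.toHₗ F U ∘ₗ SmoothVec.word U l.1) with hq
  -- Finitely many seminorms amount to one map `q` into a finite power of `H`, so a neighbourhood of
  -- `0` contains the preimage of a ball.
  have hq' : ⨅ l ∈ L, comap (fun ξ => (SmoothVec.word U l ξ).toH) (𝓝 0) = comap q (𝓝 0) := by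
    rw [nhds_pi, Filter.pi, comap_iInf, iInf_subtype']
    refine iInf_congr fun l => ?_
    rw [comap_comap]
    rfl
  rw [hq'] at hL
  obtain ⟨t, ht, hts⟩ := hL
  obtain ⟨r, hr, hrt⟩ := Metric.mem_nhds_iff.1 ht
  refine ⟨L, r, hr, fun ξ => ?_⟩
  by_contra hcon
  push Not at hcon
  have hpos : 0 < ‖η ξ‖ := by
    by_contra h0
    have : ‖η ξ‖ = 0 := le_antisymm (not_lt.1 h0) (norm_nonneg _)
    rw [this, zero_mul] at hcon
    exact absurd hcon (not_lt.2 (norm_nonneg _))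
  set c : ℂ := ((‖η ξ‖⁻¹ : ℝ) : ℂ) with hcdef
  have hcn : ‖c‖ = ‖η ξ‖⁻¹ := by simp [hcdef]
  have h1 : q (c • ξ) ∈ Metric.ball (0 : L → H) r := by
    rw [mem_ball_zero_iff, map_smul, norm_smul, hcn, inv_mul_lt_iff₀ hpos]
    exact hcon
  have h2 : ‖η (c • ξ)‖ < 1 := hts (hrt h1)
  rw [hsmul, norm_mul, RCLike.norm_conj, hcn, inv_mul_cancel₀ hpos.ne'] at h2
  exact lt_irrefl _ h2

/-- Distribution vectors are finite sums of derivatives of vectors. -/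
theorem exists_eq_sum_inner [CompleteSpace H] {η : SmoothVec F U → ℂ}
    (hη : η ∈ distributionVectors F U) :
    ∃ (L : Finset (List F)) (u : L → H), ∀ ξ,
      η ξ = ∑ l : L, inner ℂ (SmoothVec.word U l.1 ξ).toH (u l) := by
  classical
  obtain ⟨L, r, hr, hL⟩ := exists_bound_distributionVector hη
  obtain ⟨hadd, hsmul, hc⟩ := hη
  set q : SmoothVec F U →ₗ[ℂ] (L → H) :=
    LinearMap.pi (fun l : L => SmoothVec.toHₗ F U ∘ₗ SmoothVec.word U l.1) with hq
  set lam : SmoothVec F U →ₗ[ℂ] ℂ :=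
    { toFun := fun ξ => conj (η ξ)
      map_add' := fun ξ ζ => by rw [hadd, map_add]
      map_smul' := fun c ξ => by rw [hsmul, map_mul, Complex.conj_conj]; rfl } with hlam
  have hlamn : ∀ ξ, ‖lam ξ‖ = ‖η ξ‖ := fun ξ => RCLike.norm_conj _
  have hker : LinearMap.ker q ≤ LinearMap.ker lam := by
    intro ξ hξ
    rw [LinearMap.mem_ker] at hξ ⊢
    have := hL ξ
    rw [hξ, norm_zero, ← hlamn] at this
    exact norm_le_zero_iff.1 (nonpos_of_mul_nonpos_left this hr)
  -- The seminorm bound lets `conj ∘ η` factor through the range of `q` as a bounded functional.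
  -- Hahn–Banach extends it to the finite power of `H`, and Riesz represents each component.
  set f₀ : LinearMap.range q →ₗ[ℂ] ℂ :=
    (LinearMap.ker q).liftQ lam hker ∘ₗ q.quotKerEquivRange.symm.toLinearMap with hf₀
  have hf₀q : ∀ ξ, f₀ ⟨q ξ, LinearMap.mem_range_self q ξ⟩ = lam ξ := by
    intro ξ
    have h1 := q.quotKerEquivRange_symm_apply_image ξ (LinearMap.mem_range_self q ξ)
    simp only [hf₀, LinearMap.comp_apply, LinearEquiv.coe_coe, h1]
    simp
  set f : StrongDual ℂ (LinearMap.range q) := f₀.mkContinuous r⁻¹ (by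
    rintro ⟨_, ξ, rfl⟩
    rw [hf₀q, hlamn, inv_mul_eq_div, le_div_iff₀ hr]
    exact hL ξ) with hf
  obtain ⟨Λ, hΛ, -⟩ := exists_extension_norm_eq (LinearMap.range q) f
  have hΛq : ∀ ξ, Λ (q ξ) = conj (η ξ) := fun ξ =>
    (hΛ ⟨q ξ, LinearMap.mem_range_self q ξ⟩).trans (hf₀q ξ)
  refine ⟨L, fun l => (InnerProductSpace.toDual ℂ H).symm
    (Λ ∘L ContinuousLinearMap.single ℂ (fun _ : L => H) l), fun ξ => ?_⟩
  rw [← Complex.conj_conj (η ξ), ← hΛq]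
  conv_lhs => rw [← Finset.univ_sum_single (q ξ)]
  rw [map_sum, map_sum]
  refine Finset.sum_congr rfl fun l _ => ?_
  rw [← inner_conj_symm, InnerProductSpace.toDual_symm_apply]
  rfl

end Distribution

/-! ### Orbits of distribution vectors and smearing -/

section DistributionOrbits

open MeasureTheory Filter Topology Set

variable {F : Type*} [NormedAddCommGroup F] [NormedSpace ℝ F] [FiniteDimensional ℝ F]
  {G : Type*} [TopologicalSpace G] [ChartedSpace F G] [Group G] [LieGroup 𝓘(ℝ, F) ∞ G]
  {H : Type*} [NormedAddCommGroup H] [InnerProductSpace ℂ H]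
  {U : G →* (H ≃ₗᵢ[ℂ] H)} (hU : ∀ v, Continuous fun g => U g v)
  {γ : ℝ → G} (hγ : Continuous γ) (hadd : ∀ s t, γ (s + t) = γ s * γ t)

namespace SmoothVec

theorem toH_sub (ξ ζ : SmoothVec F U) : (ξ - ζ).toH = ξ.toH - ζ.toH := map_sub (toHₗ F U) ξ ζ

theorem toH_sum {ι : Type*} (s : Finset ι) (f : ι → SmoothVec F U) :
    (∑ i ∈ s, f i).toH = ∑ i ∈ s, (f i).toH := map_sum (toHₗ F U) f s

theorem toH_smul (c : ℂ) (ξ : SmoothVec F U) : (c • ξ).toH = c • ξ.toH := rfl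

theorem continuous_sub_const (ζ : SmoothVec F U) : Continuous fun ξ : SmoothVec F U => ξ - ζ :=
  continuous_of_word fun l => by
    simp only [map_sub, toH_sub]
    exact (continuous_word l).sub continuous_const

include hU in
theorem continuous_word_smoothAct (l : List F) (ξ : SmoothVec F U) :
    Continuous fun g => (word U l (smoothAct U g ξ)).toH := by
  -- Only the expansion is needed here, not the growth bound; hence the trivial curve.
  obtain ⟨ι, _, p, w, hp, -, h⟩ := exists_word_smoothAct (γ := fun _ => (1 : G)) U
    continuous_const (by simp) l
  simp only [h, toH_sum, toH_smul, toH_smoothAct]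
  exact continuous_finsetSum _ fun i _ =>
    (Complex.continuous_ofReal.comp (hp i).continuous).smul (hU _)

theorem continuous_smoothAct (g : G) : Continuous (smoothAct U g : SmoothVec F U → _) := by
  refine continuous_of_word fun l => ?_
  obtain ⟨ι, _, p, w, hp, -, h⟩ := exists_word_smoothAct (γ := fun _ => (1 : G)) U
    continuous_const (by simp) l
  simp only [h, toH_sum, toH_smul, toH_smoothAct]
  exact continuous_finsetSum _ fun i _ =>
    ((U g).continuous.comp (continuous_word (w i))).const_smul _

include hγ hadd in
-- The factor `P` replaces a continuous seminorm: its continuity and `P 0 = 0` are what later make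
-- `Φ(z)` a continuous functional.
theorem exists_norm_word_smoothAct_le (l : List F) :
    ∃ (c : ℝ) (P : SmoothVec F U → ℝ), 0 ≤ c ∧ Continuous P ∧ P 0 = 0 ∧ (∀ ξ, 0 ≤ P ξ) ∧
      ∀ ξ t, ‖(word U l (smoothAct U (γ t) ξ)).toH‖ ≤ P ξ * Real.exp (c * |t|) := by
  obtain ⟨ι, _, p, w, hp, ⟨A, c, hA, hc, hAc⟩, h⟩ := exists_word_smoothAct U hγ hadd l
  refine ⟨c, fun ξ => ∑ i, A * ‖(word U (w i) ξ).toH‖, hc,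
    continuous_finsetSum _ fun i _ => continuous_const.mul (continuous_word (w i)).norm, ?_,
    fun ξ => Finset.sum_nonneg fun i _ => by positivity, fun ξ t => ?_⟩
  · have : (0 : SmoothVec F U).toH = 0 := rfl
    simp [this]
  · simp only [h, toH_sum, toH_smul, toH_smoothAct, Finset.sum_mul]
    refine norm_sum_le_of_le _ fun i _ => ?_
    rw [norm_smul, LinearIsometryEquiv.norm_map, Complex.norm_real, Real.norm_eq_abs]
    calc _ ≤ A * Real.exp (c * |t|) * ‖(word U (w i) ξ).toH‖ := by gcongr; exact hAc i t
      _ = _ := by ring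

end SmoothVec

variable [CompleteSpace H] {η : SmoothVec F U → ℂ} (hη : η ∈ distributionVectors F U)

include hU hη in
theorem continuous_distribution_orbit (ξ : SmoothVec F U) :
    Continuous fun g => η (smoothAct U g ξ) := by
  obtain ⟨L, u, h⟩ := exists_eq_sum_inner hη
  simp only [h]
  exact continuous_finsetSum _ fun l _ =>
    (SmoothVec.continuous_word_smoothAct hU l.1 ξ).inner continuous_const

include hγ hadd hη in
/-- Distribution vectors have exponential growth along one-parameter groups. -/
theorem exists_norm_distribution_orbit_le :
    ∃ (c : ℝ) (P : SmoothVec F U → ℝ), 0 ≤ c ∧ Continuous P ∧ P 0 = 0 ∧ (∀ ξ, 0 ≤ P ξ) ∧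
      ∀ ξ t, ‖η (smoothAct U (γ t) ξ)‖ ≤ P ξ * Real.exp (c * |t|) := by
  obtain ⟨L, u, h⟩ := exists_eq_sum_inner hη
  choose c P hc hPc hP0 hPn hP using fun l : L =>
    SmoothVec.exists_norm_word_smoothAct_le (U := U) hγ hadd l.1
  refine ⟨∑ l, c l, fun ξ => ∑ l, P l ξ * ‖u l‖, Finset.sum_nonneg fun l _ => hc l,
    continuous_finsetSum _ fun l _ => (hPc l).mul continuous_const, by simp [hP0],
    fun ξ => Finset.sum_nonneg fun l _ => mul_nonneg (hPn l ξ) (norm_nonneg _), fun ξ t => ?_⟩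
  rw [h, Finset.sum_mul]
  refine norm_sum_le_of_le _ fun l _ => ?_
  have h1 : c l ≤ ∑ l, c l := Finset.single_le_sum (fun l _ => hc l) (Finset.mem_univ l)
  calc _ ≤ ‖(SmoothVec.word U l.1 (smoothAct U (γ t) ξ)).toH‖ * ‖u l‖ := norm_inner_le_norm _ _
    _ ≤ P l ξ * Real.exp ((∑ l, c l) * |t|) * ‖u l‖ := by
      gcongr
      refine (hP l ξ t).trans ?_
      have := hPn l ξ
      gcongr
    _ = _ := by ring

include hη in
theorem distAct_mem (g : G) : distAct U g η ∈ distributionVectors F U := by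
  obtain ⟨h1, h2, h3⟩ := hη
  refine ⟨fun ξ ζ => ?_, fun c ξ => ?_, h3.comp (SmoothVec.continuous_smoothAct g⁻¹)⟩
  · rw [distAct, ← SmoothVec.actₗ_apply, map_add, h1]; rfl
  · rw [distAct, ← SmoothVec.actₗ_apply, map_smul, h2]; rfl

omit [LieGroup 𝓘(ℝ, F) ∞ G] [FiniteDimensional ℝ F] [CompleteSpace H] in
theorem toFunctional_mem [LieGroup 𝓘(ℝ, F) ∞ G] (v : H) :
    toFunctional F U v ∈ distributionVectors F U := by
  refine ⟨fun ξ ζ => ?_, fun c ξ => ?_, ?_⟩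
  · exact inner_add_left _ _ _
  · exact inner_smul_left _ _ _
  · exact (SmoothVec.continuous_word ([] : List F)).inner continuous_const

include hU hη in
/-- The integrated action maps distribution vectors to vectors. -/
theorem exists_toFunctional_eq_distInt [T2Space G] [MeasurableSpace G] [BorelSpace G]
    (μ : Measure G) [μ.IsHaarMeasure] {φ : G → ℝ} (hφ : φ ∈ testFunctions F (univ : Set G)) :
    ∃ v : H, toFunctional F U v = distInt U μ φ η := by
  have : IsTopologicalGroup G := topologicalGroup_of_lieGroup 𝓘(ℝ, F) ∞
  obtain ⟨L, u, h⟩ := exists_eq_sum_inner hη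
  have key : ∀ l : L, ∃ v : H, ∀ ξ : SmoothVec F U,
      ∫ g, (φ g : ℂ) * inner ℂ (SmoothVec.word U l.1 (smoothAct U g⁻¹ ξ)).toH (u l) ∂μ =
        inner ℂ ξ.toH v := by
    intro l
    obtain ⟨ι, _, p, w, hp, -, hw⟩ := exists_word_smoothAct (γ := fun _ => (1 : G)) U
      continuous_const (by simp) l.1
    -- The coefficients of the expansion at `g⁻¹` are absorbed into the test function. Then `U(g⁻¹)`
    -- passes to the other side of the inner product, and the remaining word is integrated by parts.
    have hψ : ∀ i, (fun g => φ g * p i g⁻¹) ∈ testFunctions F (univ : Set G) := fun i =>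
      ⟨hφ.1.mul ((hp i).comp (contMDiff_inv 𝓘(ℝ, F) ∞)), hφ.2.1.mul_right, subset_univ _⟩
    choose v hv using fun i => exists_inner_word_garding μ hU (w i) (hψ i) (u l)
    refine ⟨∑ i, v i, fun ξ => ?_⟩
    rw [inner_sum]
    simp only [← hv]
    have h1 : ∀ i, inner ℂ (SmoothVec.word U (w i) ξ).toH
        (garding μ U (fun g => φ g * p i g⁻¹) (u l)) =
        ∫ g, (innerSL ℂ (SmoothVec.word U (w i) ξ).toH) ((φ g * p i g⁻¹) • U g (u l)) ∂μ :=
      fun i => ((innerSL ℂ (SmoothVec.word U (w i) ξ).toH).integral_comp_comm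
        (integrable_testFunction_smul μ (hψ i) (hU (u l)))).symm
    simp only [h1]
    rw [← integral_finsetSum _ fun i _ =>
      (innerSL ℂ (SmoothVec.word U (w i) ξ).toH).integrable_comp
        (integrable_testFunction_smul μ (hψ i) (hU (u l)))]
    congr 1 with g
    rw [hw, SmoothVec.toH_sum, sum_inner, Finset.mul_sum]
    refine Finset.sum_congr rfl fun i _ => ?_
    rw [SmoothVec.toH_smul, SmoothVec.toH_smoothAct, inner_smul_left, Complex.conj_ofReal,
      innerSL_apply_apply, ← Complex.coe_smul, inner_smul_right]
    push_cast
    rw [mul_assoc, map_inv]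
    congr 2
    exact LinearIsometryEquiv.inner_map_eq_flip _ _ _
  choose v hv using key
  refine ⟨∑ l, v l, ?_⟩
  ext ξ
  rw [toFunctional, inner_sum]
  simp only [← hv, distInt, distAct, h, Finset.mul_sum]
  rw [integral_finsetSum]
  intro l _
  have hcont : Continuous fun g => (φ g : ℂ) *
      inner ℂ (SmoothVec.word U l.1 (smoothAct U g⁻¹ ξ)).toH (u l) :=
    (Complex.continuous_ofReal.comp hφ.1.continuous).mul
      (((SmoothVec.continuous_word_smoothAct hU l.1 ξ).comp continuous_inv).inner continuous_const)
  refine hcont.integrable_of_hasCompactSupport (HasCompactSupport.mul_right ?_)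
  exact hφ.2.1.comp_left (g := fun r : ℝ => (r : ℂ)) Complex.ofReal_zero

end DistributionOrbits

/-! ### Weighted orbit integrals of smooth vectors -/

section GaussianVectors

open MeasureTheory Filter Topology Set

variable {F : Type*} [NormedAddCommGroup F] [NormedSpace ℝ F] [FiniteDimensional ℝ F]
  {G : Type*} [TopologicalSpace G] [ChartedSpace F G] [Group G] [LieGroup 𝓘(ℝ, F) ∞ G]
  {H : Type*} [NormedAddCommGroup H] [InnerProductSpace ℂ H] [CompleteSpace H]
  {U : G →* (H ≃ₗᵢ[ℂ] H)} (hU : ∀ v, Continuous fun g => U g v)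
  {γ : ℝ → G} (hγ : Continuous γ) (hadd : ∀ s t, γ (s + t) = γ s * γ t)

include hU hγ in
theorem RapidDecay.integrable_orbit {m : ℝ → ℂ} (hm : RapidDecay m) (v : H) :
    Integrable fun t => m t • U (γ t) v :=
  hm.integrable_smul ((hU v).comp hγ) (C := ‖v‖) (c := 0) fun t => by simp

include hU hγ hadd in
-- The derivative of the orbit map of `U(γ t) v` is `U(γ t) ∘ D ∘ Ad(γ t)⁻¹`. It grows at most
-- exponentially in `t`, so the rapid decay of `m` justifies differentiation under the integral.
theorem hasDerivOne_integral_orbit {m : ℝ → ℂ} (hm : RapidDecay m) {v : H} {D : F →L[ℝ] H}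
    (hD : HasDerivOne F (fun g => U g v) D) :
    ∃ D' : F →L[ℝ] H, HasDerivOne F (fun g => U g (∫ t, m t • U (γ t) v)) D' ∧
      ∀ x, D' x = ∫ t, m t • U (γ t) (D (lieAd (γ t)⁻¹ x)) := by
  have : IsTopologicalGroup G := topologicalGroup_of_lieGroup 𝓘(ℝ, F) ∞
  have : IsManifold 𝓘(ℝ, F) ∞ G := LieGroup.toContMDiffMul.toIsManifold
  obtain ⟨A, c, hA, hc, hAc⟩ := exists_norm_lieAd_le (F := F) hγ hadd
  set e := extChartAt 𝓘(ℝ, F) (1 : G) with he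
  obtain ⟨r, hr, hball⟩ := Metric.nhds_basis_closedBall.mem_iff.1
    (extChartAt_target_mem_nhds (I := 𝓘(ℝ, F)) (1 : G))
  rw [← he] at hball
  have : ProperSpace F := FiniteDimensional.proper ℝ F
  have hKc : IsCompact (Metric.closedBall (e 1) r) := isCompact_closedBall _ _
  obtain ⟨B, hB⟩ := hKc.exists_bound_of_continuousOn
    ((contDiffOn_chartTransl (G := G)).continuousOn.mono hball)
  have hB0 : 0 ≤ B := (norm_nonneg _).trans (hB (e 1) (Metric.mem_closedBall_self hr.le))
  set K : ℝ → F →L[ℝ] H := fun t => realCLM (U (γ t)) ∘L D ∘L lieAd (γ t)⁻¹ with hK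
  have hKn : ∀ t, ‖K t‖ ≤ ‖D‖ * A * Real.exp (c * |t|) := by
    intro t
    calc ‖K t‖ ≤ ‖realCLM (U (γ t))‖ * (‖D‖ * ‖lieAd (F := F) (γ t)⁻¹‖) :=
          (ContinuousLinearMap.opNorm_comp_le _ _).trans
            (mul_le_mul_of_nonneg_left (ContinuousLinearMap.opNorm_comp_le _ _) (norm_nonneg _))
      _ ≤ 1 * (‖D‖ * (A * Real.exp (c * |t|))) := by
        gcongr
        · exact norm_realCLM_le _
        · exact hAc t
      _ = _ := by ring
  have hUc : Continuous fun p : G × H => U p.1 p.2 :=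
    continuous_prod_of_continuous_lipschitzWith' (fun p : G × H => U p.1 p.2) 1
      (fun g => (U g).lipschitz) hU
  have hKc' : Continuous K := by
    refine continuous_clm_apply.2 fun x => ?_
    have h1 : Continuous fun t => lieAd (F := F) (γ t)⁻¹ x :=
      ((contMDiff_lieAd (F := F) (G := G)).continuous.comp hγ.inv).clm_apply continuous_const
    exact hUc.comp (hγ.prodMk (D.continuous.comp h1))
  have hKint : Integrable fun t => m t • K t := hm.integrable_smul hKc' hKn
  set F' : F → ℝ → F →L[ℝ] H := fun y t =>
    m t • (realCLM (U (e.symm y)) ∘L K t ∘L chartTransl F G y) with hF'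
  have hF'1 : ∀ t, F' (e 1) t = m t • K t := by
    intro t
    simp only [hF']
    rw [he, chartTransl_one, extChartAt_to_inv]
    ext x
    simp
  have hfun : ∀ g, U g (∫ t, m t • U (γ t) v) = ∫ t, m t • U g (U (γ t) v) := by
    intro g
    have h1 := (U g).toContinuousLinearEquiv.toContinuousLinearMap.integral_comp_comm
      (hm.integrable_orbit hU hγ v)
    refine h1.symm.trans (integral_congr_ae (ae_of_all _ fun t => ?_))
    exact (U g).map_smul _ _
  have hint : ∀ g, Integrable fun t => m t • U g (U (γ t) v) := fun g =>
    hm.integrable_smul ((U g).continuous.comp ((hU v).comp hγ)) (C := ‖v‖) (c := 0) fun t => by simp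
  have key : HasFDerivAt (fun y => ∫ t, m t • U (e.symm y) (U (γ t) v))
      (∫ t, F' (e 1) t) (e 1) := by
    refine hasFDerivAt_integral_of_dominated_of_fderiv_le
      (bound := fun t => ‖D‖ * A * B * (Real.exp (c * |t|) * ‖m t‖))
      (Metric.closedBall_mem_nhds (e 1) hr)
      (Eventually.of_forall fun y => (hint _).aestronglyMeasurable) (hint _) ?_
      (ae_of_all _ fun t y hy => ?_) ((hm.2 c).const_mul _) (ae_of_all _ fun t y hy => ?_)
    · rw [funext hF'1]
      exact hKint.aestronglyMeasurable
    · rw [hF', norm_smul]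
      have h1 : ‖realCLM (U (e.symm y)) ∘L K t ∘L chartTransl F G y‖ ≤
          1 * (‖D‖ * A * Real.exp (c * |t|) * B) := by
        refine (ContinuousLinearMap.opNorm_comp_le _ _).trans
          (mul_le_mul (norm_realCLM_le _) ?_ (norm_nonneg _) zero_le_one)
        exact (ContinuousLinearMap.opNorm_comp_le _ _).trans
          (mul_le_mul (hKn t) (hB y hy) (norm_nonneg _) ((norm_nonneg _).trans (hKn t)))
      calc _ ≤ ‖m t‖ * (1 * (‖D‖ * A * Real.exp (c * |t|) * B)) := by gcongr
        _ = _ := by ring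
    · exact ((hD.orbit_apply (γ t)).hasFDerivAt_orbit (hball hy)).const_smul (m t)
  rw [funext hF'1] at key
  refine ⟨∫ t, m t • K t, ?_, fun x => ?_⟩
  · rw [hasDerivOne_iff]
    simp only [hfun]
    refine ⟨?_, key⟩
    simp only [← hfun]
    exact (hU _).continuousAt
  · rw [ContinuousLinearMap.integral_apply hKint]
    rfl

include hU hγ hadd in
theorem integral_orbit_apply_deriv {m : ℝ → ℂ} (hm : RapidDecay m) (D : F →L[ℝ] H) (x : F) :
    (∀ j, RapidDecay fun t => m t * ((Module.finBasis ℝ F).repr (lieAd (γ t)⁻¹ x) j : ℝ)) ∧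
    ∫ t, m t • U (γ t) (D (lieAd (γ t)⁻¹ x)) = ∑ j, ∫ t,
      (m t * ((Module.finBasis ℝ F).repr (lieAd (γ t)⁻¹ x) j : ℝ)) •
        U (γ t) (D (Module.finBasis ℝ F j)) := by
  have : IsTopologicalGroup G := topologicalGroup_of_lieGroup 𝓘(ℝ, F) ∞
  obtain ⟨A, c, hA, hc, hAc⟩ := exists_norm_lieAd_le (F := F) hγ hadd
  set b := Module.finBasis ℝ F
  have h1 : ∀ j, RapidDecay fun t => m t * (b.repr (lieAd (γ t)⁻¹ x) j : ℝ) := by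
    intro j
    set L : F →L[ℝ] ℝ := LinearMap.toContinuousLinearMap (b.coord j)
    refine hm.mul (C := ‖L‖ * A * ‖x‖) (c := c) (Complex.continuous_ofReal.comp ?_) fun t => ?_
    · exact L.continuous.comp (((contMDiff_lieAd (F := F) (G := G)).continuous.comp
        hγ.inv).clm_apply continuous_const)
    · rw [Complex.norm_real]
      calc ‖L (lieAd (γ t)⁻¹ x)‖ ≤ ‖L‖ * (A * Real.exp (c * |t|) * ‖x‖) := by
            refine (L.le_opNorm _).trans ?_
            gcongr
            exact (ContinuousLinearMap.le_opNorm _ _).trans (by gcongr; exact hAc t)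
        _ = _ := by ring
  refine ⟨h1, ?_⟩
  rw [← integral_finsetSum _ fun j _ => (h1 j).integrable_orbit hU hγ _]
  congr 1 with t
  conv_lhs => rw [← b.sum_repr (lieAd (γ t)⁻¹ x)]
  rw [map_sum, map_sum, Finset.smul_sum]
  refine Finset.sum_congr rfl fun j _ => ?_
  rw [map_smul, mul_smul, Complex.coe_smul]
  congr 1
  exact (realCLM (U (γ t))).map_smul _ _

include hU hγ hadd in
-- With arbitrary rapidly decaying weights and smooth vectors allowed, the derivatives of such
-- integrals are finite sums of integrals of the same kind, and `subset_smoothVectors` applies.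
theorem integral_orbit_mem {m : ℝ → ℂ} (hm : RapidDecay m) {v : H} (hv : v ∈ smoothVectors F U) :
    ∫ t, m t • U (γ t) v ∈ smoothVectors F U := by
  refine subset_smoothVectors (S := {u | ∃ m : ℝ → ℂ, RapidDecay m ∧ ∃ v ∈ smoothVectors F U,
    u = ∫ t, m t • U (γ t) v}) ?_ ⟨m, hm, v, hv, rfl⟩
  rintro u ⟨m, hm, v, hv, rfl⟩
  have hD := hasDerivOne_of_mem_smoothVectors hv
  obtain ⟨D', hD', hx⟩ := hasDerivOne_integral_orbit hU hγ hadd hm hD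
  refine ⟨D', hD', fun x => ?_⟩
  obtain ⟨h1, h2⟩ := integral_orbit_apply_deriv hU hγ hadd hm (derivOne F fun g => U g v) x
  rw [hx, h2]
  exact Submodule.sum_mem _ fun j _ =>
    Submodule.subset_span ⟨_, h1 j, _, derivedRep_mem (Module.finBasis ℝ F j) hv, rfl⟩

/-- The smooth vector `∫ m(t) U(γ t) ξ dt`. -/
def orbitIntegral {m : ℝ → ℂ} (hm : RapidDecay m) (ξ : SmoothVec F U) : SmoothVec F U :=
  ⟨∫ t, m t • U (γ t) ξ.toH, integral_orbit_mem hU hγ hadd hm ξ.2⟩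

theorem deriv_orbitIntegral {m : ℝ → ℂ} (hm : RapidDecay m) (x : F) (ξ : SmoothVec F U) :
    SmoothVec.deriv U x (orbitIntegral hU hγ hadd hm ξ) =
      ∑ j, orbitIntegral hU hγ hadd
        ((integral_orbit_apply_deriv hU hγ hadd hm (derivOne F fun g => U g ξ.toH) x).1 j)
        (SmoothVec.deriv U (Module.finBasis ℝ F j) ξ) := by
  apply SmoothVec.toH_injective
  obtain ⟨D', hD', hx⟩ := hasDerivOne_integral_orbit hU hγ hadd hm
    (hasDerivOne_of_mem_smoothVectors ξ.2)
  rw [SmoothVec.toH_deriv_eq, SmoothVec.toH_sum]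
  refine (congrArg (fun D : F →L[ℝ] H => D x) hD'.derivOne_eq).trans ((hx x).trans ?_)
  exact (integral_orbit_apply_deriv hU hγ hadd hm (derivOne F fun g => U g ξ.toH) x).2

include hU hγ hadd in
theorem RapidDecay.integrable_word_orbit {m : ℝ → ℂ} (hm : RapidDecay m) (l : List F)
    (ξ : SmoothVec F U) :
    Integrable fun t => m t • (SmoothVec.word U l (smoothAct U (γ t) ξ)).toH := by
  obtain ⟨c, P, -, -, -, -, hP⟩ := SmoothVec.exists_norm_word_smoothAct_le (U := U) hγ hadd l
  exact hm.integrable_smul ((SmoothVec.continuous_word_smoothAct hU l ξ).comp hγ) (hP ξ)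

/-- Interchanging derivatives with the integral makes `η`, a sum of derivatives of vectors, commute
with orbit integrals. -/
theorem toH_word_orbitIntegral (l : List F) {m : ℝ → ℂ} (hm : RapidDecay m) (ξ : SmoothVec F U) :
    (SmoothVec.word U l (orbitIntegral hU hγ hadd hm ξ)).toH =
      ∫ t, m t • (SmoothVec.word U l (smoothAct U (γ t) ξ)).toH := by
  induction l using List.reverseRecOn generalizing m ξ with
  | nil => rfl
  | append_singleton l x ih =>
    have h0 : ∀ ζ, SmoothVec.word U (l ++ [x]) ζ =
        SmoothVec.word U l (SmoothVec.deriv U x ζ) := fun ζ => by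
      rw [SmoothVec.word_append]; rfl
    rw [h0, deriv_orbitIntegral, map_sum, SmoothVec.toH_sum]
    simp only [ih]
    rw [← integral_finsetSum _ fun j _ => RapidDecay.integrable_word_orbit hU hγ hadd
      ((integral_orbit_apply_deriv hU hγ hadd hm (derivOne F fun g => U g ξ.toH) x).1 j) l _]
    congr 1 with t
    rw [h0, SmoothVec.deriv_smoothAct, map_sum, SmoothVec.toH_sum, Finset.smul_sum]
    refine Finset.sum_congr rfl fun j _ => ?_
    rw [map_smul, SmoothVec.toH_smul, mul_smul]

/-- Distribution vectors commute with the integrals over orbits. -/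
theorem distribution_orbitIntegral {η : SmoothVec F U → ℂ} (hη : η ∈ distributionVectors F U)
    {m : ℝ → ℂ} (hm : RapidDecay m) (ξ : SmoothVec F U) :
    η (orbitIntegral hU hγ hadd hm ξ) = ∫ t, conj (m t) * η (smoothAct U (γ t) ξ) := by
  obtain ⟨L, u, h⟩ := exists_eq_sum_inner hη
  simp only [h, Finset.mul_sum]
  have h1 : ∀ (l : L) t, conj (m t) * inner ℂ (SmoothVec.word U l.1 (smoothAct U (γ t) ξ)).toH (u l) =
      conj (innerSL ℂ (u l) (m t • (SmoothVec.word U l.1 (smoothAct U (γ t) ξ)).toH)) := by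
    intro l t
    rw [innerSL_apply_apply, inner_conj_symm, inner_smul_left]
  simp only [h1]
  have h2 : ∀ l : L, Integrable fun t =>
      innerSL ℂ (u l) (m t • (SmoothVec.word U l.1 (smoothAct U (γ t) ξ)).toH) := fun l =>
    (innerSL ℂ (u l)).integrable_comp (hm.integrable_word_orbit hU hγ hadd l.1 ξ)
  have h3 : ∀ l : L, Integrable fun t =>
      conj (innerSL ℂ (u l) (m t • (SmoothVec.word U l.1 (smoothAct U (γ t) ξ)).toH)) := fun l =>
    Complex.conjCLE.toContinuousLinearMap.integrable_comp (h2 l)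
  rw [integral_finsetSum _ fun l _ => h3 l]
  refine Finset.sum_congr rfl fun l _ => ?_
  rw [integral_conj, (innerSL ℂ (u l)).integral_comp_comm
    (hm.integrable_word_orbit hU hγ hadd l.1 ξ), innerSL_apply_apply, inner_conj_symm,
    toH_word_orbitIntegral]

end GaussianVectors

/-! ### The conjugation on smooth vectors -/

section Conjugation

open MeasureTheory Filter Topology Set

variable {F : Type*} [NormedAddCommGroup F] [NormedSpace ℝ F]
  {G : Type*} [TopologicalSpace G] [ChartedSpace F G] [Group G]
  {H : Type*} [NormedAddCommGroup H] [InnerProductSpace ℂ H]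
  (ρ : AntiunitaryRep F G H)

/-- Polarization: the real terms are preserved, while the two imaginary terms are exchanged because
`J` anticommutes with `i`. -/
theorem inner_antilinear_isometry (J : H ≃ₗᵢ⋆[ℂ] H) (v w : H) :
    inner ℂ (J v) (J w) = inner ℂ w v := by
  rw [← inner_conj_symm w v, inner_eq_sum_norm_sq_div_four, inner_eq_sum_norm_sq_div_four]
  have hI : ∀ u : H, Complex.I • J u = J (-(Complex.I • u)) := fun u => by
    rw [map_neg, J.map_smulₛₗ]; simp
  have h1 : ‖J v + J w‖ = ‖v + w‖ := by rw [← map_add, J.norm_map]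
  have h2 : ‖J v - J w‖ = ‖v - w‖ := by rw [← map_sub, J.norm_map]
  have h3 : ‖J v + Complex.I • J w‖ = ‖v - Complex.I • w‖ := by
    rw [hI, ← map_add, J.norm_map, sub_eq_add_neg]
  have h4 : ‖J v - Complex.I • J w‖ = ‖v + Complex.I • w‖ := by
    rw [hI, ← map_sub, J.norm_map, sub_neg_eq_add]
  simp only [RCLike.I_to_complex] at *
  rw [h1, h2, h3, h4]
  simp only [map_div₀, map_add, map_sub, map_mul, map_pow, Complex.conj_I, map_ofNat,
    Complex.coe_algebraMap, Complex.conj_ofReal]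
  ring

namespace AntiunitaryRep

theorem J_U (g : G) (v : H) : ρ.J (ρ.U g v) = ρ.U (ρ.τ g) (ρ.J v) := by
  rw [← ρ.J_U_J, ρ.J_J]

theorem U_J (g : G) (v : H) : ρ.U g (ρ.J v) = ρ.J (ρ.U (ρ.τ g) v) := by
  rw [J_U, ρ.τ_τ]

theorem conj_inner_J (v w : H) : conj (inner ℂ (ρ.J v) w) = inner ℂ v (ρ.J w) := by
  have h := inner_antilinear_isometry ρ.J (ρ.J v) w
  rw [ρ.J_J] at h
  rw [inner_conj_symm, h]

/-- The conjugation as a real linear map. -/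
def realJ : H →L[ℝ] H where
  toFun := ρ.J
  map_add' := ρ.J.map_add
  map_smul' r v := by
    have h := ρ.J.map_smulₛₗ (r : ℂ) v
    rw [Complex.conj_ofReal] at h
    exact h
  cont := ρ.J.continuous

theorem realJ_apply (v : H) : ρ.realJ v = ρ.J v := rfl

theorem toH_smoothJ (ξ : SmoothVec F ρ.U) : (ρ.smoothJ ξ).toH = ρ.J ξ.toH := rfl

variable [LieGroup 𝓘(ℝ, F) ∞ G]

theorem smoothJ_smoothAct (g : G) (ξ : SmoothVec F ρ.U) :
    ρ.smoothJ (smoothAct ρ.U g ξ) = smoothAct ρ.U (ρ.τ g) (ρ.smoothJ ξ) :=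
  SmoothVec.toH_injective (ρ.J_U g ξ.toH)

/-- Differentiating `U(g) J = J U(τ g)` gives `dU(x) J = J dU(dτ x)`, so each letter is replaced by
its image under the differential of `τ`. -/
theorem exists_word_smoothJ (l : List F) : ∃ l' : List F, ∀ ξ : SmoothVec F ρ.U,
    SmoothVec.word ρ.U l (ρ.smoothJ ξ) = ρ.smoothJ (SmoothVec.word ρ.U l' ξ) := by
  have h2 := (ρ.contMDiff_τ.mdifferentiable (by simp) 1).hasMFDerivAt
  set T : F →L[ℝ] F := mfderiv 𝓘(ℝ, F) 𝓘(ℝ, F) ρ.τ 1 with hT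
  induction l with
  | nil => exact ⟨[], fun ξ => rfl⟩
  | cons x l ih =>
    obtain ⟨l', hl'⟩ := ih
    refine ⟨T x :: l', fun ξ => ?_⟩
    rw [SmoothVec.word_cons, LinearMap.comp_apply, hl', SmoothVec.word_cons, LinearMap.comp_apply]
    set ζ := SmoothVec.word ρ.U l' ξ
    have h3 : HasMFDerivAt 𝓘(ℝ, F) 𝓘(ℝ, H) (fun g : G => ρ.U g ζ.toH) (ρ.τ 1)
        (derivOne F fun g : G => ρ.U g ζ.toH) := by
      rw [map_one]
      exact hasDerivOne_of_mem_smoothVectors ζ.2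
    have h4 : HasDerivOne F (fun g : G => ρ.U (ρ.τ g) ζ.toH)
        ((derivOne F fun g : G => ρ.U g ζ.toH) ∘L T) := HasMFDerivAt.comp (1 : G) h3 h2
    have h5 := h4.clm_comp ρ.realJ
    simp only [realJ_apply, ← U_J] at h5
    apply SmoothVec.toH_injective
    exact congrArg (fun D : F →L[ℝ] H => D x) h5.derivOne_eq

theorem continuous_smoothJ : Continuous ρ.smoothJ := by
  refine SmoothVec.continuous_of_word fun l => ?_
  obtain ⟨l', hl'⟩ := ρ.exists_word_smoothJ l
  simp only [hl', toH_smoothJ]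
  exact ρ.J.continuous.comp (SmoothVec.continuous_word l')

end AntiunitaryRep

end Conjugation

/-! ### The KMS condition tested on Gaussian vectors -/

section KMSCondition

open MeasureTheory Filter Topology Set

variable {F : Type*} [NormedAddCommGroup F] [NormedSpace ℝ F] [FiniteDimensional ℝ F]
  {G : Type*} [TopologicalSpace G] [ChartedSpace F G] [Group G] [LieGroup 𝓘(ℝ, F) ∞ G]
  {H : Type*} [NormedAddCommGroup H] [InnerProductSpace ℂ H] [CompleteSpace H]
  (ρ : AntiunitaryRep F G H)
  {γ : ℝ → G} (hγ : Continuous γ) (hadd : ∀ s t, γ (s + t) = γ s * γ t)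
  (hτ : ∀ t, ρ.τ (γ t) = γ t)

theorem one_parameter_inv {γ : ℝ → G} (hadd : ∀ s t, γ (s + t) = γ s * γ t) (t : ℝ) :
    (γ t)⁻¹ = γ (-t) := by
  have h0 : γ 0 = 1 := by simpa using hadd 0 0
  rw [inv_eq_iff_mul_eq_one, ← hadd, add_neg_cancel, h0]

namespace AntiunitaryRep

theorem U_add {γ : ℝ → G} (hadd : ∀ s t, γ (s + t) = γ s * γ t) (s t : ℝ) (v : H) :
    ρ.U (γ (s + t)) v = ρ.U (γ s) (ρ.U (γ t) v) := by
  rw [hadd, map_mul]; rfl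

/-- The Gaussian mollification of a smooth vector along the one-parameter group. -/
def gaussVec {δ : ℝ} (hδ : 0 < δ) (z : ℂ) (ξ : SmoothVec F ρ.U) : SmoothVec F ρ.U :=
  orbitIntegral ρ.continuous_orbit hγ hadd (rapidDecay_gaussKernel hδ z) ξ

theorem toH_gaussVec {δ : ℝ} (hδ : 0 < δ) (z : ℂ) (ξ : SmoothVec F ρ.U) :
    (ρ.gaussVec hγ hadd hδ z ξ).toH = mollify δ (fun t => ρ.U (γ t) ξ.toH) z := rfl

/-- The KMS condition for a distribution vector, tested on Gaussian mollifications of smooth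
vectors. -/
def GaussKMS (η : SmoothVec F ρ.U → ℂ) : Prop :=
  ∀ (δ : ℝ) (hδ : 0 < δ) (ξ : SmoothVec F ρ.U),
    η (ρ.gaussVec hγ hadd hδ (Real.pi * Complex.I) ξ) =
      conj (η (ρ.smoothJ (ρ.gaussVec hγ hadd hδ 0 ξ)))

/-- Antilinearity of `η` conjugates the kernel, and the inverse in the dual action reflects `t`.
Together they send `z` to `-conj z`, which fixes `πi`. -/
theorem apply_gaussVec {η : SmoothVec F ρ.U → ℂ} (hη : η ∈ distributionVectors F ρ.U) {δ : ℝ}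
    (hδ : 0 < δ) (z : ℂ) (ξ : SmoothVec F ρ.U) :
    η (ρ.gaussVec hγ hadd hδ z ξ) =
      mollify δ (fun t => η (smoothAct ρ.U (γ t)⁻¹ ξ)) (-conj z) := by
  rw [gaussVec, distribution_orbitIntegral _ _ _ hη, ← mollify_comp_neg]
  congr 1 with t
  beta_reduce
  rw [conj_gaussKernel, one_parameter_inv hadd, neg_neg]
  simp

include hτ in
theorem smoothJ_gaussVec {δ : ℝ} (hδ : 0 < δ) (ξ : SmoothVec F ρ.U) :
    ρ.smoothJ (ρ.gaussVec hγ hadd hδ 0 ξ) = ρ.gaussVec hγ hadd hδ 0 (ρ.smoothJ ξ) := by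
  apply SmoothVec.toH_injective
  rw [toH_smoothJ, toH_gaussVec, toH_gaussVec, mollify, mollify, ← realJ_apply,
    ← ρ.realJ.integral_comp_comm
      ((rapidDecay_gaussKernel hδ 0).integrable_orbit ρ.continuous_orbit hγ ξ.toH)]
  congr 1 with t
  rw [realJ_apply, ρ.J.map_smulₛₗ, conj_gaussKernel, J_U, hτ]
  simp [toH_smoothJ]

theorem neg_conj_pi_mul_I : -conj ((Real.pi : ℂ) * Complex.I) = Real.pi * Complex.I := by
  simp

include hτ in
theorem gaussKMS_iff {η : SmoothVec F ρ.U → ℂ} (hη : η ∈ distributionVectors F ρ.U) :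
    ρ.GaussKMS hγ hadd η ↔ ∀ δ : ℝ, 0 < δ → ∀ ξ : SmoothVec F ρ.U,
      mollify δ (fun t => η (smoothAct ρ.U (γ t)⁻¹ ξ)) (Real.pi * Complex.I) =
        mollify δ (fun t => conj (η (smoothAct ρ.U (γ t)⁻¹ (ρ.smoothJ ξ)))) 0 := by
  refine forall_congr' fun δ => forall_congr' fun hδ => forall_congr' fun ξ => ?_
  rw [smoothJ_gaussVec ρ hγ hadd hτ, apply_gaussVec ρ hγ hadd hη, apply_gaussVec ρ hγ hadd hη,
    mollify_conj, neg_conj_pi_mul_I, map_zero, neg_zero]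

/-- The functional `Φ(z)` is tested on the Gaussian vector `ζ` at parameter `0`. The result and the
entire mollification of the orbit function agree for real `z`, hence at `πi`, where the boundary
condition of `Φ` applies. -/
theorem gaussKMS_of_mem_distKMS {η : SmoothVec F ρ.U → ℂ} (h : η ∈ ρ.distKMS γ) :
    ρ.GaussKMS hγ hadd η := by
  obtain ⟨hη, Φ, hΦmem, hΦreal, hΦcont, hΦdiff, hΦJ⟩ := h
  intro δ hδ ξ
  set ζ := ρ.gaussVec hγ hadd hδ 0 ξ with hζ
  set k : ℝ → ℂ := fun t => η (smoothAct ρ.U (γ t)⁻¹ ξ) with hk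
  obtain ⟨c, P, hc, -, -, hP0, hP⟩ := exists_norm_distribution_orbit_le hγ hadd hη
  have hkc : Continuous k := by
    have := (continuous_distribution_orbit ρ.continuous_orbit hη ξ).comp
      (hγ.comp continuous_neg)
    refine this.congr fun t => ?_
    simp [hk, one_parameter_inv hadd]
  have hkC : ∀ t, ‖k t‖ ≤ P ξ * Real.exp (c * |t|) := fun t => by
    simpa [hk, one_parameter_inv hadd] using hP ξ (-t)
  have hg := differentiable_mollify hδ hkc hkC
  have hreal : ∀ t : ℝ, Φ t ζ = mollify δ k t := by
    intro t
    have h1 : smoothAct ρ.U (γ t)⁻¹ ζ = ρ.gaussVec hγ hadd hδ ((-t : ℝ) : ℂ) ξ := by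
      apply SmoothVec.toH_injective
      rw [SmoothVec.toH_smoothAct, hζ, toH_gaussVec, toH_gaussVec, one_parameter_inv hadd,
        apply_mollify_orbit (V := fun t => ρ.U (γ t)) (ρ.U_add hadd)
          (fun v => (ρ.continuous_orbit v).comp hγ) hδ, zero_add]
    rw [hΦreal, distAct, h1, apply_gaussVec ρ hγ hadd hη, Complex.conj_ofReal]
    simp
    rfl
  have hzero := eq_zero_of_eq_zero_on_real (h := fun z => Φ z ζ - mollify δ k z)
    ((hΦcont ζ).sub hg.continuous.continuousOn) ((hΦdiff ζ).sub hg.differentiableOn)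
    (fun t => by rw [hreal, sub_self]) (Real.pi * Complex.I) (by simp [Real.pi_pos.le])
  have h1 := hΦJ 0
  rw [Complex.ofReal_zero, zero_add] at h1
  have h0 : γ 0 = 1 := by simpa using hadd 0 0
  rw [apply_gaussVec ρ hγ hadd hη, neg_conj_pi_mul_I, ← sub_eq_zero.1 hzero, h1, distJ]
  have h2 := hΦreal 0
  rw [Complex.ofReal_zero] at h2
  rw [h2, distAct, h0, inv_one]
  congr 2
  apply SmoothVec.toH_injective
  rw [SmoothVec.toH_smoothAct, map_one]
  rfl

include hτ in
-- For each `ξ` the orbit function extends to the strip by `exists_strip_extension`. Because the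
-- extension is a limit of mollifications, it inherits antilinearity in `ξ` and a bound uniform in
-- `δ`.
theorem mem_distKMS_of_gaussKMS {η : SmoothVec F ρ.U → ℂ} (hη : η ∈ distributionVectors F ρ.U)
    (h : ρ.GaussKMS hγ hadd η) : η ∈ ρ.distKMS γ := by
  rw [gaussKMS_iff ρ hγ hadd hτ hη] at h
  obtain ⟨hηadd, hηsmul, -⟩ := id hη
  obtain ⟨c, P, hc, hPc, hP0, hPn, hP⟩ := exists_norm_distribution_orbit_le hγ hadd hη
  set k : SmoothVec F ρ.U → ℝ → ℂ := fun ξ t => η (smoothAct ρ.U (γ t)⁻¹ ξ) with hk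
  -- A single constant that dominates both the lower boundary function, with `ξ`, and the upper one,
  -- with `J ξ`.
  set N : SmoothVec F ρ.U → ℝ := fun ξ => P ξ + P (ρ.smoothJ ξ) with hN
  have hNn : ∀ ξ, 0 ≤ N ξ := fun ξ => add_nonneg (hPn _) (hPn _)
  have hkc : ∀ ξ, Continuous (k ξ) := fun ξ => by
    have := (continuous_distribution_orbit ρ.continuous_orbit hη ξ).comp
      (hγ.comp continuous_neg)
    refine this.congr fun t => ?_
    simp [hk, one_parameter_inv hadd]
  have hkP : ∀ ξ t, ‖k ξ t‖ ≤ P ξ * Real.exp (c * |t|) := fun ξ t => by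
    simpa [hk, one_parameter_inv hadd] using hP ξ (-t)
  have hkC : ∀ ξ t, ‖k ξ t‖ ≤ N ξ * Real.exp (c * |t|) := fun ξ t => by
    refine (hkP ξ t).trans ?_
    have := hPn (ρ.smoothJ ξ)
    gcongr
    simp only [hN]
    linarith
  have hlC : ∀ ξ t, ‖conj (k (ρ.smoothJ ξ) t)‖ ≤ N ξ * Real.exp (c * |t|) := fun ξ t => by
    rw [RCLike.norm_conj]
    refine (hkP _ t).trans ?_
    have := hPn ξ
    gcongr
    simp only [hN]
    linarith
  have hlc : ∀ ξ, Continuous fun t => conj (k (ρ.smoothJ ξ) t) := fun ξ =>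
    Complex.continuous_conj.comp (hkc _)
  have htrans : ∀ ξ s t, k (smoothAct ρ.U (γ s)⁻¹ ξ) t = k ξ (t + s) := by
    intro ξ s t
    simp only [hk]
    rw [← SmoothVec.smoothAct_mul, ← mul_inv_rev, ← hadd, add_comm]
  have hstrip : ∀ ξ, ∀ δ : ℝ, 0 < δ → ∀ s : ℝ, mollify δ (k ξ) (s + Real.pi * Complex.I) =
      mollify δ (fun t => conj (k (ρ.smoothJ ξ) t)) s := by
    intro ξ δ hδ s
    -- The hypothesis only concerns the point `πi`; applied to translates of `ξ` it gives the whole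
    -- line `s + πi`. Since `τ` fixes `γ`, translation commutes with `J`.
    have h1 := h δ hδ (smoothAct ρ.U (γ s)⁻¹ ξ)
    have h2 : ρ.smoothJ (smoothAct ρ.U (γ s)⁻¹ ξ) = smoothAct ρ.U (γ s)⁻¹ (ρ.smoothJ ξ) := by
      rw [smoothJ_smoothAct, map_inv, hτ]
    rw [h2] at h1
    change mollify δ (fun t => k (smoothAct ρ.U (γ s)⁻¹ ξ) t) _ =
      mollify δ (fun t => conj (k (smoothAct ρ.U (γ s)⁻¹ (ρ.smoothJ ξ)) t)) 0 at h1
    simp only [htrans] at h1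
    rw [mollify_translate δ (k ξ),
      mollify_translate δ (fun t => conj (k (ρ.smoothJ ξ) t)), zero_add] at h1
    rw [add_comm]
    exact h1
  choose Ψ hΨlim hΨcont hΨdiff hΨ0 hΨπ using fun ξ => exists_strip_extension (hkc ξ) (hlc ξ) hc
    (hNn ξ) (hkC ξ) (hlC ξ) (hstrip ξ)
  have hΨadd : ∀ z ∈ Complex.im ⁻¹' Icc 0 Real.pi, ∀ ξ ζ, Ψ (ξ + ζ) z = Ψ ξ z + Ψ ζ z := by
    intro z hz ξ ζ
    refine tendsto_nhds_unique (hΨlim _ z hz) (((hΨlim ξ z hz).add (hΨlim ζ z hz)).congr fun n => ?_)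
    have hδ : (0 : ℝ) < 1 / ((n : ℝ) + 1) := by positivity
    rw [mollify, mollify, mollify, ← integral_add (integrable_mollify hδ (hkc ξ) (hkC ξ) z)
      (integrable_mollify hδ (hkc ζ) (hkC ζ) z)]
    congr 1 with t
    simp only [hk]
    rw [← smul_add, ← hηadd, ← SmoothVec.actₗ_apply, ← SmoothVec.actₗ_apply, ← map_add]
    rfl
  have hΨsmul : ∀ z ∈ Complex.im ⁻¹' Icc 0 Real.pi, ∀ (a : ℂ) ξ, Ψ (a • ξ) z = conj a * Ψ ξ z := by
    intro z hz a ξ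
    refine tendsto_nhds_unique (hΨlim _ z hz) (((hΨlim ξ z hz).const_mul (conj a)).congr fun n => ?_)
    rw [mollify, mollify, ← integral_const_mul]
    congr 1 with t
    simp only [hk]
    rw [← SmoothVec.actₗ_apply, ← SmoothVec.actₗ_apply, map_smul, hηsmul, smul_eq_mul, smul_eq_mul]
    ring
  have hΨle : ∀ z ∈ Complex.im ⁻¹' Icc 0 Real.pi, ∃ K : ℝ, ∀ ξ, ‖Ψ ξ z‖ ≤ K * N ξ := by
    intro z hz
    refine ⟨‖Complex.exp (z ^ 2)‖ * (gaussMoment 1 c * Real.exp (c ^ 2) * Real.exp (Real.pi ^ 2)),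
      fun ξ => le_of_tendsto (hΨlim ξ z hz).norm (Eventually.of_forall fun n => ?_)⟩
    have hδ : (0 : ℝ) < 1 / ((n : ℝ) + 1) := by positivity
    have hδ1 : 1 / ((n : ℝ) + 1) ≤ 1 := by
      rw [div_le_one (by positivity)]; linarith [n.cast_nonneg (α := ℝ)]
    have h1 := norm_exp_mul_mollify_strip_le (hkc ξ) hc (hNn ξ) (hkC ξ) (hlC ξ) (hstrip ξ) hδ hδ1 hz
    have h2 : mollify (1 / ((n : ℝ) + 1)) (k ξ) z =
        Complex.exp (z ^ 2) * (Complex.exp (-z ^ 2) * mollify (1 / ((n : ℝ) + 1)) (k ξ) z) := by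
      rw [← mul_assoc, ← Complex.exp_add]; simp
    rw [h2, norm_mul]
    calc _ ≤ ‖Complex.exp (z ^ 2)‖ *
          (N ξ * (gaussMoment 1 c * Real.exp (c ^ 2)) * Real.exp (Real.pi ^ 2)) := by gcongr
      _ = _ := by ring
  have hNc : Continuous N := hPc.add (hPc.comp ρ.continuous_smoothJ)
  have hN0 : N 0 = 0 := by
    have : ρ.smoothJ 0 = 0 := Subtype.val_injective (ρ.J.map_zero)
    simp only [hN, this, hP0, add_zero]
  refine ⟨hη, fun z ξ => Ψ ξ z, fun z hz0 hzπ => ⟨hΨadd z ⟨hz0, hzπ⟩, hΨsmul z ⟨hz0, hzπ⟩, ?_⟩,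
    fun t => funext fun ξ => hΨ0 ξ t, hΨcont, hΨdiff, fun t => funext fun ξ => ?_⟩
  · obtain ⟨K, hK⟩ := hΨle z ⟨hz0, hzπ⟩
    refine continuous_iff_continuousAt.2 fun ξ₀ => ?_
    -- By additivity, continuity at `ξ₀` reduces to the bound `K * N` near `0`.
    have h1 : Tendsto (fun ξ => K * N (ξ - ξ₀)) (𝓝 ξ₀) (𝓝 0) := by
      have := (continuous_const (y := K)).mul (hNc.comp (SmoothVec.continuous_sub_const ξ₀))
      have h0 : K * N (ξ₀ - ξ₀) = 0 := by rw [sub_self, hN0, mul_zero]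
      exact h0 ▸ this.tendsto ξ₀
    refine tendsto_iff_norm_sub_tendsto_zero.2 (squeeze_zero (fun _ => norm_nonneg _) (fun ξ => ?_) h1)
    have h2 := hΨadd z ⟨hz0, hzπ⟩ (ξ - ξ₀) ξ₀
    rw [sub_add_cancel] at h2
    change ‖Ψ ξ z - Ψ ξ₀ z‖ ≤ _
    rw [h2, add_sub_cancel_right]
    exact hK _
  · change Ψ ξ (t + Real.pi * Complex.I) = conj (Ψ (ρ.smoothJ ξ) t)
    rw [hΨπ, hΨ0]

include hτ in
theorem mem_distKMS_iff {η : SmoothVec F ρ.U → ℂ} (hη : η ∈ distributionVectors F ρ.U) :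
    η ∈ ρ.distKMS γ ↔ ρ.GaussKMS hγ hadd η :=
  ⟨ρ.gaussKMS_of_mem_distKMS hγ hadd, ρ.mem_distKMS_of_gaussKMS hγ hadd hτ hη⟩

include hγ hadd in
theorem mem_standardSubspace_iff (v : H) : v ∈ ρ.standardSubspace γ ↔ ∀ δ : ℝ, 0 < δ →
    mollify δ (fun t => ρ.U (γ t) v) (Real.pi * Complex.I) =
      mollify δ (fun t => ρ.U (γ t) (ρ.J v)) 0 :=
  mem_expGraph_iff (V := fun t => ρ.U (γ t)) (ρ.U_add hadd)
    (fun v => (ρ.continuous_orbit v).comp hγ)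

/-- The standard subspace as a closed real subspace. -/
def standardSubmodule : Submodule ℝ H where
  carrier := ρ.standardSubspace γ
  zero_mem' := (mem_standardSubspace_iff ρ hγ hadd 0).2 fun δ _ => by simp [mollify]
  add_mem' {v w} hv hw := by
    rw [mem_standardSubspace_iff ρ hγ hadd] at hv hw ⊢
    intro δ hδ
    have hc : ∀ v : H, Continuous fun t => ρ.U (γ t) v := fun v => (ρ.continuous_orbit v).comp hγ
    have h1 := (mollifyL (fun t => ρ.U (γ t)) hc hδ (Real.pi * Complex.I)).map_add v w
    have h2 := (mollifyL (fun t => ρ.U (γ t)) hc hδ 0).map_add (ρ.J v) (ρ.J w)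
    simp only [mollifyL_apply] at h1 h2
    rw [h1, map_add, h2, hv δ hδ, hw δ hδ]
  smul_mem' a v hv := by
    rw [mem_standardSubspace_iff ρ hγ hadd] at hv ⊢
    intro δ hδ
    have hc : ∀ v : H, Continuous fun t => ρ.U (γ t) v := fun v => (ρ.continuous_orbit v).comp hγ
    have h1 := (mollifyL (fun t => ρ.U (γ t)) hc hδ (Real.pi * Complex.I)).map_smul (a : ℂ) v
    have h2 := (mollifyL (fun t => ρ.U (γ t)) hc hδ 0).map_smul (a : ℂ) (ρ.J v)
    have h3 : ρ.J (a • v) = (a : ℂ) • ρ.J v := by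
      rw [Complex.coe_smul]; exact ρ.realJ.map_smul a v
    simp only [mollifyL_apply] at h1 h2
    rw [h3, ← Complex.coe_smul, h1, h2, hv δ hδ]

include hγ hadd in
theorem isClosed_standardSubspace : IsClosed (ρ.standardSubspace γ) := by
  have hc : ∀ v : H, Continuous fun t => ρ.U (γ t) v := fun v => (ρ.continuous_orbit v).comp hγ
  have h1 : ρ.standardSubspace γ = ⋂ (δ : ℝ) (hδ : 0 < δ),
      {v | mollifyL (fun t => ρ.U (γ t)) hc hδ (Real.pi * Complex.I) v =
        mollifyL (fun t => ρ.U (γ t)) hc hδ 0 (ρ.J v)} := by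
    ext v
    rw [mem_standardSubspace_iff ρ hγ hadd]
    simp only [mem_iInter]
    rfl
  rw [h1]
  exact isClosed_iInter fun δ => isClosed_iInter fun hδ =>
    isClosed_eq (ContinuousLinearMap.continuous _)
      ((ContinuousLinearMap.continuous _).comp ρ.J.continuous)

include hτ in
-- For `η = ⟨·, v⟩` the scalar equations are the inner products of smooth vectors with the vector
-- equation that characterizes `V`; density of the smooth vectors makes the two equivalent.
theorem mem_standardSubspace_iff_gaussKMS [T2Space G] [MeasurableSpace G] [BorelSpace G]
    (μ : Measure G) [μ.IsHaarMeasure] (v : H) :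
    v ∈ ρ.standardSubspace γ ↔ ρ.GaussKMS hγ hadd (toFunctional F ρ.U v) := by
  have hc : ∀ v : H, Continuous fun t => ρ.U (γ t) v := fun v => (ρ.continuous_orbit v).comp hγ
  rw [mem_standardSubspace_iff ρ hγ hadd, gaussKMS_iff ρ hγ hadd hτ (toFunctional_mem v)]
  refine forall_congr' fun δ => forall_congr' fun hδ => ?_
  have h1 : ∀ (ξ : SmoothVec F ρ.U) t, toFunctional F ρ.U v (smoothAct ρ.U (γ t)⁻¹ ξ) =
      inner ℂ ξ.toH (ρ.U (γ t) v) := by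
    intro ξ t
    rw [toFunctional, SmoothVec.toH_smoothAct, map_inv]
    exact LinearIsometryEquiv.inner_map_eq_flip _ _ _
  have h2 : ∀ (ξ : SmoothVec F ρ.U) t,
      conj (toFunctional F ρ.U v (smoothAct ρ.U (γ t)⁻¹ (ρ.smoothJ ξ))) =
        inner ℂ ξ.toH (ρ.U (γ t) (ρ.J v)) := by
    intro ξ t
    rw [h1, toH_smoothJ, conj_inner_J, J_U, hτ]
  have h3 : ∀ (ξ w : H) (z : ℂ), mollify δ (fun t => inner ℂ ξ (ρ.U (γ t) w)) z =
      inner ℂ ξ (mollify δ (fun t => ρ.U (γ t) w) z) := by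
    intro ξ w z
    have := (innerSL ℂ ξ).integral_comp_comm (integrable_mollify hδ (hc w) (norm_orbit_le _ w) z)
    refine Eq.trans ?_ this
    rw [mollify]
    congr 1 with t
    rw [innerSL_apply_apply, inner_smul_right, smul_eq_mul]
  simp only [h2]
  simp only [h1, h3]
  refine ⟨fun h ξ => by rw [h], fun h => ?_⟩
  exact (dense_smoothVectors (F := F) μ ρ.continuous_orbit).eq_of_inner_right (𝕜 := ℂ)
    fun ξ hξ => h ⟨ξ, hξ⟩

/-- Evaluation takes place at two smooth vectors independent of `g`, so the equation is integrated
pointwise; conjugation is harmless because `φ` is real. -/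
theorem gaussKMS_distInt [MeasurableSpace G] {μ : Measure G} {O : Set G}
    {φ : G → ℝ} (hφ : φ ∈ testFunctions F O) {η : SmoothVec F ρ.U → ℂ}
    (h : ∀ g ∈ O, ρ.GaussKMS hγ hadd (distAct ρ.U g η)) :
    ρ.GaussKMS hγ hadd (distInt ρ.U μ φ η) := by
  intro δ hδ ξ
  rw [distInt, distInt, ← integral_conj]
  congr 1 with g
  by_cases hg : g ∈ tsupport φ
  · rw [h g (hφ.2.2 hg) δ hδ ξ, map_mul, Complex.conj_ofReal]
  · simp [image_eq_zero_of_notMem_tsupport hg]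

theorem eq_zero_of_integral_testFunctions [T2Space G] [MeasurableSpace G] [BorelSpace G]
    (μ : Measure G) [μ.IsHaarMeasure] {O : Set G} (hO : IsOpen O) {D : G → ℂ} (hD : Continuous D)
    (h : ∀ φ ∈ testFunctions F O, ∫ g, (φ g : ℂ) * D g ∂μ = 0) : ∀ g ∈ O, D g = 0 := by
  intro g₀ hg₀
  by_contra hne
  -- Rotating the phase makes the real part positive at `g₀`, hence near `g₀`; a bump function
  -- supported there would have a positive integral against it.
  set R : G → ℝ := fun g => (conj (D g₀) * D g).re with hR
  have hRc : Continuous R := Complex.continuous_re.comp (continuous_const.mul hD)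
  have hR0 : 0 < R g₀ := by
    simp only [hR, ← Complex.normSq_eq_conj_mul_self, Complex.ofReal_re]
    exact Complex.normSq_pos.2 hne
  have hnhds : O ∩ {g | 0 < R g} ∈ 𝓝 g₀ :=
    (hO.inter (isOpen_lt continuous_const hRc)).mem_nhds ⟨hg₀, hR0⟩
  obtain ⟨f, -, hf⟩ := (SmoothBumpFunction.nhds_basis_tsupport (I := 𝓘(ℝ, F)) g₀).mem_iff.1 hnhds
  have : IsManifold 𝓘(ℝ, F) ∞ G := LieGroup.toContMDiffMul.toIsManifold
  have hpos : 0 < ∫ g, f g * R g ∂μ := by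
    refine (f.continuous.mul hRc).integral_pos_of_hasCompactSupport_nonneg_nonzero
      f.hasCompactSupport.mul_right (fun g => ?_) (x := g₀) ?_
    · by_cases hg : g ∈ tsupport f
      · exact mul_nonneg f.nonneg (hf hg).2.le
      · simp [image_eq_zero_of_notMem_tsupport hg]
    · simp [hR0.ne']
  have hint : Integrable (fun g => (f g : ℂ) * D g) μ := by
    refine ((Complex.continuous_ofReal.comp f.continuous).mul hD).integrable_of_hasCompactSupport
      (HasCompactSupport.mul_right ?_)
    exact f.hasCompactSupport.comp_left (g := fun r : ℝ => (r : ℂ)) Complex.ofReal_zero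
  have h1 := h f ⟨f.contMDiff, f.hasCompactSupport, fun g hg => (hf hg).1⟩
  have h2 : ∫ g, f g * R g ∂μ = (conj (D g₀) * ∫ g, (f g : ℂ) * D g ∂μ).re := by
    rw [← integral_const_mul]
    refine Eq.trans ?_ (integral_re (𝕜 := ℂ) (hint.const_mul (conj (D g₀))))
    congr 1 with g
    simp only [hR, RCLike.re_to_complex]
    rw [← Complex.re_ofReal_mul]
    congr 1
    ring
  rw [h1, mul_zero, Complex.zero_re] at h2
  exact hpos.ne' h2

/-- The difference of the two sides of the equation is continuous in `g` and integrates to zero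
against every test function on `O`. -/
theorem gaussKMS_distAct [T2Space G] [MeasurableSpace G] [BorelSpace G] (μ : Measure G)
    [μ.IsHaarMeasure] {O : Set G} (hO : IsOpen O) {η : SmoothVec F ρ.U → ℂ}
    (hη : η ∈ distributionVectors F ρ.U)
    (h : ∀ φ ∈ testFunctions F O, ρ.GaussKMS hγ hadd (distInt ρ.U μ φ η)) {g : G} (hg : g ∈ O) :
    ρ.GaussKMS hγ hadd (distAct ρ.U g η) := by
  have : IsTopologicalGroup G := topologicalGroup_of_lieGroup 𝓘(ℝ, F) ∞
  intro δ hδ ξ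
  have hc : ∀ ζ : SmoothVec F ρ.U, Continuous fun g => distAct ρ.U g η ζ := fun ζ =>
    (continuous_distribution_orbit ρ.continuous_orbit hη ζ).comp continuous_inv
  set ζ₁ := ρ.gaussVec hγ hadd hδ (Real.pi * Complex.I) ξ
  set ζ₂ := ρ.smoothJ (ρ.gaussVec hγ hadd hδ 0 ξ)
  refine sub_eq_zero.1 (eq_zero_of_integral_testFunctions (F := F) μ hO
    (D := fun g => distAct ρ.U g η ζ₁ - conj (distAct ρ.U g η ζ₂))
    ((hc ζ₁).sub (Complex.continuous_conj.comp (hc ζ₂))) (fun φ hφ => ?_) g hg)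
  have hint : ∀ D : G → ℂ, Continuous D → Integrable (fun g => (φ g : ℂ) * D g) μ := by
    intro D hD
    refine ((Complex.continuous_ofReal.comp hφ.1.continuous).mul hD).integrable_of_hasCompactSupport
      (HasCompactSupport.mul_right ?_)
    exact hφ.2.1.comp_left (g := fun r : ℝ => (r : ℂ)) Complex.ofReal_zero
  simp only [mul_sub]
  have hi₂ : Integrable (fun g => (φ g : ℂ) * conj (distAct ρ.U g η ζ₂)) μ :=
    hint _ (Complex.continuous_conj.comp (hc ζ₂))
  rw [integral_sub (hint _ (hc ζ₁)) hi₂, sub_eq_zero]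
  have h1 := h φ hφ δ hδ ξ
  rw [distInt, distInt, ← integral_conj] at h1
  refine h1.trans ?_
  congr 1 with g
  rw [map_mul, Complex.conj_ofReal]

end AntiunitaryRep

end KMSCondition

end

/-! ### The equivalence of the four conditions -/

theorem proposition4
    {F : Type*} [NormedAddCommGroup F] [NormedSpace ℝ F] [FiniteDimensional ℝ F]
    {G : Type*} [TopologicalSpace G] [ChartedSpace F G] [Group G] [LieGroup 𝓘(ℝ, F) ∞ G]
    [T2Space G] [ConnectedSpace G] [MeasurableSpace G] [BorelSpace G]
    (μ : MeasureTheory.Measure G) [μ.IsHaarMeasure]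
    {H : Type*} [NormedAddCommGroup H] [InnerProductSpace ℂ H] [CompleteSpace H]
    (ρ : AntiunitaryRep F G H)
    (h : GroupLieAlgebra 𝓘(ℝ, F) G) (γ : ℝ → G) (hγ : IsExpCurve F h γ)
    (hτ : ∀ t : ℝ, ρ.τ (γ t) = γ t)
    (O : Set G) (hO : IsOpen O)
    (E : Submodule ℝ (SmoothVec F ρ.U → ℂ)) (hE : ∀ η ∈ E, η ∈ distributionVectors F ρ.U) :
    [ (netSpace ρ.U μ E O : Set H) ⊆ ρ.standardSubspace γ,
      ∀ φ ∈ testFunctions F O, ∀ η ∈ E,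
        ∃ v ∈ ρ.standardSubspace γ, toFunctional F ρ.U v = distInt ρ.U μ φ η,
      ∀ φ ∈ testFunctions F O, ∀ η ∈ E, distInt ρ.U μ φ η ∈ ρ.distKMS γ,
      ∀ g ∈ O, ∀ η ∈ E, distAct ρ.U g η ∈ ρ.distKMS γ ].TFAE := by
  have hγc : Continuous γ := hγ.contMDiff.continuous
  have hadd := hγ.map_add
  have htest : ∀ φ ∈ testFunctions F O, φ ∈ testFunctions F (Set.univ : Set G) := fun φ hφ =>
    ⟨hφ.1, hφ.2.1, Set.subset_univ _⟩
  have hvec : ∀ φ ∈ testFunctions F O, ∀ η ∈ E,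
      ∃ v : H, toFunctional F ρ.U v = distInt ρ.U μ φ η := fun φ hφ η hη =>
    exists_toFunctional_eq_distInt ρ.continuous_orbit (hE η hη) μ (htest φ hφ)
  have hKMS : ∀ v : H, v ∈ ρ.standardSubspace γ ↔ toFunctional F ρ.U v ∈ ρ.distKMS γ := fun v =>
    (ρ.mem_standardSubspace_iff_gaussKMS hγc hadd hτ μ v).trans
      (ρ.mem_distKMS_iff hγc hadd hτ (toFunctional_mem v)).symm
  tfae_have 1 → 2 := by
    intro h1 φ hφ η hη
    obtain ⟨v, hv⟩ := hvec φ hφ η hη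
    exact ⟨v, h1 (Submodule.le_topologicalClosure _ (Submodule.subset_span ⟨φ, hφ, η, hη, hv⟩)), hv⟩
  tfae_have 2 → 1 := by
    intro h2
    refine Submodule.topologicalClosure_minimal (t := ρ.standardSubmodule hγc hadd) _
      (Submodule.span_le.2 ?_) (ρ.isClosed_standardSubspace hγc hadd)
    rintro v ⟨φ, hφ, η, hη, hv⟩
    obtain ⟨w, hw, hw'⟩ := h2 φ hφ η hη
    -- Density of the smooth vectors makes the vector representing `U^{-∞}(φ)η` unique, so `v` is
    -- the element of `V` supplied by the hypothesis.
    rw [toFunctional_injective μ ρ.continuous_orbit (hv.trans hw'.symm)]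
    exact hw
  tfae_have 2 → 3 := by
    intro h2 φ hφ η hη
    obtain ⟨v, hv, hv'⟩ := h2 φ hφ η hη
    rw [← hv']
    exact (hKMS v).1 hv
  tfae_have 3 → 2 := by
    intro h3 φ hφ η hη
    obtain ⟨v, hv⟩ := hvec φ hφ η hη
    exact ⟨v, (hKMS v).2 (hv ▸ h3 φ hφ η hη), hv⟩
  tfae_have 3 → 4 := by
    intro h3 g hg η hη
    refine ρ.mem_distKMS_of_gaussKMS hγc hadd hτ (distAct_mem (hE η hη) g) ?_
    exact ρ.gaussKMS_distAct hγc hadd μ hO (hE η hη)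
      (fun φ hφ => ρ.gaussKMS_of_mem_distKMS hγc hadd (h3 φ hφ η hη)) hg
  tfae_have 4 → 3 := by
    intro h4 φ hφ η hη
    -- The representing vector serves only to show that `U^{-∞}(φ)η` is a distribution vector.
    obtain ⟨v, hv⟩ := hvec φ hφ η hη
    refine ρ.mem_distKMS_of_gaussKMS hγc hadd hτ (hv ▸ toFunctional_mem v) ?_
    exact ρ.gaussKMS_distInt hγc hadd hφ
      fun g hg => ρ.gaussKMS_of_mem_distKMS hγc hadd (h4 g hg η hη)
  tfae_finish
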